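/- Let $n\ge 0$. An $m$-polygon $p$ in $\mathbb R^n$ is given by its vertices $p_1,\dots,p_m\in\mathbb R^n$, with indices taken modulo $m$. Put $$g_{ij}=\frac{\|p_j-p_i\|\,\|p_{j+1}-p_{i+1}\|}{\|p_{i+1}-p_i\|\,\|p_{j+1}-p_j\|},\qquad \Delta_i u_{ij}=u_{i+1,j}-u_{ij},\qquad \Delta_j u_{ij}=u_{i,j+1}-u_{ij},$$ and define the discrete energies $$\mathcal E_1^m(p)=\sum_{i\ne j}\frac1{g_{ij}}\Bigl(1+\tfrac12\Delta_i\Delta_j g_{ij}\Bigr),\qquad \mathcal E_2^m(p)=-\sum_{i\ne j}\frac1{2g_{ij}^2}\left\{\det\begin{pmatrix}\Delta_i\Delta_j g_{ij}&\Delta_i g_{ij}\\ \Delta_j g_{ij}&2g_{ij}\end{pmatrix}+1\right\},$$ $$\mathcal E^m(p)=\mathcal E_1^m(p)+\mathcal E_2^m(p)+4,$$ with the convention $x/0=0$ when vertices coincide. For a closed curve $f:\mathbb R/\mathbb Z\to\mathbb R^n$ and $0\le\theta_1<\dots<\theta_m<1$ let $P_m(f)$ be the $m$-polygon with $i$-th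 vertex $f(\theta_i)$. A real-valued function $F$ of $m$-polygons is called Möbius invariant if $F(P_m(f))=F(P_m(Tf))$ for all continuous closed curves $f$, all such $\{\theta_i\}$, and all Möbius transformations $T$ of $\mathbb R^n\cup\{\infty\}$ (finite compositions of inversions in spheres and reflections in hyperplanes) that map $\mathrm{Im}(f)$ into $\mathbb R^n$. For a closed curve $f$ let $\tau=f'/\|f'\|$, $ds_k=\|f'(\theta_k)\|\,d\theta_k$, $\Delta f=f(\theta_1)-f(\theta_2)$, $\Delta\tau=\tau(\theta_1)-\tau(\theta_2)$, let $\mathscr D(\theta_1,\theta_2)$ be the length of the shorter arc of the curve between $f(\theta_1)$ and $f(\theta_2)$, and put $$\mathcal E(f)=\iint_{(\mathbb R/\mathbb Z)^2}\Bigl(\frac1{\|\Delta f\|^2}-\frac1{\mathscr D(\theta_1,\theta_2)^2}\Bigr)ds_1ds_2,\qquad \mathcal E_1(f)=\frac12\iint_{(\mathbb R/\mathbb Z)^2}\frac{\|\Delta\tau\|^2}{\|\Delta f\|^2}\,ds_1ds_2,$$ $$\mathcal E_2(f)=\iint_{(\mathbb R/\mathbb Z)^2}\frac2{\|\Delta f\|^2}\Bigl\langle\tau(\theta_1)\wedge\frac{\Delta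 f}{\|\Delta f\|},\ \tau(\theta_2)\wedge\frac{\Delta f}{\|\Delta f\|}\Bigr\rangle_{\bigwedge^2\mathbb R^n}ds_1ds_2 .$$ Then: 1. $\mathcal E^m=\mathcal E_1^m+\mathcal E_2^m+4$ for every $m$. 2. $\mathcal E^m$, $\mathcal E_1^m$ and $\mathcal E_2^m$ are Möbius invariant for every $m$. 3. Let $f\in W^{2,\infty}(\mathbb R/\mathbb Z;\mathbb R^n)$ be bi-Lipschitz, i.e. there are $L_1,L_2>0$ with $L_1\,d_{\mathbb R/\mathbb Z}(s,t)\le\|f(s)-f(t)\|\le L_2\,d_{\mathbb R/\mathbb Z}(s,t)$ for all $s,t$. Then the integrals defining $\mathcal E(f)$, $\mathcal E_1(f)$, $\mathcal E_2(f)$ converge absolutely. Suppose moreover that for all sufficiently large $m$ numbers $0\le\theta_1^{(m)}<\dots<\theta_m^{(m)}<1$ are given such that the polygon $P_m(f)$ with $i$-th vertex $f(\theta_i^{(m)})$ is equilateral, i.e. each of its $m$ edges, including the one from the last vertex to the first, has length $L_m/m$, where $L_m$ is the total length of $P_m(f)$. Then, as $m\to\infty$, $$\mathcal E^m(P_m(f))\to\mathcal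 E(f),\qquad \mathcal E_1^m(P_m(f))\to\mathcal E_1(f),\qquad \mathcal E_2^m(P_m(f))\to\mathcal E_2(f).$$ -/

import Mathlib

open scoped ContDiff

noncomputable section

namespace DiscreteMoebius

/-- Euclidean space `ℝⁿ`. -/
abbrev Space (n : ℕ) := EuclideanSpace ℝ (Fin n)

/-- An `m`-polygon in `ℝⁿ`, given by its vertices; vertex indices are cyclic modulo `m`. -/
abbrev Polygon (m n : ℕ) := Fin m → Space n

/-- The cyclic successor `i + 1` of a vertex index (the last index is followed by the first). -/
def next {m : ℕ} (i : Fin m) : Fin m := finRotate m i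

/-! ### Discrete energies -/

/-- The cross ratio `g i j` of the vertices `i`, `i + 1`, `j`, `j + 1`. -/
def crossRatio {m n : ℕ} (p : Polygon m n) (i j : Fin m) : ℝ :=
  (‖p j - p i‖ * ‖p (next j) - p (next i)‖) / (‖p (next i) - p i‖ * ‖p (next j) - p j‖)

/-- The forward difference of a doubly indexed sequence in the first index. -/
def diffFst {m : ℕ} (u : Fin m → Fin m → ℝ) (i j : Fin m) : ℝ := u (next i) j - u i j

/-- The forward difference of a doubly indexed sequence in the second index. -/
def diffSnd {m : ℕ} (u : Fin m → Fin m → ℝ) (i j : Fin m) : ℝ := u i (next j) - u i j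

/-- The first component of the discrete energy. -/
def discreteEnergy₁ (m n : ℕ) (p : Polygon m n) : ℝ :=
  ∑ i : Fin m, ∑ j : Fin m with i ≠ j,
    (1 / crossRatio p i j) * (1 + (1 / 2) * diffFst (diffSnd (crossRatio p)) i j)

/-- The second component of the discrete energy. -/
def discreteEnergy₂ (m n : ℕ) (p : Polygon m n) : ℝ :=
  - ∑ i : Fin m, ∑ j : Fin m with i ≠ j,
    (1 / (2 * crossRatio p i j ^ 2)) *
      (Matrix.det !![diffFst (diffSnd (crossRatio p)) i j, diffFst (crossRatio p) i j;
                     diffSnd (crossRatio p) i j, 2 * crossRatio p i j] + 1)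

/-- The discrete energy. -/
def discreteEnergy (m n : ℕ) (p : Polygon m n) : ℝ :=
  discreteEnergy₁ m n p + discreteEnergy₂ m n p + 4

/-! ### Möbius transformations and Möbius invariance -/

/-- The inversion of `ℝⁿ ∪ {∞}` in the sphere with centre `c` and radius `R`; it exchanges
`c` and `∞`. -/
def sphereInversion {n : ℕ} (c : Space n) (R : ℝ) (x : OnePoint (Space n)) : OnePoint (Space n) :=
  open Classical in
  x.elim (c : OnePoint (Space n))
    (fun y => if y = c then OnePoint.infty else (EuclideanGeometry.inversion c R y : Space n))

/-- The reflection of `ℝⁿ ∪ {∞}` in the hyperplane `{y | ⟪v, y⟫ = a}` with unit normal `v`;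
it fixes `∞`. -/
def hyperplaneReflection {n : ℕ} (v : Space n) (a : ℝ) (x : OnePoint (Space n)) :
    OnePoint (Space n) :=
  x.elim OnePoint.infty (fun y => ((y - (2 * (inner ℝ v y - a)) • v : Space n)))

/-- A Möbius transformation of `ℝⁿ ∪ {∞}`: a finite composition of inversions in spheres and
reflections in hyperplanes. -/
inductive IsMoebius {n : ℕ} : (OnePoint (Space n) → OnePoint (Space n)) → Prop
  | id : IsMoebius id
  | inversion (T : OnePoint (Space n) → OnePoint (Space n)) (c : Space n) (R : ℝ) (hR : 0 < R)
      (hT : IsMoebius T) : IsMoebius (sphereInversion c R ∘ T)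
  | reflection (T : OnePoint (Space n) → OnePoint (Space n)) (v : Space n) (a : ℝ) (hv : ‖v‖ = 1)
      (hT : IsMoebius T) : IsMoebius (hyperplaneReflection v a ∘ T)

/-- Admissible parameters of the vertices: `0 ≤ θ₁ < θ₂ < ⋯ < θₘ < 1`. -/
def IsSubdivision {m : ℕ} (θ : Fin m → ℝ) : Prop :=
  StrictMono θ ∧ ∀ i, θ i ∈ Set.Ico (0 : ℝ) 1

/-- The `m`-polygon with `i`-th vertex `f (θ i)`, for a closed curve `f : ℝ/ℤ → ℝⁿ`. -/
def inscribedPolygon {m n : ℕ} (f : UnitAddCircle → Space n) (θ : Fin m → ℝ) : Polygon m n :=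
  fun i => f (θ i : UnitAddCircle)

/-- Möbius invariance of a discrete energy: `F (P_m(f)) = F (P_m(T f))` for all closed curves `f`,
all admissible parameters and all Möbius transformations `T` with `T (Im f) ⊆ ℝⁿ`. The curve `h`
is `T f`, viewed as a curve in `ℝⁿ`. -/
def IsMoebiusInvariant {m n : ℕ} (F : Polygon m n → ℝ) : Prop :=
  ∀ (f h : UnitAddCircle → Space n) (θ : Fin m → ℝ) (T : OnePoint (Space n) → OnePoint (Space n)),
    Continuous f → IsSubdivision θ → IsMoebius T →
    (∀ t, T (f t : OnePoint (Space n)) = (h t : OnePoint (Space n))) →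
    F (inscribedPolygon f θ) = F (inscribedPolygon h θ)

/-! ### Closed curves and their energies -/

/-- The `1`-periodic lift to `ℝ` of a closed curve. -/
def lift {n : ℕ} (f : UnitAddCircle → Space n) (t : ℝ) : Space n := f (t : UnitAddCircle)

/-- The speed `‖f'‖`. -/
def speed {n : ℕ} (f : UnitAddCircle → Space n) (t : ℝ) : ℝ := ‖deriv (lift f) t‖

/-- The unit tangent vector `τ = f' / ‖f'‖`. -/
def tangent {n : ℕ} (f : UnitAddCircle → Space n) (t : ℝ) : Space n :=
  (speed f t)⁻¹ • deriv (lift f) t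

/-- The total length of the curve. -/
def curveLength {n : ℕ} (f : UnitAddCircle → Space n) : ℝ := ∫ t in (0 : ℝ)..1, speed f t

/-- The intrinsic distance of `f s` and `f t` for `s, t ∈ [0, 1]`: the length of the shorter of
the two arcs of the curve between them. -/
def intrinsicDist {n : ℕ} (f : UnitAddCircle → Space n) (s t : ℝ) : ℝ :=
  min |∫ r in s..t, speed f r| (curveLength f - |∫ r in s..t, speed f r|)

/-- The fundamental domain `[0, 1]²` of `(ℝ/ℤ)²`. -/
def unitSquare : Set (ℝ × ℝ) := Set.Icc 0 1 ×ˢ Set.Icc 0 1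

/-- The integrand of the Möbius energy with respect to `dθ₁ dθ₂`; the arc length elements are
`ds = ‖f'(θ)‖ dθ`. -/
def moebiusDensity {n : ℕ} (f : UnitAddCircle → Space n) (x : ℝ × ℝ) : ℝ :=
  (1 / ‖lift f x.1 - lift f x.2‖ ^ 2 - 1 / intrinsicDist f x.1 x.2 ^ 2)
    * (speed f x.1 * speed f x.2)

/-- The integrand of the first component, with respect to `dθ₁ dθ₂`. -/
def moebiusDensity₁ {n : ℕ} (f : UnitAddCircle → Space n) (x : ℝ × ℝ) : ℝ :=
  (‖tangent f x.1 - tangent f x.2‖ ^ 2 / ‖lift f x.1 - lift f x.2‖ ^ 2)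
    * (speed f x.1 * speed f x.2)

/-- The normalized chord `Δf / ‖Δf‖`. -/
def chordDirection {n : ℕ} (f : UnitAddCircle → Space n) (x : ℝ × ℝ) : Space n :=
  ‖lift f x.1 - lift f x.2‖⁻¹ • (lift f x.1 - lift f x.2)

/-- The bivector `v ∧ w` in `⋀² ℝⁿ`, which carries its canonical inner product. -/
def wedge {n : ℕ} (v w : Space n) : ⋀[ℝ]^2 (Space n) := exteriorPower.ιMulti ℝ 2 ![v, w]

/-- The integrand of the second component, with respect to `dθ₁ dθ₂`. -/
def moebiusDensity₂ {n : ℕ} (f : UnitAddCircle → Space n) (x : ℝ × ℝ) : ℝ :=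
  (2 / ‖lift f x.1 - lift f x.2‖ ^ 2
      * inner ℝ (wedge (tangent f x.1) (chordDirection f x))
                (wedge (tangent f x.2) (chordDirection f x)))
    * (speed f x.1 * speed f x.2)

/-- The Möbius energy `𝓔`. -/
def moebiusEnergy {n : ℕ} (f : UnitAddCircle → Space n) : ℝ :=
  ∫ x in unitSquare, moebiusDensity f x

/-- The first component `𝓔₁` of the Möbius energy. -/
def moebiusEnergy₁ {n : ℕ} (f : UnitAddCircle → Space n) : ℝ :=
  (1 / 2) * ∫ x in unitSquare, moebiusDensity₁ f x

/-- The second component `𝓔₂` of the Möbius energy. -/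
def moebiusEnergy₂ {n : ℕ} (f : UnitAddCircle → Space n) : ℝ :=
  ∫ x in unitSquare, moebiusDensity₂ f x

/-! ### Regularity and equilateral polygons -/

/-- `g` is a weak derivative of `u` on `ℝ`. -/
def HasWeakDeriv {n : ℕ} (u g : ℝ → Space n) : Prop :=
  MeasureTheory.LocallyIntegrable u ∧ MeasureTheory.LocallyIntegrable g ∧
    ∀ φ : ℝ → ℝ, ContDiff ℝ ∞ φ → HasCompactSupport φ →
      ∫ t, deriv φ t • u t = - ∫ t, φ t • g t

/-- `f ∈ W^{2,∞}(ℝ/ℤ; ℝⁿ)`: the periodic lift has weak derivatives up to order two, and all of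
them are essentially bounded. -/
def MemW2Infty {n : ℕ} (f : UnitAddCircle → Space n) : Prop :=
  MeasureTheory.MemLp (lift f) ⊤ ∧
    ∃ g h : ℝ → Space n, MeasureTheory.MemLp g ⊤ ∧ MeasureTheory.MemLp h ⊤ ∧
      HasWeakDeriv (lift f) g ∧ HasWeakDeriv g h

/-- The bi-Lipschitz estimate with respect to the distance of `ℝ/ℤ`. -/
def IsBiLipschitz {n : ℕ} (f : UnitAddCircle → Space n) : Prop :=
  ∃ L₁ L₂ : ℝ, 0 < L₁ ∧ 0 < L₂ ∧
    ∀ s t : UnitAddCircle, L₁ * dist s t ≤ ‖f s - f t‖ ∧ ‖f s - f t‖ ≤ L₂ * dist s t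

/-- The total length of a (closed) polygon. -/
def polygonLength {m n : ℕ} (p : Polygon m n) : ℝ := ∑ i, ‖p (next i) - p i‖

/-- The equilateral condition: every edge has length `L_m / m`. -/
def IsEquilateral {m n : ℕ} (p : Polygon m n) : Prop :=
  ∀ i, ‖p (next i) - p i‖ = polygonLength p / m

end DiscreteMoebius

end

open scoped ContDiff

noncomputable section

namespace DiscreteMoebius

section

/-! ### Möbius invariance -/

/-! Möbius invariance. Extend the distance to ℝⁿ ∪ {∞} by giving finite points distance 1 from ∞.
Inversions and reflections then multiply the distance of x and y by w(x)w(y) with a positive weight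
w (`IsMoebius.hasConformalWeight`). In the cross ratio each of the four vertices occurs once above
and once below, so the weights cancel. All three energies are functions of the cross ratios alone.

Regularity. A continuous W^{2,∞} curve is a C^{1,1} curve (`exists_hasDerivAt_lipschitz`). With the
bi-Lipschitz bound this gives quantitative control of chords: chord directions inside a parameter
window of length H differ by O(H), so the triangle inequality for a chord prolonged by an edge ℓ is
an equality up to ℓ · O(H²).

Convergence of the components. Unroll the subdivision to ℤ and write the double sum as the integral
over [0,1]² of the step function whose value on a product of cells is the summand divided by the two
parameter gaps. Off the diagonal it converges pointwise to the continuous density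
(`tendsto_energyTerm_div`). Up to the diagonal the summands are bounded by Cℓ²
(`exists_energyTerm_le`) while each gap is at least ℓ/L, so the step functions are uniformly bounded
and dominated convergence applies (`tendsto_sum_term`). The uniform bound is the delicate point: for
equally spaced collinear vertices both summands vanish exactly, and the error has to be tracked
through the triangle defects (`abs_energy_bracket_le`).

The full energy. It remains to see 𝓔 = 𝓔₁ + 𝓔₂ + 4 for the curve itself (`moebiusEnergy_eq`). The
difference of the densities is the mixed derivative of log ‖Δf‖ minus the density of 1/𝒟². For fixed
x it is the y-derivative of an explicit function on each of the two half curves starting at x. The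
singularities at the diagonal cancel, the chord terms at the point opposite to x cancel, and the arc
terms there leave 4 · speed(x) / length, whose integral over x is 4. -/

/-- The distance of two points of `ℝⁿ`, extended to `ℝⁿ ∪ {∞}` by homogeneity: finite points have
distance `1` from `∞`. -/
def homDist {n : ℕ} (x y : OnePoint (Space n)) : ℝ :=
  x.elim (y.elim 0 fun _ => 1) fun a => y.elim 1 fun b => ‖b - a‖

@[simp] lemma homDist_coe_coe {n : ℕ} (a b : Space n) :
    homDist (a : OnePoint (Space n)) (b : OnePoint (Space n)) = ‖b - a‖ := rfl

@[simp] lemma homDist_coe_infty {n : ℕ} (a : Space n) :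
    homDist (a : OnePoint (Space n)) OnePoint.infty = 1 := rfl

@[simp] lemma homDist_infty_coe {n : ℕ} (a : Space n) :
    homDist OnePoint.infty (a : OnePoint (Space n)) = 1 := rfl

@[simp] lemma homDist_infty_infty {n : ℕ} :
    homDist (OnePoint.infty : OnePoint (Space n)) OnePoint.infty = 0 := rfl

/-- A map of `ℝⁿ ∪ {∞}` is conformal for `homDist` if it scales it by a product of positive
weights. -/
def HasConformalWeight {n : ℕ} (T : OnePoint (Space n) → OnePoint (Space n)) : Prop :=
  ∃ w : OnePoint (Space n) → ℝ, (∀ x, 0 < w x) ∧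
    ∀ x y, homDist (T x) (T y) = w x * w y * homDist x y

lemma HasConformalWeight.comp {n : ℕ} {S T : OnePoint (Space n) → OnePoint (Space n)}
    (hS : HasConformalWeight S) (hT : HasConformalWeight T) : HasConformalWeight (S ∘ T) := by
  obtain ⟨v, hv, hS⟩ := hS
  obtain ⟨w, hw, hT⟩ := hT
  refine ⟨fun x => v (T x) * w x, fun x => mul_pos (hv _) (hw _), fun x y => ?_⟩
  simp only [Function.comp_apply, hS, hT]
  ring

lemma sphereInversion_coe_self {n : ℕ} (c : Space n) (R : ℝ) :
    sphereInversion c R (c : OnePoint (Space n)) = OnePoint.infty := by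
  simp [sphereInversion]

lemma sphereInversion_coe {n : ℕ} {c : Space n} (R : ℝ) {y : Space n} (hy : y ≠ c) :
    sphereInversion c R (y : OnePoint (Space n)) =
      (EuclideanGeometry.inversion c R y : Space n) := by
  simp [sphereInversion, hy]

lemma sphereInversion_infty {n : ℕ} (c : Space n) (R : ℝ) :
    sphereInversion c R OnePoint.infty = (c : OnePoint (Space n)) := rfl

/-- Away from `c` this is the distance formula of an inversion, R²‖x − y‖ / (‖x − c‖‖y − c‖), split
into weights R / ‖y − c‖. The weights 1/R at `c` and R at ∞ are chosen to make the formula hold for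
the exchanged points too. -/
lemma hasConformalWeight_sphereInversion {n : ℕ} (c : Space n) {R : ℝ} (hR : 0 < R) :
    HasConformalWeight (sphereInversion c R) := by
  classical
  refine ⟨fun x => x.elim R fun y => if y = c then 1 / R else R / ‖y - c‖, fun x => ?_,
    fun x y => ?_⟩
  · induction x using OnePoint.rec with
    | infty => exact hR
    | coe y =>
      by_cases hy : y = c
      · simp [hy, hR]
      · simp only [OnePoint.elim_some, hy, if_false]
        exact div_pos hR (norm_pos_iff.2 (sub_ne_zero.2 hy))
  · have key : ∀ y : Space n, y ≠ c → ‖y - c‖ ≠ 0 := fun y hy => norm_ne_zero_iff.2 (sub_ne_zero.2 hy)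
    have hc : ∀ y : Space n, y ≠ c →
        ‖EuclideanGeometry.inversion c R y - c‖ = R ^ 2 / ‖y - c‖ := fun y hy => by
      rw [← dist_eq_norm, EuclideanGeometry.dist_inversion_center, dist_eq_norm]
    induction x using OnePoint.rec with
    | infty =>
      induction y using OnePoint.rec with
      | infty => simp [sphereInversion_infty]
      | coe y =>
        by_cases hy : y = c
        · subst hy
          simp [sphereInversion_coe_self, sphereInversion_infty, hR.ne']
        · simp only [sphereInversion_infty, sphereInversion_coe R hy, homDist_coe_coe, hc y hy,
            OnePoint.elim_some, OnePoint.elim_infty, hy, if_false, homDist_infty_coe]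
          ring
    | coe x =>
      by_cases hx : x = c
      · subst hx
        induction y using OnePoint.rec with
        | infty => simp [sphereInversion_coe_self, sphereInversion_infty, hR.ne']
        | coe y =>
          by_cases hy : y = x
          · subst hy
            simp [sphereInversion_coe_self]
          · have := key y hy
            simp only [sphereInversion_coe_self, sphereInversion_coe R hy, homDist_infty_coe,
              OnePoint.elim_some, hy, if_false, homDist_coe_coe, if_true]
            field_simp
      · have hx' := key x hx
        induction y using OnePoint.rec with
        | infty =>
          simp only [sphereInversion_infty, sphereInversion_coe R hx, homDist_coe_coe,
            OnePoint.elim_some, OnePoint.elim_infty, hx, if_false, homDist_coe_infty]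
          rw [norm_sub_rev, hc x hx]
          ring
        | coe y =>
          by_cases hy : y = c
          · subst hy
            simp only [sphereInversion_coe_self, sphereInversion_coe R hx, homDist_coe_infty,
              OnePoint.elim_some, hx, if_false, homDist_coe_coe, if_true]
            rw [norm_sub_rev y x]
            field_simp
          · have := key y hy
            simp only [sphereInversion_coe R hx, sphereInversion_coe R hy,
              OnePoint.elim_some, hx, hy, if_false, homDist_coe_coe]
            rw [← dist_eq_norm, EuclideanGeometry.dist_inversion_inversion hy hx, dist_eq_norm,
              dist_eq_norm, dist_eq_norm]
            field_simp

lemma hasConformalWeight_hyperplaneReflection {n : ℕ} {v : Space n} (hv : ‖v‖ = 1) (a : ℝ) :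
    HasConformalWeight (hyperplaneReflection v a) := by
  refine ⟨fun _ => 1, fun _ => one_pos, fun x y => ?_⟩
  induction x using OnePoint.rec with
  | infty => induction y using OnePoint.rec <;> simp [hyperplaneReflection]
  | coe x =>
    induction y using OnePoint.rec with
    | infty => simp [hyperplaneReflection]
    | coe y =>
      simp only [hyperplaneReflection, OnePoint.elim_some, homDist_coe_coe, one_mul]
      have h : y - (2 * (inner ℝ v y - a)) • v - (x - (2 * (inner ℝ v x - a)) • v) =
          (y - x) - (2 * inner ℝ v (y - x)) • v := by
        rw [inner_sub_right]
        module
      rw [h, ← sq_eq_sq₀ (norm_nonneg _) (norm_nonneg _), norm_sub_sq_real, inner_smul_right,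
        norm_smul, hv, mul_one, Real.norm_eq_abs, sq_abs, real_inner_comm]
      ring

lemma IsMoebius.hasConformalWeight {n : ℕ} {T : OnePoint (Space n) → OnePoint (Space n)}
    (hT : IsMoebius T) : HasConformalWeight T := by
  induction hT with
  | id => exact ⟨fun _ => 1, fun _ => one_pos, fun x y => by simp⟩
  | inversion T c R hR _ ih => exact (hasConformalWeight_sphereInversion c hR).comp ih
  | reflection T v a hv _ ih => exact (hasConformalWeight_hyperplaneReflection hv a).comp ih

/-- The product of the four weights is a common nonzero factor of numerator and denominator, so the
cancellation also holds when vertices coincide and the quotient is 0 by convention. -/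
lemma crossRatio_eq_of_weight {m n : ℕ} {p q : Polygon m n} {w : Fin m → ℝ} (hw : ∀ i, 0 < w i)
    (h : ∀ i j, ‖q j - q i‖ = w i * w j * ‖p j - p i‖) : crossRatio q = crossRatio p := by
  ext i j
  have h1 := (hw i).ne'
  have h2 := (hw j).ne'
  have h3 := (hw (next i)).ne'
  have h4 := (hw (next j)).ne'
  simp only [crossRatio, h]
  rw [show w i * w j * ‖p j - p i‖ * (w (next i) * w (next j) * ‖p (next j) - p (next i)‖) =
      (w i * w j * w (next i) * w (next j)) * (‖p j - p i‖ * ‖p (next j) - p (next i)‖) by ring,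
    show w i * w (next i) * ‖p (next i) - p i‖ * (w j * w (next j) * ‖p (next j) - p j‖) =
      (w i * w j * w (next i) * w (next j)) * (‖p (next i) - p i‖ * ‖p (next j) - p j‖) by ring,
    mul_div_mul_left _ _ (by positivity)]

lemma isMoebiusInvariant_of_crossRatio {m n : ℕ} {F : Polygon m n → ℝ}
    (hF : ∀ p q : Polygon m n, crossRatio p = crossRatio q → F p = F q) :
    IsMoebiusInvariant F := by
  intro f h θ T _ _ hT hfh
  obtain ⟨w, hw, hwT⟩ := hT.hasConformalWeight
  refine hF _ _ (crossRatio_eq_of_weight (w := fun i => w (f (θ i : UnitAddCircle)))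
    (fun i => hw _) fun i j => ?_).symm
  have := hwT (f (θ i : UnitAddCircle)) (f (θ j : UnitAddCircle))
  rwa [hfh, hfh, homDist_coe_coe, homDist_coe_coe] at this

lemma isMoebiusInvariant_discreteEnergy₁ (m n : ℕ) :
    IsMoebiusInvariant (discreteEnergy₁ m n) :=
  isMoebiusInvariant_of_crossRatio fun p q h => by simp only [discreteEnergy₁, h]

lemma isMoebiusInvariant_discreteEnergy₂ (m n : ℕ) :
    IsMoebiusInvariant (discreteEnergy₂ m n) :=
  isMoebiusInvariant_of_crossRatio fun p q h => by simp only [discreteEnergy₂, h]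

lemma isMoebiusInvariant_discreteEnergy (m n : ℕ) :
    IsMoebiusInvariant (discreteEnergy m n) :=
  isMoebiusInvariant_of_crossRatio fun p q h => by
    simp only [discreteEnergy, discreteEnergy₁, discreteEnergy₂, h]

end

section

/-! ### Weak derivatives on the line -/

open MeasureTheory Set Filter Topology

lemma exists_pos_tsupport_subset_Ioo {φ : ℝ → ℝ} (h : HasCompactSupport φ) :
    ∃ R : ℝ, 0 < R ∧ tsupport φ ⊆ Ioo (-R) R := by
  obtain ⟨R, hR, h⟩ := h.isCompact.isBounded.subset_ball_lt 0 0
  refine ⟨R, hR, h.trans ?_⟩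
  rw [Real.ball_eq_Ioo]
  simp

lemma integral_eq_intervalIntegral_of_tsupport_subset {F : ℝ → ℝ} {R : ℝ} (hR : 0 < R)
    (h : ∀ t, t ∉ Ioo (-R) R → F t = 0) : ∫ t, F t = ∫ t in (-R)..R, F t := by
  rw [intervalIntegral.integral_of_le (by linarith), setIntegral_eq_integral_of_forall_compl_eq_zero]
  intro t ht
  exact h t fun h' => ht ⟨h'.1, h'.2.le⟩

lemma deriv_eq_zero_of_notMem_tsupport {φ : ℝ → ℝ} {t : ℝ} (h : t ∉ tsupport φ) :
    deriv φ t = 0 := by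
  by_contra h'
  exact h (support_deriv_subset h')

/-- Integration by parts of a test function against a primitive. -/
lemma integral_deriv_mul_primitive {g φ : ℝ → ℝ} (hg : LocallyIntegrable g)
    (hφ : ContDiff ℝ ∞ φ) (hφc : HasCompactSupport φ) :
    ∫ t, deriv φ t * ∫ s in (0 : ℝ)..t, g s = - ∫ t, φ t * g t := by
  obtain ⟨R, hR, hsub⟩ := exists_pos_tsupport_subset_Ioo hφc
  have hz : ∀ t, t ∉ Ioo (-R) R → φ t = 0 := fun t ht =>
    image_eq_zero_of_notMem_tsupport fun h => ht (hsub h)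
  have hz' : ∀ t, t ∉ Ioo (-R) R → deriv φ t = 0 := fun t ht =>
    deriv_eq_zero_of_notMem_tsupport fun h => ht (hsub h)
  rw [integral_eq_intervalIntegral_of_tsupport_subset hR fun t ht => by rw [hz' t ht, zero_mul],
    integral_eq_intervalIntegral_of_tsupport_subset hR fun t ht => by rw [hz t ht, zero_mul]]
  have hint : IntervalIntegrable g volume (-R) R :=
    (hg.integrableOn_isCompact isCompact_uIcc).intervalIntegrable
  have h0 : (0 : ℝ) ∈ uIcc (-R) R := by
    rw [uIcc_of_le (by linarith), mem_Icc]
    exact ⟨by linarith, hR.le⟩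
  have hU := hint.absolutelyContinuousOnInterval_intervalIntegral h0
  have hφ1 : AbsolutelyContinuousOnInterval φ (-R) R :=
    (hφ.of_le (by norm_cast)).contDiffOn.absolutelyContinuousOnInterval
  have key := hφ1.integral_mul_deriv_eq_deriv_mul hU
  have h1 : ∫ x in (-R)..R, φ x * deriv (fun x => ∫ s in (0 : ℝ)..x, g s) x =
      ∫ x in (-R)..R, φ x * g x := by
    apply intervalIntegral.integral_congr_ae
    filter_upwards [LocallyIntegrable.ae_hasDerivAt_integral hg] with x hx _
    rw [(hx 0).deriv]
  rw [h1, hz R (by simp), hz (-R) (by simp)] at key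
  rw [key]
  ring

/-- The primitive starting to the left of the support is constant to the right of it, and that
constant is the total integral; the vanishing mean gives compact support. -/
lemma exists_primitive_of_integral_eq_zero {ψ : ℝ → ℝ} (hψ : ContDiff ℝ ∞ ψ)
    (hψc : HasCompactSupport ψ) (h0 : ∫ t, ψ t = 0) :
    ∃ φ : ℝ → ℝ, ContDiff ℝ ∞ φ ∧ HasCompactSupport φ ∧ deriv φ = ψ := by
  obtain ⟨R, hR, hsub⟩ := exists_pos_tsupport_subset_Ioo hψc
  have hz : ∀ t, t ∉ Ioo (-R) R → ψ t = 0 := fun t ht =>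
    image_eq_zero_of_notMem_tsupport fun h => ht (hsub h)
  have hcont := hψ.continuous
  have hd : ∀ t, HasDerivAt (fun x => ∫ s in (-R)..x, ψ s) (ψ t) t := fun t =>
    intervalIntegral.integral_hasDerivAt_right (hcont.intervalIntegrable _ _)
      (hcont.stronglyMeasurableAtFilter _ _) hcont.continuousAt
  have hderiv : deriv (fun x => ∫ s in (-R)..x, ψ s) = ψ := funext fun t => (hd t).deriv
  refine ⟨fun x => ∫ s in (-R)..x, ψ s, ?_, ?_, hderiv⟩
  · rw [contDiff_infty_iff_deriv, hderiv]
    exact ⟨fun t => (hd t).differentiableAt, hψ⟩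
  · refine HasCompactSupport.of_support_subset_isCompact (isCompact_Icc (a := -R) (b := R)) ?_
    intro x hx
    by_contra hxR
    refine hx ?_
    rw [mem_Icc, not_and_or, not_le, not_le] at hxR
    rcases hxR with hxR | hxR
    · refine intervalIntegral.integral_zero_ae (ae_of_all _ fun s hs => hz s fun hs' => ?_)
      rw [uIoc_of_ge hxR.le] at hs
      linarith [hs.2, hs'.1]
    · change ∫ s in (-R)..x, ψ s = 0
      rw [← intervalIntegral.integral_add_adjacent_intervals (hcont.intervalIntegrable _ R)
        (hcont.intervalIntegrable _ _), ← integral_eq_intervalIntegral_of_tsupport_subset hR hz, h0,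
        zero_add]
      refine intervalIntegral.integral_zero_ae (ae_of_all _ fun s hs => hz s fun hs' => ?_)
      rw [uIoc_of_le hxR.le] at hs
      linarith [hs.1, hs'.2]

lemma integrable_mul_of_hasCompactSupport {w ψ : ℝ → ℝ} (hw : LocallyIntegrable w)
    (hψ : Continuous ψ) (hψc : HasCompactSupport ψ) : Integrable fun t => ψ t * w t :=
  hw.integrable_smul_left_of_hasCompactSupport hψ hψc

/-- The lemma of du Bois-Reymond: a function with vanishing weak derivative is constant. -/
lemma exists_ae_eq_const_of_integral_deriv_mul_eq_zero {w : ℝ → ℝ} (hw : LocallyIntegrable w)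
    (h : ∀ φ : ℝ → ℝ, ContDiff ℝ ∞ φ → HasCompactSupport φ → ∫ t, deriv φ t * w t = 0) :
    ∃ c : ℝ, ∀ᵐ t, w t = c := by
  let B : ContDiffBump (0 : ℝ) := ⟨1, 2, one_pos, one_lt_two⟩
  let ρ : ℝ → ℝ := B.normed volume
  have hρ : ContDiff ℝ ∞ ρ := B.contDiff_normed
  have hρc : HasCompactSupport ρ := B.hasCompactSupport_normed
  have hρi : ∫ t, ρ t = 1 := B.integral_normed
  refine ⟨∫ t, ρ t * w t, ?_⟩
  have hae := ae_eq_zero_of_integral_contDiff_smul_eq_zero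
    (f := fun t => w t - ∫ t, ρ t * w t) (μ := volume)
    (hw.sub (locallyIntegrable_const _)) fun ψ hψ hψc => ?_
  · filter_upwards [hae] with t ht
    linarith
  have hψint : Integrable ψ := hψ.continuous.integrable_of_hasCompactSupport hψc
  have hρint : Integrable ρ := hρ.continuous.integrable_of_hasCompactSupport hρc
  -- Subtracting (∫ψ)ρ from ψ makes the mean zero, so the difference is the derivative of a test
  -- function.
  obtain ⟨φ, hφ, hφc, hφd⟩ := exists_primitive_of_integral_eq_zero
    (ψ := fun t => ψ t - (∫ s, ψ s) * ρ t) (hψ.sub (contDiff_const.mul hρ))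
    (hψc.sub (hρc.mul_left)) (by
      rw [integral_sub hψint (hρint.const_mul _), integral_const_mul, hρi]
      ring)
  have h1 := h φ hφ hφc
  have hi1 := integrable_mul_of_hasCompactSupport hw hψ.continuous hψc
  have hi2 := integrable_mul_of_hasCompactSupport hw hρ.continuous hρc
  have h2 : ∫ t, deriv φ t * w t = (∫ t, ψ t * w t) - (∫ s, ψ s) * ∫ t, ρ t * w t := by
    rw [hφd, ← integral_const_mul, ← integral_sub hi1 (hi2.const_mul _)]
    congr 1
    ext t
    ring
  simp only [smul_eq_mul, mul_sub]
  rw [integral_sub hi1 (hψint.mul_const _), integral_mul_const]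
  linarith

/-- A function with locally integrable weak derivative is a primitive of it. -/
lemma exists_ae_eq_primitive {u g : ℝ → ℝ} (hu : LocallyIntegrable u) (hg : LocallyIntegrable g)
    (h : ∀ φ : ℝ → ℝ, ContDiff ℝ ∞ φ → HasCompactSupport φ →
      ∫ t, deriv φ t * u t = - ∫ t, φ t * g t) :
    ∃ c : ℝ, ∀ᵐ t, u t = c + ∫ s in (0 : ℝ)..t, g s := by
  have hUcont : Continuous fun t => ∫ s in (0 : ℝ)..t, g s :=
    intervalIntegral.continuous_primitive
      (fun a b => (hg.integrableOn_isCompact isCompact_uIcc).intervalIntegrable) 0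
  obtain ⟨c, hc⟩ := exists_ae_eq_const_of_integral_deriv_mul_eq_zero
    (w := fun t => u t - ∫ s in (0 : ℝ)..t, g s) (hu.sub hUcont.locallyIntegrable)
    fun φ hφ hφc => by
      have hd : Continuous (deriv φ) := hφ.continuous_deriv (by simp)
      simp only [mul_sub]
      rw [integral_sub (integrable_mul_of_hasCompactSupport hu hd hφc.deriv)
        (integrable_mul_of_hasCompactSupport hUcont.locallyIntegrable hd hφc.deriv), h φ hφ hφc,
        integral_deriv_mul_primitive hg hφ hφc, sub_self]
  refine ⟨c, ?_⟩
  filter_upwards [hc] with t ht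
  linarith

lemma HasWeakDeriv.apply {n : ℕ} {u g : ℝ → Space n} (h : HasWeakDeriv u g) (k : Fin n) :
    LocallyIntegrable (fun t => u t k) ∧ LocallyIntegrable (fun t => g t k) ∧
      ∀ φ : ℝ → ℝ, ContDiff ℝ ∞ φ → HasCompactSupport φ →
        ∫ t, deriv φ t * u t k = - ∫ t, φ t * g t k := by
  obtain ⟨hu, hg, h⟩ := h
  let π : Space n →L[ℝ] ℝ := EuclideanSpace.proj k
  refine ⟨fun x => ?_, fun x => ?_, fun φ hφ hφc => ?_⟩
  · obtain ⟨s, hs, hi⟩ := hu x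
    exact ⟨s, hs, π.integrable_comp hi⟩
  · obtain ⟨s, hs, hi⟩ := hg x
    exact ⟨s, hs, π.integrable_comp hi⟩
  · have hd : Continuous (deriv φ) := hφ.continuous_deriv (by simp)
    have h1 := π.integral_comp_comm (hu.integrable_smul_left_of_hasCompactSupport hd hφc.deriv)
    have h2 := π.integral_comp_comm (hg.integrable_smul_left_of_hasCompactSupport hφ.continuous hφc)
    rw [h φ hφ hφc, map_neg, ← h2] at h1
    simpa [π] using h1

/-- A bounded continuous function with two bounded weak derivatives is `C^{1,1}`. -/
lemma exists_hasDerivAt_lipschitz {n : ℕ} {u g h : ℝ → Space n} (hu : Continuous u)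
    (hh : MemLp h ⊤) (hug : HasWeakDeriv u g) (hgh : HasWeakDeriv g h) :
    ∃ (V : ℝ → Space n) (M : ℝ), 0 ≤ M ∧ (∀ t, HasDerivAt u (V t) t) ∧
      ∀ s t, ‖V s - V t‖ ≤ M * |s - t| := by
  obtain ⟨M, hM⟩ : ∃ M : ℝ, ∀ᵐ t, ‖h t‖ ≤ M := by
    refine ⟨(eLpNormEssSup h volume).toReal, ?_⟩
    have hlt : eLpNormEssSup h volume ≠ ⊤ := by
      rw [← eLpNorm_exponent_top]
      exact hh.eLpNorm_ne_top
    filter_upwards [enorm_ae_le_eLpNormEssSup h volume] with t ht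
    rw [← toReal_enorm]
    exact ENNReal.toReal_mono hlt ht
  have hint : ∀ a b, IntervalIntegrable h volume a b := fun a b =>
    (hgh.2.1.integrableOn_isCompact isCompact_uIcc).intervalIntegrable
  choose c hc using fun k => exists_ae_eq_primitive (hgh.apply k).1 (hgh.apply k).2.1
    (hgh.apply k).2.2
  choose c' hc' using fun k => exists_ae_eq_primitive (hug.apply k).1 (hug.apply k).2.1
    (hug.apply k).2.2
  -- `V` is the continuous representative of `g`: the weak derivative of `g` is `h`, and `c`
  -- collects the constants of integration of the components.
  let V : ℝ → Space n := fun t => WithLp.toLp 2 c + ∫ s in (0 : ℝ)..t, h s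
  have hVk : ∀ k t, V t k = c k + ∫ s in (0 : ℝ)..t, h s k := fun k t => by
    have := (EuclideanSpace.proj k : Space n →L[ℝ] ℝ).intervalIntegral_comp_comm (hint 0 t)
    simp only [PiLp.proj_apply] at this
    simp [V, this]
  have hVc : Continuous V :=
    continuous_const.add (intervalIntegral.continuous_primitive hint 0)
  have hVkc : ∀ k, Continuous fun t => V t k := fun k =>
    (EuclideanSpace.proj k : Space n →L[ℝ] ℝ).continuous.comp hVc
  -- Both sides are continuous, so equality almost everywhere is equality everywhere, and `u`
  -- becomes a genuine primitive of `V`.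
  have huk : ∀ k, (fun t => u t k) = fun t => c' k + ∫ s in (0 : ℝ)..t, V s k := fun k => by
    refine (Continuous.ae_eq_iff_eq volume
      ((EuclideanSpace.proj k : Space n →L[ℝ] ℝ).continuous.comp hu)
      (continuous_const.add (intervalIntegral.continuous_primitive
        (fun a b => (hVkc k).intervalIntegrable a b) 0))).1 ?_
    filter_upwards [hc' k] with t ht
    change u t k = c' k + ∫ s in (0 : ℝ)..t, V s k
    rw [ht]
    congr 1
    apply intervalIntegral.integral_congr_ae
    filter_upwards [hc k] with s hs _
    rw [hs, hVk]
  refine ⟨V, max M 0, le_max_right _ _, fun t => ?_, fun s t => ?_⟩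
  · rw [← hasDerivWithinAt_univ, hasDerivWithinAt_iff_hasFDerivWithinAt, hasFDerivWithinAt_euclidean]
    intro k
    have h1 : HasDerivAt (fun t => c' k + ∫ s in (0 : ℝ)..t, V s k) (V t k) t :=
      (intervalIntegral.integral_hasDerivAt_right ((hVkc k).intervalIntegrable _ _)
        ((hVkc k).stronglyMeasurableAtFilter _ _) (hVkc k).continuousAt).const_add _
    rw [← huk k] at h1
    refine h1.hasFDerivAt.hasFDerivWithinAt.congr_fderiv ?_
    ext
    simp
  · have h1 : V s - V t = ∫ r in t..s, h r := by
      simp only [V, add_sub_add_left_eq_sub]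
      exact intervalIntegral.integral_interval_sub_left (hint _ _) (hint _ _)
    rw [h1]
    refine intervalIntegral.norm_integral_le_of_norm_le_const_ae ?_
    filter_upwards [hM] with r hr _
    exact hr.trans (le_max_left _ _)

end

section

/-! ### Chords of curves of class `C^{1,1}` -/

open Set

/-! ### Directions of vectors and the defect of the triangle inequality -/

section Direction

variable {E : Type*} [NormedAddCommGroup E] [InnerProductSpace ℝ E]

/-- The direction of a vector; it is `0` for the zero vector. -/
def dir (v : E) : E := ‖v‖⁻¹ • v

lemma norm_dir {v : E} (hv : v ≠ 0) : ‖dir v‖ = 1 := by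
  rw [dir, norm_smul, norm_inv, norm_norm, inv_mul_cancel₀ (norm_ne_zero_iff.2 hv)]

lemma norm_dir_le_one (v : E) : ‖dir v‖ ≤ 1 := by
  by_cases hv : v = 0
  · simp [hv, dir]
  · exact (norm_dir hv).le

lemma norm_smul_dir (v : E) : ‖v‖ • dir v = v := by
  by_cases hv : v = 0
  · simp [hv]
  · rw [dir, smul_smul, mul_inv_cancel₀ (norm_ne_zero_iff.2 hv), one_smul]

lemma dir_smul_of_pos {a : ℝ} (ha : 0 < a) (v : E) : dir (a • v) = dir v := by
  rw [dir, dir, norm_smul, Real.norm_of_nonneg ha.le, smul_smul]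
  congr 1
  field_simp

/-- From ‖w‖(dir v − dir w) = (‖w‖ − ‖v‖) dir v + (v − w), where each summand has norm at most ‖v −
w‖. Only `w` must be nonzero. -/
lemma norm_dir_sub_dir_le (v : E) {w : E} (hw : w ≠ 0) :
    ‖dir v - dir w‖ ≤ 2 * ‖v - w‖ / ‖w‖ := by
  have hw' : 0 < ‖w‖ := norm_pos_iff.2 hw
  rw [le_div_iff₀ hw', mul_comm ‖dir v - dir w‖]
  have h1 : ‖w‖ * ‖dir v - dir w‖ = ‖(‖w‖ - ‖v‖) • dir v + (v - w)‖ := by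
    rw [← Real.norm_of_nonneg hw'.le, ← norm_smul, norm_norm, smul_sub, norm_smul_dir, sub_smul,
      norm_smul_dir]
    congr 1
    abel
  rw [h1]
  have h2 : ‖(‖w‖ - ‖v‖) • dir v‖ ≤ ‖v - w‖ := by
    rw [norm_smul, Real.norm_eq_abs]
    calc |‖w‖ - ‖v‖| * ‖dir v‖ ≤ ‖w - v‖ * 1 :=
          mul_le_mul (abs_norm_sub_norm_le _ _) (norm_dir_le_one v) (norm_nonneg _) (norm_nonneg _)
      _ = ‖v - w‖ := by rw [mul_one, norm_sub_rev]
  linarith [norm_add_le ((‖w‖ - ‖v‖) • dir v) (v - w)]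

lemma two_mul_inner_eq_dir (v w : E) (hv : v ≠ 0) (hw : w ≠ 0) :
    2 * inner ℝ v w = ‖v‖ * ‖w‖ * (2 - ‖dir v - dir w‖ ^ 2) := by
  rw [norm_sub_sq_real, norm_dir hv, norm_dir hw, dir, dir, inner_smul_left, inner_smul_right]
  have := norm_ne_zero_iff.2 hv
  have := norm_ne_zero_iff.2 hw
  simp only [map_inv₀, conj_trivial]
  field_simp
  ring

/-- The defect in the triangle inequality is quadratic in the angle. -/
lemma norm_add_norm_sub_le (v e : E) :
    ‖v‖ + ‖e‖ - ‖e‖ * ‖dir v - dir e‖ ^ 2 ≤ ‖v + e‖ := by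
  by_cases hv : v = 0
  · subst hv
    simp only [norm_zero, zero_add]
    nlinarith [mul_nonneg (norm_nonneg e) (sq_nonneg ‖dir 0 - dir e‖)]
  by_cases he : e = 0
  · simp [he]
  by_cases hneg : ‖v‖ + ‖e‖ - ‖e‖ * ‖dir v - dir e‖ ^ 2 ≤ 0
  · exact hneg.trans (norm_nonneg _)
  push Not at hneg
  refine (sq_le_sq₀ hneg.le (norm_nonneg _)).1 ?_
  rw [norm_add_sq_real, two_mul_inner_eq_dir v e hv he]
  set κ := ‖dir v - dir e‖ ^ 2
  have hκ : 0 ≤ ‖e‖ * κ := by positivity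
  -- The difference of the squares is ‖e‖κ · ((‖v‖ + ‖e‖ − ‖e‖κ) + ‖e‖), a product of nonnegative
  -- factors.
  nlinarith [norm_nonneg v, norm_nonneg e, mul_nonneg hκ hneg.le, mul_nonneg hκ (norm_nonneg e)]

end Direction

/-! ### Quantitative chord estimates -/

/-- `F` is a `1`-periodic curve with Lipschitz derivative `V`, bi-Lipschitz on the circle. -/
structure IsRegularCurve {n : ℕ} (F V : ℝ → Space n) (c L M : ℝ) : Prop where
  c_pos : 0 < c
  L_pos : 0 < L
  M_nonneg : 0 ≤ M
  periodic : Function.Periodic F 1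
  hasDerivAt : ∀ t, HasDerivAt F (V t) t
  lipschitz_deriv : ∀ s t, ‖V s - V t‖ ≤ M * |s - t|
  lower : ∀ s t, |s - t| ≤ 3 / 4 → c * |s - t| ≤ ‖F s - F t‖
  upper : ∀ s t, ‖F s - F t‖ ≤ L * |s - t|

namespace IsRegularCurve

variable {n : ℕ} {F V : ℝ → Space n} {c L M : ℝ}

/-- Mean value inequality for x ↦ F x − x · V r, whose derivative V x − V r has norm at most MH on
the window. -/
lemma norm_sub_sub_smul_le (h : IsRegularCurve F V c L M) {a H s t r : ℝ} (hst : s ≤ t)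
    (hs : a ≤ s) (ht : t ≤ a + H) (hr : r ∈ Icc a (a + H)) :
    ‖F t - F s - (t - s) • V r‖ ≤ M * H * (t - s) := by
  have hd : ∀ x ∈ Icc s t, HasDerivWithinAt (fun x => F x - x • V r) (V x - V r) (Icc s t) x := by
    intro x _
    have := (h.hasDerivAt x).sub ((hasDerivAt_id x).smul_const (V r))
    simp only [one_smul] at this
    exact this.hasDerivWithinAt
  have hb : ∀ x ∈ Icc s t, ‖V x - V r‖ ≤ M * H := by
    intro x hx
    refine (h.lipschitz_deriv x r).trans (mul_le_mul_of_nonneg_left ?_ h.M_nonneg)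
    rw [abs_le]
    constructor <;> linarith [hx.1, hx.2, hr.1, hr.2]
  have := (convex_Icc s t).norm_image_sub_le_of_norm_hasDerivWithin_le hd hb
    (left_mem_Icc.2 hst) (right_mem_Icc.2 hst)
  rw [Real.norm_of_nonneg (sub_nonneg.2 hst)] at this
  have e : F t - F s - (t - s) • V r = F t - t • V r - (F s - s • V r) := by
    rw [sub_smul]
    abel
  rwa [e]

lemma norm_slope_sub_le (h : IsRegularCurve F V c L M) {a H s t r : ℝ} (hst : s < t)
    (hs : a ≤ s) (ht : t ≤ a + H) (hr : r ∈ Icc a (a + H)) :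
    ‖(t - s)⁻¹ • (F t - F s) - V r‖ ≤ M * H := by
  have hp : 0 < t - s := sub_pos.2 hst
  have h1 := h.norm_sub_sub_smul_le hst.le hs ht hr
  have h2 : (t - s)⁻¹ • (F t - F s) - V r = (t - s)⁻¹ • (F t - F s - (t - s) • V r) := by
    rw [smul_sub (t - s)⁻¹ (F t - F s), smul_smul, inv_mul_cancel₀ hp.ne', one_smul]
  rw [h2, norm_smul, Real.norm_of_nonneg (inv_nonneg.2 hp.le), inv_mul_le_iff₀ hp]
  linarith

/-- Directions of chords vary in a Lipschitz way. -/
lemma norm_dir_chord_sub_le (h : IsRegularCurve F V c L M) {a H s t s' t' : ℝ} (hst : s < t)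
    (hst' : s' < t') (hshort : t - s ≤ 3 / 4) (hs : a ≤ s) (ht : t ≤ a + H) (hs' : a ≤ s')
    (ht' : t' ≤ a + H) :
    ‖dir (F t' - F s') - dir (F t - F s)‖ ≤ 4 * M / c * H := by
  have hp : 0 < t - s := sub_pos.2 hst
  have hp' : 0 < t' - s' := sub_pos.2 hst'
  have hr : a ∈ Icc a (a + H) := ⟨le_rfl, by linarith⟩
  have h1 := h.norm_slope_sub_le hst hs ht hr
  have h2 := h.norm_slope_sub_le hst' hs' ht' hr
  -- The comparison of directions divides by the norm of one vector only, so a lower bound for one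
  -- of the two chords is enough.
  have hlow : c ≤ ‖(t - s)⁻¹ • (F t - F s)‖ := by
    rw [norm_smul, Real.norm_of_nonneg (inv_nonneg.2 hp.le), le_inv_mul_iff₀ hp, mul_comm]
    have := h.lower t s (by rwa [abs_of_pos hp])
    rwa [abs_of_pos hp] at this
  have hne : (t - s)⁻¹ • (F t - F s) ≠ 0 := norm_pos_iff.1 (h.c_pos.trans_le hlow)
  rw [← dir_smul_of_pos (inv_pos.2 hp) (F t - F s), ← dir_smul_of_pos (inv_pos.2 hp') (F t' - F s')]
  generalize (t' - s')⁻¹ • (F t' - F s') = w' at *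
  generalize (t - s)⁻¹ • (F t - F s) = w at *
  refine (norm_dir_sub_dir_le _ hne).trans ?_
  have h3 : ‖w' - w‖ ≤ 2 * (M * H) := by
    have := norm_sub_le (w' - V a) (w - V a)
    rw [sub_sub_sub_cancel_right] at this
    linarith
  have hMH : 0 ≤ M * H := (norm_nonneg _).trans h1
  calc 2 * ‖w' - w‖ / ‖w‖ ≤ 2 * (2 * (M * H)) / c :=
        div_le_div₀ (by positivity) (by linarith) h.c_pos hlow
    _ = 4 * M / c * H := by ring

/-- Prolonging a chord at its end point by an edge nearly adds the lengths. -/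
lemma norm_chord_add_le (h : IsRegularCurve F V c L M) {s t t' : ℝ} (hst : s ≤ t) (htt' : t < t')
    (hshort : t' - t ≤ 3 / 4) :
    ‖F t - F s‖ + ‖F t' - F t‖ - ‖F t' - F t‖ * (4 * M / c * (t' - s)) ^ 2 ≤ ‖F t' - F s‖ := by
  -- A degenerate chord has direction 0, which is not close to the direction of the edge; in this
  -- case the inequality is trivial.
  rcases hst.eq_or_lt with rfl | hst
  · simp only [sub_self, norm_zero, zero_add]
    nlinarith [mul_nonneg (norm_nonneg (F t' - F s)) (sq_nonneg (4 * M / c * (t' - s)))]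
  have h1 := norm_add_norm_sub_le (F t - F s) (F t' - F t)
  have h2 := h.norm_dir_chord_sub_le (a := s) (H := t' - s) htt' hst hshort hst.le (by linarith)
    le_rfl (by linarith)
  have h3 := mul_le_mul_of_nonneg_left (pow_le_pow_left₀ (norm_nonneg _) h2 2)
    (norm_nonneg (F t' - F t))
  rw [sub_add_sub_cancel'] at h1
  linarith

/-- Prolonging a chord at its initial point by an edge nearly adds the lengths. -/
lemma norm_chord_add_le' (h : IsRegularCurve F V c L M) {s' s t : ℝ} (hss' : s' < s) (hst : s ≤ t)
    (hshort : s - s' ≤ 3 / 4) :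
    ‖F t - F s‖ + ‖F s - F s'‖ - ‖F s - F s'‖ * (4 * M / c * (t - s')) ^ 2 ≤ ‖F t - F s'‖ := by
  rcases hst.eq_or_lt with rfl | hst
  · simp only [sub_self, norm_zero, zero_add]
    nlinarith [mul_nonneg (norm_nonneg (F s - F s')) (sq_nonneg (4 * M / c * (s - s')))]
  have h1 := norm_add_norm_sub_le (F t - F s) (F s - F s')
  have h2 := h.norm_dir_chord_sub_le (a := s') (H := t - s') hss' hst hshort le_rfl (by linarith)
    hss'.le (by linarith)
  have h3 := mul_le_mul_of_nonneg_left (pow_le_pow_left₀ (norm_nonneg _) h2 2)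
    (norm_nonneg (F s - F s'))
  rw [sub_add_sub_cancel] at h1
  linarith

end IsRegularCurve

end

section

/-! ### The summands of the discrete energies -/

open Set

section Terms

variable {n : ℕ}

/-- The cross ratio of four points. -/
def quadRatio (P P' Q Q' : Space n) : ℝ := (‖Q - P‖ * ‖Q' - P'‖) / (‖P' - P‖ * ‖Q' - Q‖)

/-- The forward difference of the cross ratio in the first pair of points. -/
def ratioDiffFst (P₀ P₁ P₂ Q₀ Q₁ : Space n) : ℝ := quadRatio P₁ P₂ Q₀ Q₁ - quadRatio P₀ P₁ Q₀ Q₁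

/-- The forward difference of the cross ratio in the second pair of points. -/
def ratioDiffSnd (P₀ P₁ Q₀ Q₁ Q₂ : Space n) : ℝ := quadRatio P₀ P₁ Q₁ Q₂ - quadRatio P₀ P₁ Q₀ Q₁

/-- The mixed second difference of the cross ratio. -/
def ratioDiffMixed (P₀ P₁ P₂ Q₀ Q₁ Q₂ : Space n) : ℝ :=
  ratioDiffSnd P₁ P₂ Q₀ Q₁ Q₂ - ratioDiffSnd P₀ P₁ Q₀ Q₁ Q₂

/-- A summand of the first discrete energy. -/
def energyTerm₁ (P₀ P₁ P₂ Q₀ Q₁ Q₂ : Space n) : ℝ :=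
  (1 / quadRatio P₀ P₁ Q₀ Q₁) * (1 + (1 / 2) * ratioDiffMixed P₀ P₁ P₂ Q₀ Q₁ Q₂)

/-- A summand of the second discrete energy. -/
def energyTerm₂ (P₀ P₁ P₂ Q₀ Q₁ Q₂ : Space n) : ℝ :=
  -((1 / (2 * quadRatio P₀ P₁ Q₀ Q₁ ^ 2)) *
    (ratioDiffMixed P₀ P₁ P₂ Q₀ Q₁ Q₂ * (2 * quadRatio P₀ P₁ Q₀ Q₁) -
      ratioDiffFst P₀ P₁ P₂ Q₀ Q₁ * ratioDiffSnd P₀ P₁ Q₀ Q₁ Q₂ + 1))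

lemma discreteEnergy₁_eq_sum {m : ℕ} (p : Polygon m n) :
    discreteEnergy₁ m n p = ∑ i : Fin m, ∑ j : Fin m, if i ≠ j then
      energyTerm₁ (p i) (p (next i)) (p (next (next i))) (p j) (p (next j)) (p (next (next j)))
      else 0 := by
  simp only [discreteEnergy₁, Finset.sum_filter]
  rfl

lemma discreteEnergy₂_eq_sum {m : ℕ} (p : Polygon m n) :
    discreteEnergy₂ m n p = ∑ i : Fin m, ∑ j : Fin m, if i ≠ j then
      energyTerm₂ (p i) (p (next i)) (p (next (next i))) (p j) (p (next j)) (p (next (next j)))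
      else 0 := by
  simp only [discreteEnergy₂, Finset.sum_filter, Matrix.det_fin_two_of, ← Finset.sum_neg_distrib]
  refine Finset.sum_congr rfl fun i _ => Finset.sum_congr rfl fun j _ => ?_
  split_ifs
  · rfl
  · simp

lemma quadRatio_swap (P P' Q Q' : Space n) : quadRatio Q Q' P P' = quadRatio P P' Q Q' := by
  rw [quadRatio, quadRatio, norm_sub_rev P Q, norm_sub_rev P' Q', mul_comm ‖Q' - Q‖]

/-- The symmetry allows each pair of vertices to be taken in the order in which they follow each
other on a short arc. -/
lemma energyTerm₁_swap (P₀ P₁ P₂ Q₀ Q₁ Q₂ : Space n) :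
    energyTerm₁ Q₀ Q₁ Q₂ P₀ P₁ P₂ = energyTerm₁ P₀ P₁ P₂ Q₀ Q₁ Q₂ := by
  simp only [energyTerm₁, ratioDiffMixed, ratioDiffSnd, quadRatio_swap P₀ P₁, quadRatio_swap P₁ P₂]
  ring

lemma energyTerm₂_swap (P₀ P₁ P₂ Q₀ Q₁ Q₂ : Space n) :
    energyTerm₂ Q₀ Q₁ Q₂ P₀ P₁ P₂ = energyTerm₂ P₀ P₁ P₂ Q₀ Q₁ Q₂ := by
  simp only [energyTerm₂, ratioDiffMixed, ratioDiffSnd, ratioDiffFst, quadRatio_swap P₀ P₁,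
    quadRatio_swap P₁ P₂]
  ring

lemma norm_sub_sq_mixed (P P' Q Q' : Space n) :
    ‖Q' - P'‖ ^ 2 - ‖Q - P'‖ ^ 2 - ‖Q' - P‖ ^ 2 + ‖Q - P‖ ^ 2 =
      -2 * inner ℝ (P' - P) (Q' - Q) := by
  simp only [norm_sub_sq_real, inner_sub_left, inner_sub_right, real_inner_comm P,
    real_inner_comm P']
  ring

/-- The mixed second difference of the cross ratios of an equilateral polygon. -/
lemma sq_mul_ratioDiffMixed {ℓ : ℝ} (hℓ : 0 < ℓ) {P₀ P₁ P₂ Q₀ Q₁ Q₂ : Space n}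
    (hP₀ : ‖P₁ - P₀‖ = ℓ) (hP₁ : ‖P₂ - P₁‖ = ℓ) (hQ₀ : ‖Q₁ - Q₀‖ = ℓ) (hQ₁ : ‖Q₂ - Q₁‖ = ℓ) :
    ℓ ^ 2 * ratioDiffMixed P₀ P₁ P₂ Q₀ Q₁ Q₂ =
      -inner ℝ (P₁ - P₀) (Q₁ - Q₀) - inner ℝ (P₂ - P₁) (Q₂ - Q₁) -
        ((‖Q₂ - P₂‖ - ‖Q₁ - P₁‖) ^ 2 - (‖Q₁ - P₂‖ - ‖Q₀ - P₁‖) ^ 2 -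
          (‖Q₂ - P₁‖ - ‖Q₁ - P₀‖) ^ 2 + (‖Q₁ - P₁‖ - ‖Q₀ - P₀‖) ^ 2) / 2 := by
  -- Each of the four products of norms is replaced by ab = (a² + b² − (a − b)²)/2. The eight
  -- squares combine into two mixed differences of squared distances, which are bilinear in the
  -- edges.
  have h1 := norm_sub_sq_mixed P₀ P₁ Q₀ Q₁
  have h2 := norm_sub_sq_mixed P₁ P₂ Q₁ Q₂
  have h3 : ℓ ^ 2 * ratioDiffMixed P₀ P₁ P₂ Q₀ Q₁ Q₂ =
      ‖Q₁ - P₁‖ * ‖Q₂ - P₂‖ - ‖Q₀ - P₁‖ * ‖Q₁ - P₂‖ -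
        (‖Q₁ - P₀‖ * ‖Q₂ - P₁‖ - ‖Q₀ - P₀‖ * ‖Q₁ - P₁‖) := by
    simp only [ratioDiffMixed, ratioDiffSnd, quadRatio, hP₀, hP₁, hQ₀, hQ₁]
    field_simp
  rw [h3]
  linarith

lemma abs_norm_sub_norm_le_edges (P P' Q Q' : Space n) :
    |‖Q' - P'‖ - ‖Q - P‖| ≤ ‖(P' - P) - (Q' - Q)‖ := by
  refine (abs_norm_sub_norm_le _ _).trans (le_of_eq ?_)
  rw [← norm_neg]
  congr 1
  abel

/-- Two edges of length ℓ differing by at most ℓκ have inner product within ℓ²κ²/2 of ℓ², so the two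
inner products contribute −2 up to O(κ²). The squared differences of distances are at most ℓ²κ². -/
lemma abs_ratioDiffMixed_add_two_le {ℓ κ : ℝ} (hℓ : 0 < ℓ) {P₀ P₁ P₂ Q₀ Q₁ Q₂ : Space n}
    (hP₀ : ‖P₁ - P₀‖ = ℓ) (hP₁ : ‖P₂ - P₁‖ = ℓ) (hQ₀ : ‖Q₁ - Q₀‖ = ℓ) (hQ₁ : ‖Q₂ - Q₁‖ = ℓ)
    (h₀₀ : ‖(P₁ - P₀) - (Q₁ - Q₀)‖ ≤ ℓ * κ) (h₀₁ : ‖(P₁ - P₀) - (Q₂ - Q₁)‖ ≤ ℓ * κ)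
    (h₁₀ : ‖(P₂ - P₁) - (Q₁ - Q₀)‖ ≤ ℓ * κ) (h₁₁ : ‖(P₂ - P₁) - (Q₂ - Q₁)‖ ≤ ℓ * κ) :
    |ratioDiffMixed P₀ P₁ P₂ Q₀ Q₁ Q₂ + 2| ≤ 3 * κ ^ 2 := by
  have key := sq_mul_ratioDiffMixed hℓ hP₀ hP₁ hQ₀ hQ₁
  have sq_le : ∀ {x y : ℝ}, |x| ≤ y → x ^ 2 ≤ y ^ 2 := fun h => sq_le_sq.2 (h.trans (le_abs_self _))
  have d₁₁ := sq_le ((abs_norm_sub_norm_le_edges P₁ P₂ Q₁ Q₂).trans h₁₁)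
  have d₁₀ := sq_le ((abs_norm_sub_norm_le_edges P₁ P₂ Q₀ Q₁).trans h₁₀)
  have d₀₁ := sq_le ((abs_norm_sub_norm_le_edges P₀ P₁ Q₁ Q₂).trans h₀₁)
  have d₀₀ := sq_le ((abs_norm_sub_norm_le_edges P₀ P₁ Q₀ Q₁).trans h₀₀)
  have e₀ := pow_le_pow_left₀ (norm_nonneg _) h₀₀ 2
  have e₁ := pow_le_pow_left₀ (norm_nonneg _) h₁₁ 2
  rw [norm_sub_sq_real, hP₀, hQ₀] at e₀
  rw [norm_sub_sq_real, hP₁, hQ₁] at e₁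
  have f₀ := sq_nonneg ‖(P₁ - P₀) - (Q₁ - Q₀)‖
  have f₁ := sq_nonneg ‖(P₂ - P₁) - (Q₂ - Q₁)‖
  rw [norm_sub_sq_real, hP₀, hQ₀] at f₀
  rw [norm_sub_sq_real, hP₁, hQ₁] at f₁
  have hℓ2 : 0 < ℓ ^ 2 := by positivity
  have main : |ℓ ^ 2 * (ratioDiffMixed P₀ P₁ P₂ Q₀ Q₁ Q₂ + 2)| ≤ ℓ ^ 2 * (3 * κ ^ 2) := by
    rw [mul_add, key, abs_le]
    have s₁ := sq_nonneg (‖Q₂ - P₂‖ - ‖Q₁ - P₁‖)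
    have s₂ := sq_nonneg (‖Q₁ - P₂‖ - ‖Q₀ - P₁‖)
    have s₃ := sq_nonneg (‖Q₂ - P₁‖ - ‖Q₁ - P₀‖)
    have s₄ := sq_nonneg (‖Q₁ - P₁‖ - ‖Q₀ - P₀‖)
    have hmul : (ℓ * κ) ^ 2 = ℓ ^ 2 * κ ^ 2 := by ring
    rw [hmul] at *
    constructor <;> nlinarith
  rw [abs_mul, abs_of_pos hℓ2] at main
  exact le_of_mul_le_mul_left main hℓ2

end Terms

/-! ### Cancellation in the second energy -/

lemma abs_mul_le_mul {x y a b : ℝ} (hx : |x| ≤ a) (hy : |y| ≤ b) : |x * y| ≤ a * b := by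
  rw [abs_mul]
  exact mul_le_mul hx hy (abs_nonneg _) ((abs_nonneg _).trans hx)

/-- The cancellation in the second energy near the diagonal: `b` is the rescaled distance of the
two vertices, and `η₁, …, η₅` are the defects of five triangle inequalities. -/
lemma abs_energy_bracket_le {β e₀ b ε η₁ η₂ η₃ η₄ η₅ δ : ℝ} (hβ : 0 < β) (hb : β ≤ b) (hε : 0 ≤ ε)
    (hε₀ : ε ≤ e₀) (h₁ : |η₁| ≤ ε) (h₂ : |η₂| ≤ ε) (h₃ : |η₃| ≤ ε) (h₄ : |η₄| ≤ ε) (h₅ : |η₅| ≤ ε)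
    (hδ : |δ + 2| ≤ 3 * ε) {C₁ : ℝ} (hC₁ : C₁ = 6 + (6 + 3 * e₀) / β) :
    |δ * (2 * (b * (b + η₁ - η₃))) -
      ((b - 1 + η₁) * (b - 1 + η₁ - η₃ + η₄) - b * (b + η₁ - η₃)) *
      ((b + 1 - η₂) * (b + 1 + η₁ - η₃ - η₅) - b * (b + η₁ - η₃)) + 1| ≤
    (8 / β + 6 + 12 * e₀ / β + 2 * (2 + 1 / β) * C₁ + C₁ ^ 2 * e₀) * (ε * b ^ 2) := by
  have hb0 : 0 < b := hβ.trans_le hb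
  have he0 : 0 ≤ e₀ := hε.trans hε₀
  have hbβ : 1 ≤ b / β := (one_le_div hβ).2 hb
  rw [abs_le] at h₁ h₂ h₃ h₄ h₅
  obtain ⟨α, hα⟩ : ∃ α, α = η₁ - η₃ := ⟨_, rfl⟩
  have hα' : |α| ≤ 2 * ε := by rw [abs_le]; constructor <;> linarith
  have hb1 : |b - 1| ≤ b + 1 := by rw [abs_le]; constructor <;> linarith
  have hb2 : |b + 1| ≤ b + 1 := (abs_of_pos (by linarith)).le
  have hC₁b : ε * (6 * b + 6 + 3 * e₀) ≤ C₁ * (ε * b) := by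
    have : C₁ * (ε * b) = ε * (6 * b + (6 + 3 * e₀) * (b / β)) := by rw [hC₁]; ring
    rw [this]
    refine mul_le_mul_of_nonneg_left ?_ hε
    have := le_mul_of_one_le_right (show 0 ≤ 6 + 3 * e₀ by positivity) hbβ
    linarith
  have hεε : ε * ε ≤ ε * e₀ := mul_le_mul_of_nonneg_left hε₀ hε
  -- Common shape of the two remainders `R₁` and `R₂` below, with x = b ∓ 1 and y, z, w combinations
  -- of defects.
  have rem : ∀ {x y z w : ℝ}, |x| ≤ b + 1 → |y| ≤ 4 * ε → |z| ≤ ε → |w| ≤ 3 * ε →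
      |x * y + z * w - b * α| ≤ C₁ * (ε * b) := by
    intro x y z w hx hy hz hw
    refine le_trans ?_ hC₁b
    have a1 := abs_mul_le_mul hx hy
    have a2 := abs_mul_le_mul hz hw
    have a3 : |b * α| ≤ b * (2 * ε) := abs_mul_le_mul (abs_of_pos hb0).le hα'
    calc |x * y + z * w - b * α| ≤ |x * y| + |z * w| + |b * α| :=
          (abs_sub _ _).trans (add_le_add_left (abs_add_le _ _) _)
      _ ≤ (b + 1) * (4 * ε) + ε * (3 * ε) + b * (2 * ε) := by linarith
      _ ≤ ε * (6 * b + 6 + 3 * e₀) := by linarith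
  -- For equally spaced collinear vertices the cross ratio is b² and its two differences are 1 − 2b
  -- and 1 + 2b. `R₁` and `R₂` are the deviations from these values.
  obtain ⟨R₁, hR₁⟩ : ∃ R, R = (b - 1) * (2 * η₁ - η₃ + η₄) + η₁ * (η₁ - η₃ + η₄) - b * α :=
    ⟨_, rfl⟩
  obtain ⟨R₂, hR₂⟩ : ∃ R, R = (b + 1) * (α - η₅ - η₂) + -η₂ * (α - η₅) - b * α := ⟨_, rfl⟩
  have bR₁ : |R₁| ≤ C₁ * (ε * b) := by
    rw [hR₁]
    refine rem hb1 ?_ (abs_le.2 h₁) ?_ <;> rw [abs_le] <;> constructor <;> linarith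
  have bR₂ : |R₂| ≤ C₁ * (ε * b) := by
    rw [hR₂]
    refine rem hb2 ?_ ?_ ?_ <;> rw [abs_le] <;> constructor <;> linarith
  -- With δ = −2 the main part −4b² − (1 − 2b)(1 + 2b) + 1 vanishes, so every remaining term
  -- contains a defect or δ + 2.
  have e : δ * (2 * (b * (b + η₁ - η₃))) -
      ((b - 1 + η₁) * (b - 1 + η₁ - η₃ + η₄) - b * (b + η₁ - η₃)) *
      ((b + 1 - η₂) * (b + 1 + η₁ - η₃ - η₅) - b * (b + η₁ - η₃)) + 1 =
      -4 * (b * α) + 2 * (b ^ 2 * (δ + 2)) + 2 * ((b * α) * (δ + 2)) + (2 * b - 1) * R₂ -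
        (2 * b + 1) * R₁ - R₁ * R₂ := by
    rw [hR₁, hR₂, hα]; ring
  rw [e]
  have t1 : |b * α| ≤ b * (2 * ε) := abs_mul_le_mul (abs_of_pos hb0).le hα'
  have t2 : |b ^ 2 * (δ + 2)| ≤ b ^ 2 * (3 * ε) := abs_mul_le_mul (abs_of_pos (by positivity)).le hδ
  have t3 : |(b * α) * (δ + 2)| ≤ (b * (2 * ε)) * (3 * ε) := abs_mul_le_mul t1 hδ
  have t4 : |(2 * b - 1) * R₂| ≤ (2 * b + 1) * (C₁ * (ε * b)) :=
    abs_mul_le_mul (by rw [abs_le]; constructor <;> linarith) bR₂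
  have t5 : |(2 * b + 1) * R₁| ≤ (2 * b + 1) * (C₁ * (ε * b)) :=
    abs_mul_le_mul (abs_of_pos (by linarith)).le bR₁
  have t6 : |R₁ * R₂| ≤ (C₁ * (ε * b)) * (C₁ * (ε * b)) := abs_mul_le_mul bR₁ bR₂
  have hC₁0 : 0 ≤ C₁ := by rw [hC₁]; positivity
  -- Since b ≥ β, a missing power of b is supplied at the cost of a factor 1/β.
  have u1 : ε * b ≤ ε * b ^ 2 * (1 / β) := by
    have : ε * b ^ 2 * (1 / β) = (ε * b) * (b / β) := by ring
    rw [this]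
    exact le_mul_of_one_le_right (by positivity) hbβ
  have u3 : (b * (2 * ε)) * (3 * ε) ≤ 6 * e₀ * (1 / β) * (ε * b ^ 2) := by
    have : (b * (2 * ε)) * (3 * ε) = 6 * ε * (ε * b) := by ring
    rw [this]
    calc 6 * ε * (ε * b) ≤ 6 * e₀ * (ε * b ^ 2 * (1 / β)) := by gcongr
      _ = _ := by ring
  have u4 : (2 * b + 1) * (C₁ * (ε * b)) ≤ (2 + 1 / β) * C₁ * (ε * b ^ 2) := by
    have : (2 * b + 1) * (C₁ * (ε * b)) = 2 * C₁ * (ε * b ^ 2) + C₁ * (ε * b) := by ring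
    rw [this]
    calc 2 * C₁ * (ε * b ^ 2) + C₁ * (ε * b)
        ≤ 2 * C₁ * (ε * b ^ 2) + C₁ * (ε * b ^ 2 * (1 / β)) := by gcongr
      _ = _ := by ring
  have u6 : (C₁ * (ε * b)) * (C₁ * (ε * b)) ≤ C₁ ^ 2 * e₀ * (ε * b ^ 2) := by
    have : (C₁ * (ε * b)) * (C₁ * (ε * b)) = (C₁ ^ 2 * (ε * b ^ 2)) * ε := by ring
    rw [this]
    calc (C₁ ^ 2 * (ε * b ^ 2)) * ε ≤ (C₁ ^ 2 * (ε * b ^ 2)) * e₀ := by gcongr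
      _ = _ := by ring
  have hfin : (8 / β + 6 + 12 * e₀ / β + 2 * (2 + 1 / β) * C₁ + C₁ ^ 2 * e₀) * (ε * b ^ 2) =
      8 * (ε * b ^ 2 * (1 / β)) + 6 * (ε * b ^ 2) + 2 * (6 * e₀ * (1 / β) * (ε * b ^ 2)) +
      2 * ((2 + 1 / β) * C₁ * (ε * b ^ 2)) + C₁ ^ 2 * e₀ * (ε * b ^ 2) := by ring
  rw [hfin]
  rw [abs_le] at t1 t2 t3 t4 t5 t6 ⊢
  constructor <;> linarith

end

/-! ### Uniform bound on the summands up to the diagonal -/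

section

open Set

lemma quadRatio_eq_of_edges {n : ℕ} {ℓ : ℝ} {P P' Q Q' : Space n}
    (hP : ‖P' - P‖ = ℓ) (hQ : ‖Q' - Q‖ = ℓ) :
    quadRatio P P' Q Q' = ‖Q - P‖ / ℓ * (‖Q' - P'‖ / ℓ) := by
  rw [quadRatio, hP, hQ, mul_div_mul_comm]

/-- Consecutive parameters `x₀ < x₁ < x₂` and `y₀ < y₁ < y₂` of vertices of an inscribed
equilateral polygon, the second ones lying behind the first ones on a short arc. -/
structure IsOrderedPair {n : ℕ} (F : ℝ → Space n) (ℓ x₀ x₁ x₂ y₀ y₁ y₂ : ℝ) : Prop where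
  x₀₁ : x₀ < x₁
  x₁₂ : x₁ < x₂
  y₀₁ : y₀ < y₁
  y₁₂ : y₁ < y₂
  x₁y₀ : x₁ ≤ y₀
  x₂y₁ : x₂ ≤ y₁
  near : y₀ - x₀ ≤ 1 / 2
  gap_x₀ : x₁ - x₀ ≤ 1 / 16
  gap_x₁ : x₂ - x₁ ≤ 1 / 16
  gap_y₀ : y₁ - y₀ ≤ 1 / 16
  gap_y₁ : y₂ - y₁ ≤ 1 / 16
  edge_x₀ : ‖F x₁ - F x₀‖ = ℓ
  edge_x₁ : ‖F x₂ - F x₁‖ = ℓ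
  edge_y₀ : ‖F y₁ - F y₀‖ = ℓ
  edge_y₁ : ‖F y₂ - F y₁‖ = ℓ

namespace IsRegularCurve

variable {n : ℕ} {F V : ℝ → Space n} {c L M : ℝ}

lemma gap_le (h : IsRegularCurve F V c L M) {s t : ℝ} (hst : s < t) (ht : t - s ≤ 3 / 4) :
    c * (t - s) ≤ ‖F t - F s‖ ∧ ‖F t - F s‖ ≤ L * (t - s) := by
  have h1 := h.lower t s (by rwa [abs_of_pos (sub_pos.2 hst)])
  have h2 := h.upper t s
  rw [abs_of_pos (sub_pos.2 hst)] at h1 h2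
  exact ⟨h1, h2⟩

/-- Edges of the same length ℓ differ by ℓ times the difference of their directions. -/
lemma norm_edge_sub_edge_le (h : IsRegularCurve F V c L M) {ℓ a H s t s' t' : ℝ} (hst : s < t)
    (hst' : s' < t') (hshort : t - s ≤ 3 / 4) (hs : a ≤ s) (ht : t ≤ a + H) (hs' : a ≤ s')
    (ht' : t' ≤ a + H) (hℓ : ‖F t - F s‖ = ℓ) (hℓ' : ‖F t' - F s'‖ = ℓ) :
    ‖(F t' - F s') - (F t - F s)‖ ≤ ℓ * (4 * M / c * H) := by
  have h1 := h.norm_dir_chord_sub_le hst hst' hshort hs ht hs' ht'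
  have h2 : (F t' - F s') - (F t - F s) = ℓ • (dir (F t' - F s') - dir (F t - F s)) := by
    rw [smul_sub]
    conv_rhs => rw [← hℓ', norm_smul_dir, hℓ', ← hℓ, norm_smul_dir]
  have hℓ0 : 0 ≤ ℓ := hℓ ▸ norm_nonneg _
  rw [h2, norm_smul, Real.norm_of_nonneg hℓ0]
  exact mul_le_mul_of_nonneg_left h1 hℓ0

/-- The defect is nonnegative by the triangle inequality and bounded above by `norm_chord_add_le`.
The rescaling by ℓ removes the edge factor, so the bound is purely quadratic in the window. -/
lemma abs_chord_defect_le (h : IsRegularCurve F V c L M) {ℓ H s t t' : ℝ} (hℓ : 0 < ℓ)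
    (hst : s ≤ t) (htt' : t < t') (hshort : t' - t ≤ 3 / 4) (hedge : ‖F t' - F t‖ = ℓ)
    (hH : t' - s ≤ H) :
    |‖F t - F s‖ / ℓ + 1 - ‖F t' - F s‖ / ℓ| ≤ (4 * M / c * H) ^ 2 := by
  have h1 := h.norm_chord_add_le hst htt' hshort
  have h2 : ‖F t' - F s‖ ≤ ‖F t - F s‖ + ‖F t' - F t‖ := by
    rw [← sub_add_sub_cancel' (F t) (F s) (F t')]
    exact norm_add_le _ _
  rw [hedge] at h1 h2
  have hK : 0 ≤ 4 * M / c := by have := h.c_pos; have := h.M_nonneg; positivity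
  have h3 : (4 * M / c * (t' - s)) ^ 2 ≤ (4 * M / c * H) ^ 2 :=
    pow_le_pow_left₀ (mul_nonneg hK (by linarith)) (mul_le_mul_of_nonneg_left hH hK) 2
  have e : ‖F t - F s‖ / ℓ + 1 - ‖F t' - F s‖ / ℓ = (‖F t - F s‖ + ℓ - ‖F t' - F s‖) / ℓ := by
    field_simp
  rw [e, abs_of_nonneg (div_nonneg (by linarith) hℓ.le), div_le_iff₀ hℓ]
  nlinarith [mul_le_mul_of_nonneg_left h3 hℓ.le]

lemma abs_chord_defect_le' (h : IsRegularCurve F V c L M) {ℓ H s' s t : ℝ} (hℓ : 0 < ℓ)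
    (hss' : s' < s) (hst : s ≤ t) (hshort : s - s' ≤ 3 / 4) (hedge : ‖F s - F s'‖ = ℓ)
    (hH : t - s' ≤ H) :
    |‖F t - F s‖ / ℓ + 1 - ‖F t - F s'‖ / ℓ| ≤ (4 * M / c * H) ^ 2 := by
  have h1 := h.norm_chord_add_le' hss' hst hshort
  have h2 : ‖F t - F s'‖ ≤ ‖F t - F s‖ + ‖F s - F s'‖ := by
    rw [← sub_add_sub_cancel (F t) (F s) (F s')]
    exact norm_add_le _ _
  rw [hedge] at h1 h2
  have hK : 0 ≤ 4 * M / c := by have := h.c_pos; have := h.M_nonneg; positivity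
  have h3 : (4 * M / c * (t - s')) ^ 2 ≤ (4 * M / c * H) ^ 2 :=
    pow_le_pow_left₀ (mul_nonneg hK (by linarith)) (mul_le_mul_of_nonneg_left hH hK) 2
  have e : ‖F t - F s‖ / ℓ + 1 - ‖F t - F s'‖ / ℓ = (‖F t - F s‖ + ℓ - ‖F t - F s'‖) / ℓ := by
    field_simp
  rw [e, abs_of_nonneg (div_nonneg (by linarith) hℓ.le), div_le_iff₀ hℓ]
  nlinarith [mul_le_mul_of_nonneg_left h3 hℓ.le]

/-- The summands of the discrete energies are of the order of the squared edge length, uniformly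
up to the diagonal. -/
theorem exists_energyTerm_le (h : IsRegularCurve F V c L M) :
    ∃ C : ℝ, 0 ≤ C ∧ ∀ {ℓ x₀ x₁ x₂ y₀ y₁ y₂ : ℝ}, 0 < ℓ → IsOrderedPair F ℓ x₀ x₁ x₂ y₀ y₁ y₂ →
      |energyTerm₁ (F x₀) (F x₁) (F x₂) (F y₀) (F y₁) (F y₂)| ≤ C * ℓ ^ 2 ∧
      |energyTerm₂ (F x₀) (F x₁) (F x₂) (F y₀) (F y₁) (F y₂)| ≤ C * ℓ ^ 2 := by
  have hc := h.c_pos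
  have hL := h.L_pos
  have hM := h.M_nonneg
  obtain ⟨K, hKdef⟩ : ∃ K, K = 4 * M / c := ⟨_, rfl⟩
  have hK : 0 ≤ K := by rw [hKdef]; positivity
  -- `C₀` will bound the whole window y₂ − x₀ by C₀r with r = y₀ − x₀: each of the two gaps
  -- following y₀ is at most ℓ/c ≤ (L/c)r.
  obtain ⟨C₀, hC₀def⟩ : ∃ C₀, C₀ = 1 + 2 * (L / c) := ⟨_, rfl⟩
  have hC₀ : 0 ≤ C₀ := by rw [hC₀def]; positivity
  -- γr²/ℓ² will bound the cross ratio from below; the factor 1 + L/c compares r with y₁ − x₁, which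
  -- may be smaller.
  obtain ⟨γ, hγdef⟩ : ∃ γ, γ = c ^ 2 / (1 + L / c) := ⟨_, rfl⟩
  have hγ : 0 < γ := by rw [hγdef]; positivity
  -- `C₁` and `A` are the constants of `abs_energy_bracket_le` for β = c/L and e₀ = K².
  obtain ⟨C₁, hC₁⟩ : ∃ C₁, C₁ = 6 + (6 + 3 * K ^ 2) / (c / L) := ⟨_, rfl⟩
  have hC₁0 : 0 ≤ C₁ := by rw [hC₁]; positivity
  obtain ⟨A, hA⟩ : ∃ A, A = 8 / (c / L) + 6 + 12 * K ^ 2 / (c / L) +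
    2 * (2 + 1 / (c / L)) * C₁ + C₁ ^ 2 * K ^ 2 := ⟨_, rfl⟩
  have hA0 : 0 ≤ A := by rw [hA]; positivity
  refine ⟨3 / 2 * (K * C₀) ^ 2 / γ + A * (K * C₀) ^ 2 * L ^ 2 / (2 * γ ^ 2), by positivity, ?_⟩
  intro ℓ x₀ x₁ x₂ y₀ y₁ y₂ hℓ hp
  obtain ⟨hx₀₁, hx₁₂, hy₀₁, hy₁₂, hx₁y₀, hx₂y₁, near, gx₀, gx₁, gy₀, gy₁, ex₀, ex₁, ey₀, ey₁⟩ := hp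
  obtain ⟨r, hr⟩ : ∃ r, r = y₀ - x₀ := ⟨_, rfl⟩
  have hr0 : 0 < r := by linarith
  have bx₀ := h.gap_le hx₀₁ (by linarith)
  have by₀ := h.gap_le hy₀₁ (by linarith)
  have by₁ := h.gap_le hy₁₂ (by linarith)
  rw [ex₀] at bx₀
  rw [ey₀] at by₀
  rw [ey₁] at by₁
  have hℓr : ℓ ≤ L * r := bx₀.2.trans (mul_le_mul_of_nonneg_left (by linarith) hL.le)
  obtain ⟨H, hH⟩ : ∃ H, H = y₂ - x₀ := ⟨_, rfl⟩
  have hH1 : H ≤ 1 := by linarith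
  have hH0 : 0 ≤ H := by linarith
  have gap_ℓ : ∀ {g : ℝ}, c * g ≤ ℓ → g ≤ L / c * r := fun {g} hg => by
    rw [div_mul_eq_mul_div, le_div_iff₀ hc]
    linarith
  have hHr : H ≤ C₀ * r := by
    have := gap_ℓ by₀.1
    have := gap_ℓ by₁.1
    rw [hC₀def]
    linarith
  obtain ⟨ε, hε⟩ : ∃ ε, ε = (K * H) ^ 2 := ⟨_, rfl⟩
  have hε0 : 0 ≤ ε := by rw [hε]; positivity
  have hεK : ε ≤ K ^ 2 := by
    rw [hε]
    exact pow_le_pow_left₀ (by positivity) (mul_le_of_le_one_right hK hH1) 2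
  have hεr : ε ≤ (K * C₀) ^ 2 * r ^ 2 := by
    rw [hε, ← mul_pow, mul_assoc]
    exact pow_le_pow_left₀ (by positivity) (mul_le_mul_of_nonneg_left hHr hK) 2
  -- The five defects express the other five distances in the cross ratios through ‖F y₀ − F x₀‖ and
  -- ℓ. All five triangles lie in the window [x₀, y₂], whence the common bound ε. The case x₁ = y₀
  -- of adjacent vertices is included.
  have η₁ := h.abs_chord_defect_le' (H := H) hℓ hx₀₁ hx₁y₀ (by linarith) ex₀ (by linarith)
  have η₂ := h.abs_chord_defect_le (H := H) hℓ (hx₀₁.le.trans hx₁y₀) hy₀₁ (by linarith) ey₀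
    (by linarith)
  have η₃ := h.abs_chord_defect_le (H := H) hℓ hx₁y₀ hy₀₁ (by linarith) ey₀ (by linarith)
  have η₄ := h.abs_chord_defect_le' (H := H) hℓ hx₁₂ hx₂y₁ (by linarith) ex₁ (by linarith)
  have η₅ := h.abs_chord_defect_le (H := H) hℓ (hx₁₂.le.trans hx₂y₁) hy₁₂ (by linarith) ey₁
    (by linarith)
  have hδ := abs_ratioDiffMixed_add_two_le (κ := K * H) hℓ ex₀ ex₁ ey₀ ey₁
    (hKdef ▸ h.norm_edge_sub_edge_le (a := x₀) hy₀₁ hx₀₁ (by linarith) (by linarith) (by linarith)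
      (by linarith) (by linarith) ey₀ ex₀)
    (hKdef ▸ h.norm_edge_sub_edge_le (a := x₀) hy₁₂ hx₀₁ (by linarith) (by linarith) (by linarith)
      (by linarith) (by linarith) ey₁ ex₀)
    (hKdef ▸ h.norm_edge_sub_edge_le (a := x₀) hy₀₁ hx₁₂ (by linarith) (by linarith) (by linarith)
      (by linarith) (by linarith) ey₀ ex₁)
    (hKdef ▸ h.norm_edge_sub_edge_le (a := x₀) hy₁₂ hx₁₂ (by linarith) (by linarith) (by linarith)
      (by linarith) (by linarith) ey₁ ex₁)
  rw [← hKdef, ← hε] at η₁ η₂ η₃ η₄ η₅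
  rw [← hε] at hδ
  have g₀₀ := quadRatio_eq_of_edges ex₀ ey₀
  have g₁₀ := quadRatio_eq_of_edges ex₁ ey₀
  have g₀₁ := quadRatio_eq_of_edges ex₀ ey₁
  have bD := h.gap_le (s := x₀) (t := y₀) (by linarith) (by linarith)
  have bD' := h.gap_le (s := x₁) (t := y₁) (by linarith) (by linarith)
  rw [← hr] at bD
  have hb : c / L ≤ ‖F y₀ - F x₀‖ / ℓ := by
    rw [div_le_div_iff₀ hL hℓ]
    calc c * ℓ ≤ c * (L * r) := mul_le_mul_of_nonneg_left hℓr hc.le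
      _ = c * r * L := by ring
      _ ≤ ‖F y₀ - F x₀‖ * L := mul_le_mul_of_nonneg_right bD.1 hL.le
  have hg : γ * r ^ 2 / ℓ ^ 2 ≤ quadRatio (F x₀) (F x₁) (F y₀) (F y₁) := by
    rw [g₀₀, div_mul_div_comm, ← pow_two]
    refine div_le_div_of_nonneg_right ?_ (by positivity)
    have h1 : r ≤ (1 + L / c) * (y₁ - x₁) := by
      have : x₁ - x₀ ≤ L / c * (y₁ - y₀) := by
        rw [div_mul_eq_mul_div, le_div_iff₀ hc]
        linarith
      have : L / c * (y₁ - y₀) ≤ L / c * (y₁ - x₁) :=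
        mul_le_mul_of_nonneg_left (by linarith) (by positivity)
      linarith
    have h2 : c * r / (1 + L / c) ≤ ‖F y₁ - F x₁‖ := by
      rw [div_le_iff₀ (by positivity)]
      calc c * r ≤ c * ((1 + L / c) * (y₁ - x₁)) := mul_le_mul_of_nonneg_left h1 hc.le
        _ = c * (y₁ - x₁) * (1 + L / c) := by ring
        _ ≤ ‖F y₁ - F x₁‖ * (1 + L / c) := mul_le_mul_of_nonneg_right bD'.1 (by positivity)
    calc γ * r ^ 2 = (c * r) * (c * r / (1 + L / c)) := by rw [hγdef]; ring
      _ ≤ ‖F y₀ - F x₀‖ * ‖F y₁ - F x₁‖ :=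
        mul_le_mul bD.1 h2 (by positivity) (norm_nonneg _)
  have hg0 : 0 < γ * r ^ 2 / ℓ ^ 2 := by positivity
  have hgpos := hg0.trans_le hg
  have hbL : ‖F y₀ - F x₀‖ / ℓ ≤ L * r / ℓ := div_le_div_of_nonneg_right bD.2 hℓ.le
  have bracket := abs_energy_bracket_le (div_pos hc hL) hb hε0 hεK η₁ η₂ η₃ η₄ η₅ hδ hC₁
  rw [← hA] at bracket
  constructor
  · rw [energyTerm₁, abs_mul, abs_of_pos (one_div_pos.2 hgpos)]
    have hm : |1 + 1 / 2 * ratioDiffMixed (F x₀) (F x₁) (F x₂) (F y₀) (F y₁) (F y₂)| ≤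
        3 / 2 * ε := by
      rw [abs_le] at hδ ⊢
      constructor <;> linarith
    calc 1 / quadRatio (F x₀) (F x₁) (F y₀) (F y₁) *
          |1 + 1 / 2 * ratioDiffMixed (F x₀) (F x₁) (F x₂) (F y₀) (F y₁) (F y₂)|
        ≤ 1 / (γ * r ^ 2 / ℓ ^ 2) * (3 / 2 * ((K * C₀) ^ 2 * r ^ 2)) :=
          mul_le_mul (one_div_le_one_div_of_le hg0 hg) (hm.trans (by linarith)) (abs_nonneg _)
            (by positivity)
      _ = 3 / 2 * (K * C₀) ^ 2 / γ * ℓ ^ 2 := by field_simp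
      _ ≤ _ := mul_le_mul_of_nonneg_right (le_add_of_nonneg_right (by positivity)) (by positivity)
  · rw [energyTerm₂, abs_neg, abs_mul,
      abs_of_pos (one_div_pos.2 (mul_pos two_pos (pow_pos hgpos 2)))]
    have hm : |ratioDiffMixed (F x₀) (F x₁) (F x₂) (F y₀) (F y₁) (F y₂) *
        (2 * quadRatio (F x₀) (F x₁) (F y₀) (F y₁)) -
        ratioDiffFst (F x₀) (F x₁) (F x₂) (F y₀) (F y₁) *
          ratioDiffSnd (F x₀) (F x₁) (F y₀) (F y₁) (F y₂) + 1| ≤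
        A * (ε * (‖F y₀ - F x₀‖ / ℓ) ^ 2) := by
      rw [ratioDiffFst, ratioDiffSnd, g₀₀, g₁₀, g₀₁]
      refine le_of_eq_of_le ?_ bracket
      congr 1
      ring
    have hm' : A * (ε * (‖F y₀ - F x₀‖ / ℓ) ^ 2) ≤
        A * (((K * C₀) ^ 2 * r ^ 2) * (L * r / ℓ) ^ 2) := by
      gcongr
    -- With b and the root of the cross ratio of order r/ℓ and ε of order r², the quotient εb²/g² is
    -- of order ℓ².
    calc 1 / (2 * quadRatio (F x₀) (F x₁) (F y₀) (F y₁) ^ 2) * _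
        ≤ 1 / (2 * (γ * r ^ 2 / ℓ ^ 2) ^ 2) *
          (A * (((K * C₀) ^ 2 * r ^ 2) * (L * r / ℓ) ^ 2)) := by
          refine mul_le_mul (one_div_le_one_div_of_le (by positivity) ?_) (hm.trans hm')
            (abs_nonneg _) (by positivity)
          gcongr
      _ = A * (K * C₀) ^ 2 * L ^ 2 / (2 * γ ^ 2) * ℓ ^ 2 := by field_simp
      _ ≤ _ := mul_le_mul_of_nonneg_right (le_add_of_nonneg_left (by positivity)) (by positivity)

end IsRegularCurve

end

section

/-! ### Limits of the summands off the diagonal -/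

open Set Filter Topology

lemma tendsto_dir {ι : Type*} {l : Filter ι} {E : Type*} [NormedAddCommGroup E]
    [InnerProductSpace ℝ E] {v : ι → E} {w : E} (hw : w ≠ 0) (h : Tendsto v l (𝓝 w)) :
    Tendsto (fun i => dir (v i)) l (𝓝 (dir w)) :=
  (h.norm.inv₀ (norm_ne_zero_iff.2 hw)).smul h

/-- The derivative of the norm along a sequence. -/
lemma tendsto_norm_add_sub_norm_div {ι : Type*} {l : Filter ι} {E : Type*} [NormedAddCommGroup E]
    [InnerProductSpace ℝ E] {u u' : ι → E} {ℓ : ι → ℝ} {v w : E} (hv : v ≠ 0)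
    (hℓ : ∀ᶠ i in l, 0 < ℓ i) (hu : Tendsto u l (𝓝 v)) (hu' : Tendsto u' l (𝓝 v))
    (hw : Tendsto (fun i => (ℓ i)⁻¹ • (u' i - u i)) l (𝓝 w)) :
    Tendsto (fun i => (‖u' i‖ - ‖u i‖) / ℓ i) l (𝓝 (inner ℝ v w / ‖v‖)) := by
  have hv' : 0 < ‖v‖ := norm_pos_iff.2 hv
  have h1 : Tendsto (fun i => inner ℝ (u' i + u i) ((ℓ i)⁻¹ • (u' i - u i)) / (‖u' i‖ + ‖u i‖)) l
      (𝓝 (inner ℝ (v + v) w / (‖v‖ + ‖v‖))) :=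
    ((hu'.add hu).inner hw).div (hu'.norm.add hu.norm) (by positivity)
  have h2 : inner ℝ (v + v) w / (‖v‖ + ‖v‖) = inner ℝ v w / ‖v‖ := by
    rw [← two_mul, ← two_smul ℝ v, real_inner_smul_left, mul_div_mul_left _ _ two_ne_zero]
  rw [h2] at h1
  refine h1.congr' ?_
  filter_upwards [hℓ, hu.norm.eventually_const_lt hv'] with i hi hui
  have : inner ℝ (u' i + u i) (u' i - u i) = (‖u' i‖ - ‖u i‖) * (‖u' i‖ + ‖u i‖) := by
    rw [inner_add_left, inner_sub_right, inner_sub_right, real_inner_self_eq_norm_sq,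
      real_inner_self_eq_norm_sq, real_inner_comm (u' i) (u i)]
    ring
  have hne : ‖u' i‖ + ‖u i‖ ≠ 0 := (add_pos_of_nonneg_of_pos (norm_nonneg _) hui).ne'
  rw [real_inner_smul_right, this, ← mul_assoc, mul_div_cancel_right₀ _ hne, div_eq_inv_mul]

namespace IsRegularCurve

variable {n : ℕ} {F V : ℝ → Space n} {c L M : ℝ}

lemma continuous (h : IsRegularCurve F V c L M) : Continuous F :=
  continuous_iff_continuousAt.2 fun t => (h.hasDerivAt t).continuousAt

lemma continuous_deriv (h : IsRegularCurve F V c L M) : Continuous V :=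
  (LipschitzWith.of_dist_le_mul (K := ⟨M, h.M_nonneg⟩) fun s t => by
    rw [dist_eq_norm, Real.dist_eq]
    exact h.lipschitz_deriv s t).continuous

lemma le_norm_deriv (h : IsRegularCurve F V c L M) (t : ℝ) : c ≤ ‖V t‖ := by
  have h1 : Tendsto (fun s => ‖slope F t s‖) (𝓝[≠] t) (𝓝 ‖V t‖) :=
    (hasDerivAt_iff_tendsto_slope.1 (h.hasDerivAt t)).norm
  refine ge_of_tendsto h1 ?_
  have h2 : ∀ᶠ s in 𝓝[≠] t, |s - t| < 3 / 4 := by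
    refine nhdsWithin_le_nhds ?_
    filter_upwards [Metric.ball_mem_nhds t (show (0 : ℝ) < 3 / 4 by norm_num)] with s hs
    rwa [Metric.mem_ball, Real.dist_eq] at hs
  filter_upwards [h2, self_mem_nhdsWithin] with s hs hst
  have hp : 0 < |s - t| := abs_pos.2 (sub_ne_zero.2 hst)
  rw [slope_def_module, norm_smul, norm_inv, Real.norm_eq_abs, le_inv_mul_iff₀ hp, mul_comm]
  exact h.lower s t hs.le

lemma deriv_ne_zero (h : IsRegularCurve F V c L M) (t : ℝ) : V t ≠ 0 :=
  norm_pos_iff.1 (h.c_pos.trans_le (h.le_norm_deriv t))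

variable {ι : Type*} {l : Filter ι} {X₀ X₁ X₂ Y₀ Y₁ Y₂ ℓ : ι → ℝ} {x y : ℝ}

lemma tendsto_slope (h : IsRegularCurve F V c L M) (hlt : ∀ᶠ i in l, X₀ i < X₁ i)
    (h₀ : Tendsto X₀ l (𝓝 x)) (h₁ : Tendsto X₁ l (𝓝 x)) :
    Tendsto (fun i => (X₁ i - X₀ i)⁻¹ • (F (X₁ i) - F (X₀ i))) l (𝓝 (V x)) := by
  rw [tendsto_iff_norm_sub_tendsto_zero]
  have hb : Tendsto (fun i => M * (max (X₁ i) x - min (X₀ i) x)) l (𝓝 0) := by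
    have := ((h₁.max (tendsto_const_nhds (x := x))).sub
      (h₀.min (tendsto_const_nhds (x := x)))).const_mul M
    simpa using this
  refine squeeze_zero' (Eventually.of_forall fun _ => norm_nonneg _) ?_ hb
  filter_upwards [hlt] with i hi
  refine h.norm_slope_sub_le hi (min_le_left _ x) ?_ ?_
  · rw [add_sub_cancel]
    exact le_max_left _ _
  · rw [add_sub_cancel]
    exact ⟨min_le_right _ _, le_max_right _ _⟩

lemma tendsto_unit_edge (h : IsRegularCurve F V c L M) (hlt : ∀ᶠ i in l, X₀ i < X₁ i)
    (h₀ : Tendsto X₀ l (𝓝 x)) (h₁ : Tendsto X₁ l (𝓝 x))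
    (hedge : ∀ᶠ i in l, ‖F (X₁ i) - F (X₀ i)‖ = ℓ i) :
    Tendsto (fun i => (ℓ i)⁻¹ • (F (X₁ i) - F (X₀ i))) l (𝓝 (dir (V x))) := by
  refine (tendsto_dir (h.deriv_ne_zero x) (h.tendsto_slope hlt h₀ h₁)).congr' ?_
  filter_upwards [hlt, hedge] with i hi he
  rw [dir_smul_of_pos (inv_pos.2 (sub_pos.2 hi)), dir, he]

lemma tendsto_edge_div_gap (h : IsRegularCurve F V c L M) (hlt : ∀ᶠ i in l, X₀ i < X₁ i)
    (h₀ : Tendsto X₀ l (𝓝 x)) (h₁ : Tendsto X₁ l (𝓝 x))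
    (hedge : ∀ᶠ i in l, ‖F (X₁ i) - F (X₀ i)‖ = ℓ i) :
    Tendsto (fun i => ℓ i / (X₁ i - X₀ i)) l (𝓝 ‖V x‖) := by
  refine (h.tendsto_slope hlt h₀ h₁).norm.congr' ?_
  filter_upwards [hlt, hedge] with i hi he
  rw [norm_smul, he, norm_inv, Real.norm_of_nonneg (sub_pos.2 hi).le, div_eq_inv_mul]

/-- Off the diagonal, the summands of the discrete energies converge to the energy densities. -/
theorem tendsto_energyTerm_div (h : IsRegularCurve F V c L M) (hℓ : ∀ᶠ i in l, 0 < ℓ i)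
    (hX₀₁ : ∀ᶠ i in l, X₀ i < X₁ i) (hX₁₂ : ∀ᶠ i in l, X₁ i < X₂ i)
    (hY₀₁ : ∀ᶠ i in l, Y₀ i < Y₁ i) (hY₁₂ : ∀ᶠ i in l, Y₁ i < Y₂ i)
    (hX₀ : Tendsto X₀ l (𝓝 x)) (hX₁ : Tendsto X₁ l (𝓝 x)) (hX₂ : Tendsto X₂ l (𝓝 x))
    (hY₀ : Tendsto Y₀ l (𝓝 y)) (hY₁ : Tendsto Y₁ l (𝓝 y)) (hY₂ : Tendsto Y₂ l (𝓝 y))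
    (eX₀ : ∀ᶠ i in l, ‖F (X₁ i) - F (X₀ i)‖ = ℓ i) (eX₁ : ∀ᶠ i in l, ‖F (X₂ i) - F (X₁ i)‖ = ℓ i)
    (eY₀ : ∀ᶠ i in l, ‖F (Y₁ i) - F (Y₀ i)‖ = ℓ i) (eY₁ : ∀ᶠ i in l, ‖F (Y₂ i) - F (Y₁ i)‖ = ℓ i)
    (hxy : F x ≠ F y) :
    Tendsto (fun i => energyTerm₁ (F (X₀ i)) (F (X₁ i)) (F (X₂ i)) (F (Y₀ i)) (F (Y₁ i))
        (F (Y₂ i)) / ((X₁ i - X₀ i) * (Y₁ i - Y₀ i))) l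
      (𝓝 (1 / ‖F y - F x‖ ^ 2 * (1 - inner ℝ (dir (V x)) (dir (V y))) * (‖V x‖ * ‖V y‖))) ∧
    Tendsto (fun i => energyTerm₂ (F (X₀ i)) (F (X₁ i)) (F (X₂ i)) (F (Y₀ i)) (F (Y₁ i))
        (F (Y₂ i)) / ((X₁ i - X₀ i) * (Y₁ i - Y₀ i))) l
      (𝓝 ((2 * inner ℝ (dir (V x)) (dir (V y)) / ‖F y - F x‖ ^ 2 -
        2 * inner ℝ (F y - F x) (dir (V x)) * inner ℝ (F y - F x) (dir (V y)) /
          ‖F y - F x‖ ^ 4) * (‖V x‖ * ‖V y‖))) := by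
  have hv : F y - F x ≠ 0 := sub_ne_zero.2 hxy.symm
  have hv' : ‖F y - F x‖ ≠ 0 := norm_ne_zero_iff.2 hv
  have hF : ∀ {Z : ι → ℝ} {z : ℝ}, Tendsto Z l (𝓝 z) → Tendsto (fun i => F (Z i)) l (𝓝 (F z)) :=
    fun hZ => (h.continuous.tendsto _).comp hZ
  have FX₀ := hF hX₀
  have FX₁ := hF hX₁
  have FX₂ := hF hX₂
  have FY₀ := hF hY₀
  have FY₁ := hF hY₁
  have FY₂ := hF hY₂
  have tX₀ := h.tendsto_unit_edge hX₀₁ hX₀ hX₁ eX₀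
  have tX₁ := h.tendsto_unit_edge hX₁₂ hX₁ hX₂ eX₁
  have tY₀ := h.tendsto_unit_edge hY₀₁ hY₀ hY₁ eY₀
  have tY₁ := h.tendsto_unit_edge hY₁₂ hY₁ hY₂ eY₁
  have sX := h.tendsto_edge_div_gap hX₀₁ hX₀ hX₁ eX₀
  have sY := h.tendsto_edge_div_gap hY₀₁ hY₀ hY₁ eY₀
  have hℓ0 : Tendsto ℓ l (𝓝 0) := by
    have := (FX₁.sub FX₀).norm
    rw [sub_self, norm_zero] at this
    exact this.congr' eX₀
  generalize dir (V x) = τ at *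
  generalize dir (V y) = σ at *
  have both : ∀ {P P' Q Q' : ι → Space n}, Tendsto P l (𝓝 (F x)) → Tendsto P' l (𝓝 (F x)) →
      Tendsto Q l (𝓝 (F y)) → Tendsto Q' l (𝓝 (F y)) →
      Tendsto (fun i => (ℓ i)⁻¹ • (P' i - P i)) l (𝓝 τ) →
      Tendsto (fun i => (ℓ i)⁻¹ • (Q' i - Q i)) l (𝓝 σ) →
      Tendsto (fun i => (‖Q' i - P' i‖ - ‖Q i - P i‖) / ℓ i) l
        (𝓝 (inner ℝ (F y - F x) (σ - τ) / ‖F y - F x‖)) := by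
    intro P P' Q Q' hP hP' hQ hQ' hτ hσ
    refine tendsto_norm_add_sub_norm_div hv hℓ (hQ.sub hP) (hQ'.sub hP') ((hσ.sub hτ).congr ?_)
    intro i
    rw [← smul_sub]
    congr 1
    abel
  have fst : ∀ {P P' Q : ι → Space n}, Tendsto P l (𝓝 (F x)) → Tendsto P' l (𝓝 (F x)) →
      Tendsto Q l (𝓝 (F y)) → Tendsto (fun i => (ℓ i)⁻¹ • (P' i - P i)) l (𝓝 τ) →
      Tendsto (fun i => (‖Q i - P' i‖ - ‖Q i - P i‖) / ℓ i) l
        (𝓝 (inner ℝ (F y - F x) (-τ) / ‖F y - F x‖)) := by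
    intro P P' Q hP hP' hQ hτ
    refine tendsto_norm_add_sub_norm_div hv hℓ (hQ.sub hP) (hQ.sub hP') (hτ.neg.congr ?_)
    intro i
    rw [← smul_neg]
    congr 1
    abel
  have snd : ∀ {P Q Q' : ι → Space n}, Tendsto P l (𝓝 (F x)) → Tendsto Q l (𝓝 (F y)) →
      Tendsto Q' l (𝓝 (F y)) → Tendsto (fun i => (ℓ i)⁻¹ • (Q' i - Q i)) l (𝓝 σ) →
      Tendsto (fun i => (‖Q' i - P i‖ - ‖Q i - P i‖) / ℓ i) l
        (𝓝 (inner ℝ (F y - F x) σ / ‖F y - F x‖)) := by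
    intro P Q Q' hP hQ hQ' hσ
    refine tendsto_norm_add_sub_norm_div hv hℓ (hQ.sub hP) (hQ'.sub hP) (hσ.congr ?_)
    intro i
    congr 1
    abel
  have hg : Tendsto (fun i => ℓ i ^ 2 * quadRatio (F (X₀ i)) (F (X₁ i)) (F (Y₀ i)) (F (Y₁ i))) l
      (𝓝 (‖F y - F x‖ ^ 2)) := by
    rw [pow_two ‖F y - F x‖]
    refine ((FY₀.sub FX₀).norm.mul (FY₁.sub FX₁).norm).congr' ?_
    filter_upwards [hℓ, eX₀, eY₀] with i hi h1 h2
    rw [quadRatio, h1, h2]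
    field_simp
  have hmixed : Tendsto (fun i => ratioDiffMixed (F (X₀ i)) (F (X₁ i)) (F (X₂ i)) (F (Y₀ i))
      (F (Y₁ i)) (F (Y₂ i))) l (𝓝 (-2 * inner ℝ τ σ)) := by
    -- The four squared difference quotients have the same limit and cancel in pairs; only the inner
    -- products survive.
    have := (((tX₀.inner tY₀ (𝕜 := ℝ)).neg.sub (tX₁.inner tY₁)).sub
      ((((((both FX₁ FX₂ FY₁ FY₂ tX₁ tY₁).pow 2).sub ((both FX₁ FX₂ FY₀ FY₁ tX₁ tY₀).pow 2)).sub
        ((both FX₀ FX₁ FY₁ FY₂ tX₀ tY₁).pow 2)).add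
        ((both FX₀ FX₁ FY₀ FY₁ tX₀ tY₀).pow 2)).div_const 2))
    have e : -2 * inner ℝ τ σ = -inner ℝ τ σ - inner ℝ τ σ -
        ((inner ℝ (F y - F x) (σ - τ) / ‖F y - F x‖) ^ 2 -
          (inner ℝ (F y - F x) (σ - τ) / ‖F y - F x‖) ^ 2 -
          (inner ℝ (F y - F x) (σ - τ) / ‖F y - F x‖) ^ 2 +
          (inner ℝ (F y - F x) (σ - τ) / ‖F y - F x‖) ^ 2) / 2 := by ring
    rw [e]
    refine this.congr' ?_
    filter_upwards [hℓ, eX₀, eX₁, eY₀, eY₁] with i hi h1 h2 h3 h4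
    have key := sq_mul_ratioDiffMixed hi h1 h2 h3 h4
    have hi2 : ℓ i ^ 2 ≠ 0 := by positivity
    rw [← mul_right_inj' hi2, key]
    simp only [real_inner_smul_left, real_inner_smul_right]
    field_simp
  have hfst : Tendsto (fun i => ℓ i * ratioDiffFst (F (X₀ i)) (F (X₁ i)) (F (X₂ i)) (F (Y₀ i))
      (F (Y₁ i))) l (𝓝 (-2 * inner ℝ (F y - F x) τ)) := by
    have := ((FY₀.sub FX₁).norm.mul (fst FX₁ FX₂ FY₁ tX₁)).add
      ((FY₁.sub FX₁).norm.mul (fst FX₀ FX₁ FY₀ tX₀))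
    have e : -2 * inner ℝ (F y - F x) τ =
        ‖F y - F x‖ * (inner ℝ (F y - F x) (-τ) / ‖F y - F x‖) +
        ‖F y - F x‖ * (inner ℝ (F y - F x) (-τ) / ‖F y - F x‖) := by
      rw [mul_div_cancel₀ _ hv', inner_neg_right]
      ring
    rw [e]
    refine this.congr' ?_
    filter_upwards [hℓ, eX₀, eX₁, eY₀] with i hi h1 h2 h3
    rw [ratioDiffFst, quadRatio, quadRatio, h1, h2, h3]
    field_simp
    ring
  have hsnd : Tendsto (fun i => ℓ i * ratioDiffSnd (F (X₀ i)) (F (X₁ i)) (F (Y₀ i)) (F (Y₁ i))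
      (F (Y₂ i))) l (𝓝 (2 * inner ℝ (F y - F x) σ)) := by
    have := ((FY₁.sub FX₀).norm.mul (snd FX₁ FY₁ FY₂ tY₁)).add
      ((FY₁.sub FX₁).norm.mul (snd FX₀ FY₀ FY₁ tY₀))
    have e : 2 * inner ℝ (F y - F x) σ =
        ‖F y - F x‖ * (inner ℝ (F y - F x) σ / ‖F y - F x‖) +
        ‖F y - F x‖ * (inner ℝ (F y - F x) σ / ‖F y - F x‖) := by
      rw [mul_div_cancel₀ _ hv']
      ring
    rw [e]
    refine this.congr' ?_
    filter_upwards [hℓ, eX₀, eY₀, eY₁] with i hi h1 h2 h3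
    rw [ratioDiffSnd, quadRatio, quadRatio, h1, h2, h3]
    field_simp
    ring
  have hv2 : ‖F y - F x‖ ^ 2 ≠ 0 := pow_ne_zero 2 hv'
  constructor
  · have := (((hg.inv₀ hv2).mul ((hmixed.const_mul (1 / 2)).const_add 1)).mul (sX.mul sY))
    have e : 1 / ‖F y - F x‖ ^ 2 * (1 - inner ℝ τ σ) * (‖V x‖ * ‖V y‖) =
        (‖F y - F x‖ ^ 2)⁻¹ * (1 + 1 / 2 * (-2 * inner ℝ τ σ)) * (‖V x‖ * ‖V y‖) := by
      ring
    rw [e]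
    refine this.congr' ?_
    filter_upwards [hℓ] with i hi
    rw [energyTerm₁]
    field_simp
  -- Multiplying the bracket by ℓ² turns its summand 1 into ℓ², so this correction disappears off
  -- the diagonal.
  · have := (((hmixed.mul (hg.const_mul 2)).sub (hfst.mul hsnd)).add (hℓ0.pow 2)).neg.mul
      ((((hg.pow 2).const_mul 2).inv₀ (by positivity)).mul (sX.mul sY))
    have e : (2 * inner ℝ τ σ / ‖F y - F x‖ ^ 2 -
        2 * inner ℝ (F y - F x) τ * inner ℝ (F y - F x) σ / ‖F y - F x‖ ^ 4) *
          (‖V x‖ * ‖V y‖) =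
        -(-2 * inner ℝ τ σ * (2 * ‖F y - F x‖ ^ 2) -
          -2 * inner ℝ (F y - F x) τ * (2 * inner ℝ (F y - F x) σ) + 0 ^ 2) *
        ((2 * (‖F y - F x‖ ^ 2) ^ 2)⁻¹ * (‖V x‖ * ‖V y‖)) := by
      field_simp
      ring
    rw [e]
    refine this.congr' ?_
    filter_upwards [hℓ] with i hi
    rw [energyTerm₂]
    field_simp

end IsRegularCurve

end

section

/-! ### Subdivisions of the circle -/

open Set MeasureTheory

/-- A subdivision of the circle, unrolled to the line: `Θ` enumerates the parameters over `ℤ`,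
and `ι k` is the vertex index of `Θ k`. -/
structure IsUnrolling {m : ℕ} (θ : Fin m → ℝ) (Θ : ℤ → ℝ) (ι : ℤ → Fin m) : Prop where
  m_pos : 0 < m
  strictMono : StrictMono Θ
  add_period : ∀ k z : ℤ, Θ (k + m * z) = Θ k + z
  index_add : ∀ k z : ℤ, ι (k + m * z) = ι k
  index_natCast : ∀ i : Fin m, ι (i : ℕ) = i
  exists_of_index_eq : ∀ a b : ℤ, ι a = ι b → ∃ z : ℤ, a = b + m * z
  next_index : ∀ k, next (ι k) = ι (k + 1)
  coe_eq : ∀ k, (Θ k : UnitAddCircle) = (θ (ι k) : UnitAddCircle)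

/-- Take Θ k = θ(k mod m) + ⌊k/m⌋. A step either advances inside one period or wraps from the last
vertex to the first and adds 1; it increases Θ in the second case because the θ values lie in [0,
1). -/
theorem IsSubdivision.exists_isUnrolling {m : ℕ} (hm : 0 < m) {θ : Fin m → ℝ}
    (hθ : IsSubdivision θ) : ∃ Θ ι, IsUnrolling θ Θ ι := by
  have hmz : (0 : ℤ) < m := by exact_mod_cast hm
  have hmod0 : ∀ k : ℤ, 0 ≤ k % m := fun k => Int.emod_nonneg k hmz.ne'
  have hmodm : ∀ k : ℤ, k % m < m := fun k => Int.emod_lt_of_pos k hmz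
  let ι : ℤ → Fin m := fun k => ⟨(k % m).toNat, by have := hmod0 k; have := hmodm k; omega⟩
  have hι : ∀ k, ((ι k : ℕ) : ℤ) = k % m := fun k => Int.toNat_of_nonneg (hmod0 k)
  have step : ∀ k : ℤ, ((ι (k + 1) : ℕ) = ι k + 1 ∧ (k + 1) / m = k / m) ∨
      ((ι k : ℕ) + 1 = m ∧ (ι (k + 1) : ℕ) = 0 ∧ (k + 1) / m = k / m + 1) := by
    intro k
    have hk := Int.emod_add_mul_ediv k m
    rcases (show k % m + 1 < m ∨ k % m + 1 = m by have := hmodm k; omega) with hlt | heq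
    · left
      have h1 := (Int.ediv_emod_unique hmz (a := k + 1) (q := k / m) (r := k % m + 1)).2
        ⟨by linarith, by have := hmod0 k; omega, hlt⟩
      have h2 := hι (k + 1)
      rw [h1.2, ← hι k] at h2
      exact ⟨by exact_mod_cast h2, h1.1⟩
    · right
      have h1 := (Int.ediv_emod_unique hmz (a := k + 1) (q := k / m + 1) (r := 0)).2
        ⟨by linarith, le_rfl, hmz⟩
      have h2 := hι (k + 1)
      rw [h1.2] at h2
      rw [← hι k] at heq
      exact ⟨by exact_mod_cast heq, by exact_mod_cast h2, h1.1⟩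
  refine ⟨fun k => θ (ι k) + (k / m : ℤ), ι, hm, strictMono_int_of_lt_succ fun k => ?_,
    fun k z => ?_, fun k z => ?_, fun i => ?_, fun a b hab => ?_, fun k => ?_, fun k => ?_⟩
  · rcases step k with ⟨h1, h2⟩ | ⟨-, -, h3⟩
    · rw [h2]
      have : ι k < ι (k + 1) := by rw [Fin.lt_def, h1]; omega
      linarith [hθ.1 this]
    · rw [h3]
      push_cast
      linarith [(hθ.2 (ι k)).2, (hθ.2 (ι (k + 1))).1]
  · have h1 : ι (k + m * z) = ι k := by
      apply Fin.ext
      have := hι (k + m * z)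
      rw [Int.add_mul_emod_self_left, ← hι k] at this
      exact_mod_cast this
    rw [h1, Int.add_mul_ediv_left _ _ hmz.ne']
    push_cast
    ring
  · apply Fin.ext
    have := hι (k + m * z)
    rw [Int.add_mul_emod_self_left, ← hι k] at this
    exact_mod_cast this
  · apply Fin.ext
    have := hι (i : ℕ)
    rw [Int.emod_eq_of_lt (by positivity) (by exact_mod_cast i.2)] at this
    exact_mod_cast this
  · have h1 : a % m = b % m := by rw [← hι, ← hι, hab]
    obtain ⟨z, hz⟩ := Int.ModEq.dvd (show b ≡ a [ZMOD m] from h1.symm)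
    exact ⟨z, by linarith⟩
  · obtain ⟨m', rfl⟩ : ∃ m', m = m' + 1 := ⟨m - 1, by omega⟩
    rcases step k with ⟨h1, -⟩ | ⟨h1, h2, -⟩
    · apply Fin.ext
      rw [h1, next, coe_finRotate_of_ne_last]
      intro hl
      have := (ι (k + 1)).2
      rw [h1, hl, Fin.val_last] at this
      omega
    · have hl : ι k = Fin.last m' := Fin.ext (by rw [Fin.val_last]; omega)
      rw [next, hl, finRotate_last]
      exact Fin.ext h2.symm
  · rw [AddCircle.coe_add, add_eq_left, AddCircle.coe_eq_zero_iff]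
    exact ⟨k / m, by simp⟩

/-! ### Cells and step functions -/

namespace IsUnrolling

variable {m : ℕ} {θ : Fin m → ℝ} {Θ : ℤ → ℝ} {ι : ℤ → Fin m}

lemma exists_mem_cell (h : IsUnrolling θ Θ ι) (x : ℝ) : ∃ k, x ∈ Ico (Θ k) (Θ (k + 1)) := by
  have h0 : ∀ z : ℤ, Θ (m * z) = Θ 0 + z := fun z => by simpa using h.add_period 0 z
  obtain ⟨k, hk, hmax⟩ := Int.exists_greatest_of_bdd (P := fun k => Θ k ≤ x)
    ⟨m * (⌊x - Θ 0⌋ + 1), fun z hz => by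
      by_contra hlt
      push Not at hlt
      have := h.strictMono hlt
      rw [h0] at this
      push_cast at this
      linarith [Int.lt_floor_add_one (x - Θ 0)]⟩
    ⟨m * ⌊x - Θ 0⌋, by rw [h0]; linarith [Int.floor_le (x - Θ 0)]⟩
  refine ⟨k, hk, ?_⟩
  by_contra hle
  push Not at hle
  have := hmax _ hle
  omega

lemma cell_unique (h : IsUnrolling θ Θ ι) {x : ℝ} {a b : ℤ} (ha : x ∈ Ico (Θ a) (Θ (a + 1)))
    (hb : x ∈ Ico (Θ b) (Θ (b + 1))) : a = b := by
  have h1 := h.strictMono.lt_iff_lt.1 (ha.1.trans_lt hb.2)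
  have h2 := h.strictMono.lt_iff_lt.1 (hb.1.trans_lt ha.2)
  omega

lemma gap_add (h : IsUnrolling θ Θ ι) (a z : ℤ) :
    Θ (a + m * z + 1) - Θ (a + m * z) = Θ (a + 1) - Θ a := by
  rw [show a + m * z + 1 = (a + 1) + m * z by ring, h.add_period, h.add_period]
  ring

lemma gap_pos (h : IsUnrolling θ Θ ι) (a : ℤ) : 0 < Θ (a + 1) - Θ a :=
  sub_pos.2 (h.strictMono (by omega))

/-- The union of the cells with vertex index `i`. -/
def cells (Θ : ℤ → ℝ) (ι : ℤ → Fin m) (i : Fin m) : Set ℝ :=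
  ⋃ k, ⋃ (_ : ι k = i), Ico (Θ k) (Θ (k + 1))

/-- The density of the uniform distribution on the `i`-th cell. -/
def cellDensity (Θ : ℤ → ℝ) (ι : ℤ → Fin m) (i : Fin m) : ℝ → ℝ :=
  (cells Θ ι i).indicator fun _ => (Θ ((i : ℕ) + 1) - Θ (i : ℕ))⁻¹

lemma measurableSet_cells (Θ : ℤ → ℝ) (ι : ℤ → Fin m) (i : Fin m) :
    MeasurableSet (cells Θ ι i) :=
  MeasurableSet.iUnion fun _ => MeasurableSet.iUnion fun _ => measurableSet_Ico

lemma measurable_cellDensity (Θ : ℤ → ℝ) (ι : ℤ → Fin m) (i : Fin m) :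
    Measurable (cellDensity Θ ι i) :=
  measurable_const.indicator (measurableSet_cells Θ ι i)

lemma mem_cells_iff (h : IsUnrolling θ Θ ι) {x : ℝ} {a : ℤ} (ha : x ∈ Ico (Θ a) (Θ (a + 1)))
    (i : Fin m) : x ∈ cells Θ ι i ↔ ι a = i := by
  simp only [cells, mem_iUnion, exists_prop]
  constructor
  · rintro ⟨k, hk, hx⟩
    rw [h.cell_unique ha hx, hk]
  · exact fun hi => ⟨a, hi, ha⟩

lemma cellDensity_apply (h : IsUnrolling θ Θ ι) {x : ℝ} {a : ℤ} (ha : x ∈ Ico (Θ a) (Θ (a + 1)))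
    (i : Fin m) : cellDensity Θ ι i x = if ι a = i then (Θ (a + 1) - Θ a)⁻¹ else 0 := by
  have hmem := h.mem_cells_iff ha i
  split_ifs with hi
  · rw [cellDensity, indicator_of_mem (hmem.2 hi)]
    obtain ⟨z, rfl⟩ := h.exists_of_index_eq a (i : ℕ) (by rw [hi, h.index_natCast])
    rw [h.gap_add]
  · exact indicator_of_notMem (fun hx => hi (hmem.1 hx)) _

lemma mem_cell_add_int (h : IsUnrolling θ Θ ι) {x : ℝ} {a : ℤ}
    (ha : x ∈ Ico (Θ a) (Θ (a + 1))) (z : ℤ) :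
    x + z ∈ Ico (Θ (a + m * z)) (Θ (a + m * z + 1)) := by
  rw [show a + m * z + 1 = (a + 1) + m * z by ring, h.add_period, h.add_period]
  exact ⟨by linarith [ha.1], by linarith [ha.2]⟩

lemma periodic_cellDensity (h : IsUnrolling θ Θ ι) (i : Fin m) :
    Function.Periodic (cellDensity Θ ι i) 1 := by
  intro x
  obtain ⟨a, ha⟩ := h.exists_mem_cell x
  have ha' := h.mem_cell_add_int ha 1
  rw [Int.cast_one] at ha'
  rw [h.cellDensity_apply ha, h.cellDensity_apply ha', h.index_add, h.gap_add]

/-- By periodicity [0, 1] may be replaced by the period starting at Θ i, which meets the cells of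
index i in one uncut interval. In [0, 1] itself the last cell can be split by the base point. -/
lemma integral_cellDensity (h : IsUnrolling θ Θ ι) (i : Fin m) :
    ∫ x in Icc (0 : ℝ) 1, cellDensity Θ ι i x = 1 := by
  have hper := (h.periodic_cellDensity i).intervalIntegral_add_eq 0 (Θ (i : ℕ))
  rw [zero_add, intervalIntegral.integral_of_le zero_le_one, ← integral_Icc_eq_integral_Ioc,
    intervalIntegral.integral_of_le (by linarith), ← integral_Ico_eq_integral_Ioc] at hper
  rw [hper, cellDensity, setIntegral_indicator (measurableSet_cells Θ ι i)]
  have hper1 : Θ ((i : ℕ) + m * 1) = Θ (i : ℕ) + 1 := by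
    rw [h.add_period, Int.cast_one]
  have hset : Ico (Θ (i : ℕ)) (Θ (i : ℕ) + 1) ∩ cells Θ ι i = Ico (Θ (i : ℕ)) (Θ ((i : ℕ) + 1)) := by
    ext x
    constructor
    · rintro ⟨⟨h1, h2⟩, hx⟩
      simp only [cells, mem_iUnion, exists_prop] at hx
      obtain ⟨k, hk, hx⟩ := hx
      obtain ⟨z, rfl⟩ := h.exists_of_index_eq k (i : ℕ) (by rw [hk, h.index_natCast])
      rw [show ((i : ℕ) : ℤ) + m * z + 1 = ((i : ℕ) + 1) + m * z by ring, h.add_period,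
        h.add_period] at hx
      have hle : Θ ((i : ℕ) + 1) ≤ Θ (i : ℕ) + 1 := by
        rw [← hper1]
        refine h.strictMono.monotone ?_
        have := h.m_pos
        omega
      have hz1 : (z : ℝ) < 1 := by linarith [hx.1]
      have hz2 : (-1 : ℝ) < z := by linarith [hx.2]
      have hz : z = 0 := by
        have : z < 1 := by exact_mod_cast hz1
        have : -1 < z := by exact_mod_cast hz2
        omega
      subst hz
      simpa using hx
    · intro hx
      refine ⟨⟨hx.1, hx.2.trans_le ?_⟩, (h.mem_cells_iff hx i).2 (h.index_natCast i)⟩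
      rw [← hper1]
      refine h.strictMono.monotone ?_
      have := h.m_pos
      omega
  have hp := h.gap_pos (i : ℕ)
  rw [hset, setIntegral_const, smul_eq_mul, measureReal_def, Real.volume_Ico,
    ENNReal.toReal_ofReal hp.le, mul_inv_cancel₀ hp.ne']

/-- A double sum over the vertices is the integral of a step function. -/
theorem exists_stepFunction (h : IsUnrolling θ Θ ι) (c : Fin m → Fin m → ℝ) :
    ∃ S : ℝ × ℝ → ℝ, Measurable S ∧ ∫ x in unitSquare, S x = ∑ i, ∑ j, c i j ∧
      ∀ (a b : ℤ) (x y : ℝ), x ∈ Ico (Θ a) (Θ (a + 1)) → y ∈ Ico (Θ b) (Θ (b + 1)) →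
        S (x, y) = c (ι a) (ι b) / ((Θ (a + 1) - Θ a) * (Θ (b + 1) - Θ b)) := by
  -- Each product of two cell densities has integral 1 over the square, and at any given point only
  -- one of them is nonzero.
  refine ⟨fun x => ∑ i, ∑ j, c i j * (cellDensity Θ ι i x.1 * cellDensity Θ ι j x.2), ?_, ?_, ?_⟩
  · exact Finset.measurable_fun_sum _ fun i _ => Finset.measurable_fun_sum _ fun j _ =>
      measurable_const.mul (((measurable_cellDensity Θ ι i).comp measurable_fst).mul
        ((measurable_cellDensity Θ ι j).comp measurable_snd))
  · have hres : (volume : Measure (ℝ × ℝ)).restrict unitSquare =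
        (volume.restrict (Icc (0 : ℝ) 1)).prod (volume.restrict (Icc (0 : ℝ) 1)) := by
      rw [unitSquare, Measure.prod_restrict, ← Measure.volume_eq_prod]
    have hint : ∀ i, Integrable (cellDensity Θ ι i) (volume.restrict (Icc (0 : ℝ) 1)) := fun i =>
      (integrable_const _).indicator (measurableSet_cells Θ ι i)
    have hint2 : ∀ i j, Integrable (fun x : ℝ × ℝ =>
        c i j * (cellDensity Θ ι i x.1 * cellDensity Θ ι j x.2))
        ((volume.restrict (Icc (0 : ℝ) 1)).prod (volume.restrict (Icc (0 : ℝ) 1))) := fun i j =>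
      ((hint i).mul_prod (hint j)).const_mul _
    rw [hres, integral_finsetSum _ fun i _ => integrable_finsetSum _ fun j _ => hint2 i j]
    refine Finset.sum_congr rfl fun i _ => ?_
    rw [integral_finsetSum _ fun j _ => hint2 i j]
    refine Finset.sum_congr rfl fun j _ => ?_
    rw [integral_const_mul, integral_prod_mul, h.integral_cellDensity, h.integral_cellDensity]
    ring
  · intro a b x y ha hb
    simp only [h.cellDensity_apply ha, h.cellDensity_apply hb]
    rw [Finset.sum_eq_single (ι a), Finset.sum_eq_single (ι b)]
    · simp only [if_true]
      rw [div_eq_mul_inv, mul_inv]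
    · intro j _ hj
      rw [if_neg hj.symm, mul_zero, mul_zero]
    · simp
    · intro i _ hi
      simp [hi.symm]
    · simp

end IsUnrolling

end

section

/-! ### Convergence of the components of the discrete energy -/

open Set MeasureTheory Filter Topology

/-- An unrolled subdivision whose inscribed polygon is equilateral with edge length `ℓ`. -/
structure IsEquilateralUnrolling {n m : ℕ} (F : ℝ → Space n) (c L : ℝ) (θ : Fin m → ℝ)
    (Θ : ℤ → ℝ) (ι : ℤ → Fin m) (ℓ : ℝ) : Prop extends IsUnrolling θ Θ ι where
  ℓ_pos : 0 < ℓ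
  edge : ∀ k, ‖F (Θ (k + 1)) - F (Θ k)‖ = ℓ
  gap_le : ∀ k, c * (Θ (k + 1) - Θ k) ≤ ℓ
  length_le : m * ℓ ≤ L

namespace IsRegularCurve

variable {n : ℕ} {F V : ℝ → Space n} {c L M : ℝ}

lemma periodic_int (h : IsRegularCurve F V c L M) (t : ℝ) (z : ℤ) : F (t + z) = F t := by
  have := h.periodic.int_mul z t
  rwa [mul_one] at this

lemma sub_eq_of_eq (h : IsRegularCurve F V c L M) {x y : ℝ} (hxy : |x - y| ≤ 1)
    (he : F x = F y) : x - y = 0 ∨ x - y = 1 ∨ x - y = -1 := by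
  have inj : ∀ {s t : ℝ}, |s - t| ≤ 3 / 4 → F s = F t → s - t = 0 := by
    intro s t hst hF
    have := h.lower s t hst
    rw [hF, sub_self, norm_zero] at this
    exact abs_nonpos_iff.1 (nonpos_of_mul_nonpos_right this h.c_pos)
  rw [abs_le] at hxy
  by_cases h1 : |x - y| ≤ 3 / 4
  · exact Or.inl (inj h1 he)
  · right
    rw [not_le, lt_abs] at h1
    rcases h1 with h1 | h1
    · left
      have := inj (s := x) (t := y + 1) (by rw [abs_le]; constructor <;> linarith)
        (by rw [h.periodic, he])
      linarith
    · right
      have := inj (s := x + 1) (t := y) (by rw [abs_le]; constructor <;> linarith)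
        (by rw [h.periodic, he])
      linarith

/-- On the square F x = F y forces x − y ∈ {0, 1, −1}, and these three lines are null sets. -/
lemma ae_ne (h : IsRegularCurve F V c L M) :
    ∀ᵐ x : ℝ × ℝ ∂volume.restrict unitSquare, F x.1 ≠ F x.2 := by
  have line : ∀ k : ℝ, ∀ᵐ x : ℝ × ℝ, x.1 - x.2 ≠ k := by
    intro k
    rw [ae_iff, Measure.volume_eq_prod]
    simp only [not_not]
    have hs : MeasurableSet {a : ℝ × ℝ | a.1 - a.2 = k} :=
      measurableSet_eq_fun (measurable_fst.sub measurable_snd) measurable_const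
    rw [Measure.measure_prod_null hs]
    refine ae_of_all _ fun x => ?_
    have : Prod.mk x ⁻¹' {a : ℝ × ℝ | a.1 - a.2 = k} = {x - k} := by
      ext y
      simp only [mem_preimage, mem_ofPred_eq, mem_singleton_iff]
      constructor <;> intro hy <;> linarith
    change volume (Prod.mk x ⁻¹' {a : ℝ × ℝ | a.1 - a.2 = k}) = 0
    rw [this, Real.volume_singleton]
  have hmeas : MeasurableSet unitSquare := measurableSet_Icc.prod measurableSet_Icc
  rw [ae_restrict_iff' hmeas]
  filter_upwards [line 0, line 1, line (-1)] with x h0 h1 h2 hx he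
  have hd : |x.1 - x.2| ≤ 1 := by
    rw [abs_le]
    constructor <;> linarith [hx.1.1, hx.1.2, hx.2.1, hx.2.2]
  rcases h.sub_eq_of_eq hd he with h' | h' | h'
  · exact h0 h'
  · exact h1 h'
  · exact h2 h'

lemma exists_equilateralUnrolling (h : IsRegularCurve F V c L M) {m : ℕ} {θ : Fin m → ℝ}
    {f : UnitAddCircle → Space n} (hf : F = lift f) (hθ : IsSubdivision θ)
    (heq : IsEquilateral (inscribedPolygon f θ)) (hm2 : 2 ≤ m) (hm : L / c < m - 1) :
    ∃ Θ ι ℓ, IsEquilateralUnrolling F c L θ Θ ι ℓ := by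
  obtain ⟨Θ, ι, hΘ⟩ := hθ.exists_isUnrolling (by omega)
  obtain ⟨ℓ, hℓdef⟩ : ∃ ℓ, ℓ = polygonLength (inscribedPolygon f θ) / m := ⟨_, rfl⟩
  have hp : ∀ k, inscribedPolygon f θ (ι k) = F (Θ k) := fun k => by
    rw [hf, lift, inscribedPolygon, hΘ.coe_eq]
  have edge : ∀ k, ‖F (Θ (k + 1)) - F (Θ k)‖ = ℓ := fun k => by
    rw [hℓdef, ← heq (ι k), hΘ.next_index, hp, hp]
  have hℓ0 : 0 ≤ ℓ := edge 0 ▸ norm_nonneg _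
  have up : ∀ k, ℓ ≤ L * (Θ (k + 1) - Θ k) := fun k => by
    have := h.upper (Θ (k + 1)) (Θ k)
    rwa [edge, abs_of_pos (hΘ.gap_pos k)] at this
  have ups : ∀ (N : ℕ) (k : ℤ), N * ℓ ≤ L * (Θ (k + N) - Θ k) := by
    intro N k
    induction N with
    | zero => simp
    | succ N ih =>
      have := up (k + N)
      push_cast
      rw [← add_assoc]
      linarith
  have hper : ∀ k, Θ (k + m) = Θ k + 1 := fun k => by simpa using hΘ.add_period k 1
  have hpos : 0 < ℓ := by
    refine hℓ0.lt_of_ne' fun hz => ?_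
    -- If ℓ = 0, the lower Lipschitz bound excludes gaps of at most 3/4; but two consecutive gaps
    -- fit into one period.
    have big : ∀ k, 3 / 4 < Θ (k + 1) - Θ k := by
      intro k
      by_contra hle
      push Not at hle
      have h1 := h.gap_le (sub_pos.1 (hΘ.gap_pos k)) hle
      rw [edge, hz] at h1
      exact absurd (hΘ.gap_pos k) (not_lt.2 (nonpos_of_mul_nonpos_right h1.1 h.c_pos))
    have h1 := big 0
    have h2 := big (0 + 1)
    have h3 := hΘ.strictMono.monotone (show (0 : ℤ) + 1 + 1 ≤ 0 + m by omega)
    rw [hper] at h3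
    norm_num at h1 h2 h3
    linarith
  refine ⟨Θ, ι, ℓ, hΘ, hpos, edge, fun k => ?_, ?_⟩
  · by_cases hle : Θ (k + 1) - Θ k ≤ 3 / 4
    · have := h.gap_le (sub_pos.1 (hΘ.gap_pos k)) hle
      rw [edge] at this
      exact this.1
    · exfalso
      push Not at hle
      -- A gap above 3/4 escapes the Lipschitz bound directly. Then the other m − 1 edges lie on the
      -- complementary arc, so (m − 1)ℓ ≤ L(1 − gap), while the chord closing that arc gives c(1 −
      -- gap) ≤ ℓ. Together (m − 1)c ≤ L, against the choice of m.
      have h1 := ups (m - 1) (k + 1)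
      have e1 : k + 1 + ((m - 1 : ℕ) : ℤ) = k + m := by
        rw [Nat.cast_sub (by omega)]; push_cast; ring
      have e2 : ((m - 1 : ℕ) : ℝ) = m - 1 := by rw [Nat.cast_sub (by omega)]; simp
      rw [e1, e2, hper] at h1
      have h2 := h.lower (Θ k + 1) (Θ (k + 1)) (by
        have := hΘ.strictMono.monotone (show k + 1 ≤ k + m by omega)
        rw [hper] at this
        rw [abs_le]; constructor <;> linarith)
      rw [h.periodic, norm_sub_rev, edge] at h2
      have h3 : c * (Θ k + 1 - Θ (k + 1)) ≤ ℓ :=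
        (mul_le_mul_of_nonneg_left (le_abs_self _) h.c_pos.le).trans h2
      have h4 : (m - 1) * ℓ * c ≤ L * ℓ := by
        calc (m - 1) * ℓ * c ≤ L * (Θ k + 1 - Θ (k + 1)) * c :=
              mul_le_mul_of_nonneg_right h1 h.c_pos.le
          _ = L * (c * (Θ k + 1 - Θ (k + 1))) := by ring
          _ ≤ L * ℓ := mul_le_mul_of_nonneg_left h3 h.L_pos.le
      rw [div_lt_iff₀ h.c_pos] at hm
      have h5 := mul_lt_mul_of_pos_right hm hpos
      linarith
  · have := ups m 0
    rw [hper] at this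
    linarith

/-- The summand belonging to two different cells is of the order of the squared edge length. -/
lemma abs_term_le (h : IsRegularCurve F V c L M) {m : ℕ} {θ : Fin m → ℝ} {Θ : ℤ → ℝ}
    {ι : ℤ → Fin m} {ℓ C : ℝ} (hΘ : IsEquilateralUnrolling F c L θ Θ ι ℓ) (hfine : ℓ / c ≤ 1 / 16)
    {T : Space n → Space n → Space n → Space n → Space n → Space n → ℝ}
    (hswap : ∀ P₀ P₁ P₂ Q₀ Q₁ Q₂, T Q₀ Q₁ Q₂ P₀ P₁ P₂ = T P₀ P₁ P₂ Q₀ Q₁ Q₂)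
    (hT : ∀ {ℓ x₀ x₁ x₂ y₀ y₁ y₂ : ℝ}, 0 < ℓ → IsOrderedPair F ℓ x₀ x₁ x₂ y₀ y₁ y₂ →
      |T (F x₀) (F x₁) (F x₂) (F y₀) (F y₁) (F y₂)| ≤ C * ℓ ^ 2) {a b : ℤ} (hab : ι a ≠ ι b) :
    |T (F (Θ a)) (F (Θ (a + 1))) (F (Θ (a + 1 + 1))) (F (Θ b)) (F (Θ (b + 1)))
      (F (Θ (b + 1 + 1)))| ≤ C * ℓ ^ 2 := by
  have gap : ∀ k, Θ (k + 1) - Θ k ≤ 1 / 16 := fun k => by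
    refine le_trans ?_ hfine
    rw [le_div_iff₀ h.c_pos, mul_comm]
    exact hΘ.gap_le k
  have pair : ∀ {a b : ℤ}, a < b → Θ b - Θ a ≤ 1 / 2 → IsOrderedPair F ℓ (Θ a) (Θ (a + 1))
      (Θ (a + 1 + 1)) (Θ b) (Θ (b + 1)) (Θ (b + 1 + 1)) := fun {a b} hlt hle =>
    { x₀₁ := sub_pos.1 (hΘ.gap_pos a)
      x₁₂ := sub_pos.1 (hΘ.gap_pos _)
      y₀₁ := sub_pos.1 (hΘ.gap_pos b)
      y₁₂ := sub_pos.1 (hΘ.gap_pos _)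
      x₁y₀ := hΘ.strictMono.monotone (by omega)
      x₂y₁ := hΘ.strictMono.monotone (by omega)
      near := hle
      gap_x₀ := gap a
      gap_x₁ := gap _
      gap_y₀ := gap b
      gap_y₁ := gap _
      edge_x₀ := hΘ.edge a
      edge_x₁ := hΘ.edge _
      edge_y₀ := hΘ.edge b
      edge_y₁ := hΘ.edge _ }
  -- Shifting the second vertex by whole periods brings it within half a period of the first, before
  -- or behind it; the symmetry of T handles the order.
  obtain ⟨z, hz⟩ : ∃ z : ℤ, |Θ (b + m * z) - Θ a| ≤ 1 / 2 := by
    refine ⟨-round (Θ b - Θ a), ?_⟩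
    rw [hΘ.add_period]
    have := abs_sub_round (Θ b - Θ a)
    push_cast
    rwa [show Θ b + -(round (Θ b - Θ a) : ℝ) - Θ a = Θ b - Θ a - round (Θ b - Θ a) by ring]
  have shift : ∀ k, F (Θ (k + m * z)) = F (Θ k) := fun k => by
    rw [hΘ.add_period, h.periodic_int]
  rw [← shift b, ← shift (b + 1), ← shift (b + 1 + 1),
    show b + 1 + 1 + m * z = b + m * z + 1 + 1 by ring, show b + 1 + m * z = b + m * z + 1 by ring]
  have hne : a ≠ b + m * z := fun he => hab (by rw [he, hΘ.index_add])
  rw [abs_le] at hz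
  rcases lt_or_gt_of_ne hne with hlt | hlt
  · exact hT hΘ.ℓ_pos (pair hlt hz.2)
  · rw [hswap]
    exact hT hΘ.ℓ_pos (pair hlt (by linarith [hz.1]))

/-- The sum over all pairs of different vertices converges to the integral of the density, if the
summands are dominated up to the diagonal and converge off the diagonal. -/
theorem tendsto_sum_term (h : IsRegularCurve F V c L M) {f : UnitAddCircle → Space n}
    (hf : F = lift f) {T : Space n → Space n → Space n → Space n → Space n → Space n → ℝ}
    {d : ℝ × ℝ → ℝ} {C : ℝ} (hC : 0 ≤ C)
    (hswap : ∀ P₀ P₁ P₂ Q₀ Q₁ Q₂, T Q₀ Q₁ Q₂ P₀ P₁ P₂ = T P₀ P₁ P₂ Q₀ Q₁ Q₂)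
    (hT : ∀ {ℓ x₀ x₁ x₂ y₀ y₁ y₂ : ℝ}, 0 < ℓ → IsOrderedPair F ℓ x₀ x₁ x₂ y₀ y₁ y₂ →
      |T (F x₀) (F x₁) (F x₂) (F y₀) (F y₁) (F y₂)| ≤ C * ℓ ^ 2)
    (hlim : ∀ {X₀ X₁ X₂ Y₀ Y₁ Y₂ ℓ : ℕ → ℝ} {x y : ℝ}, (∀ᶠ i in atTop, 0 < ℓ i) →
      (∀ᶠ i in atTop, X₀ i < X₁ i) → (∀ᶠ i in atTop, X₁ i < X₂ i) →
      (∀ᶠ i in atTop, Y₀ i < Y₁ i) → (∀ᶠ i in atTop, Y₁ i < Y₂ i) →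
      Tendsto X₀ atTop (𝓝 x) → Tendsto X₁ atTop (𝓝 x) → Tendsto X₂ atTop (𝓝 x) →
      Tendsto Y₀ atTop (𝓝 y) → Tendsto Y₁ atTop (𝓝 y) → Tendsto Y₂ atTop (𝓝 y) →
      (∀ᶠ i in atTop, ‖F (X₁ i) - F (X₀ i)‖ = ℓ i) → (∀ᶠ i in atTop, ‖F (X₂ i) - F (X₁ i)‖ = ℓ i) →
      (∀ᶠ i in atTop, ‖F (Y₁ i) - F (Y₀ i)‖ = ℓ i) → (∀ᶠ i in atTop, ‖F (Y₂ i) - F (Y₁ i)‖ = ℓ i) →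
      F x ≠ F y →
      Tendsto (fun i => T (F (X₀ i)) (F (X₁ i)) (F (X₂ i)) (F (Y₀ i)) (F (Y₁ i)) (F (Y₂ i)) /
        ((X₁ i - X₀ i) * (Y₁ i - Y₀ i))) atTop (𝓝 (d (x, y))))
    {θ : (m : ℕ) → Fin m → ℝ}
    (hθ : ∀ᶠ m in atTop, IsSubdivision (θ m) ∧ IsEquilateral (inscribedPolygon f (θ m))) :
    Tendsto (fun m => ∑ i : Fin m, ∑ j : Fin m, if i ≠ j then
      T (inscribedPolygon f (θ m) i) (inscribedPolygon f (θ m) (next i))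
        (inscribedPolygon f (θ m) (next (next i))) (inscribedPolygon f (θ m) j)
        (inscribedPolygon f (θ m) (next j)) (inscribedPolygon f (θ m) (next (next j))) else 0)
      atTop (𝓝 (∫ x in unitSquare, d x)) := by
  have hc := h.c_pos
  have hL := h.L_pos
  let t : (m : ℕ) → Fin m → Fin m → ℝ := fun m i j => if i ≠ j then
      T (inscribedPolygon f (θ m) i) (inscribedPolygon f (θ m) (next i))
        (inscribedPolygon f (θ m) (next (next i))) (inscribedPolygon f (θ m) j)
        (inscribedPolygon f (θ m) (next j)) (inscribedPolygon f (θ m) (next (next j))) else 0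
  have data : ∀ᶠ m : ℕ in atTop, ∃ Θ ι ℓ, IsEquilateralUnrolling F c L (θ m) Θ ι ℓ := by
    have hlarge : ∀ᶠ m : ℕ in atTop, L / c + 1 < m :=
      tendsto_natCast_atTop_atTop.eventually_gt_atTop _
    filter_upwards [hθ, eventually_ge_atTop 2, hlarge] with m hm hm2 hmL
    exact h.exists_equilateralUnrolling hf hm.1 hm.2 hm2 (by linarith)
  -- The shift to m + 1 makes the index type nonempty, so that total choice functions exist with a
  -- default index 0.
  have data' : ∀ m : ℕ, ∃ (Θ : ℤ → ℝ) (ι : ℤ → Fin (m + 1)) (ℓ : ℝ),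
      (∃ Θ ι ℓ, IsEquilateralUnrolling F c L (θ (m + 1)) Θ ι ℓ) →
        IsEquilateralUnrolling F c L (θ (m + 1)) Θ ι ℓ := by
    intro m
    by_cases hex : ∃ Θ ι ℓ, IsEquilateralUnrolling F c L (θ (m + 1)) Θ ι ℓ
    · obtain ⟨Θ, ι, ℓ, hΘ⟩ := hex
      exact ⟨Θ, ι, ℓ, fun _ => hΘ⟩
    · exact ⟨fun _ => 0, fun _ => 0, 0, fun hex' => absurd hex' hex⟩
  choose Θ ι ℓ hΘ using data'
  have good : ∀ᶠ m : ℕ in atTop, IsEquilateralUnrolling F c L (θ (m + 1)) (Θ m) (ι m) (ℓ m) := by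
    filter_upwards [(tendsto_add_atTop_nat 1).eventually data] with m hm
    exact hΘ m hm
  have hℓ0 : Tendsto ℓ atTop (𝓝 0) := by
    have h1 : Tendsto (fun m : ℕ => L * (1 / ((m : ℝ) + 1))) atTop (𝓝 0) := by
      simpa using tendsto_one_div_add_atTop_nhds_zero_nat.const_mul L
    refine squeeze_zero' (good.mono fun m hm => hm.ℓ_pos.le) (good.mono fun m hm => ?_) h1
    have := hm.length_le
    push_cast at this
    rw [mul_one_div, le_div_iff₀ (by positivity)]
    linarith
  have hgap0 : Tendsto (fun m => ℓ m / c) atTop (𝓝 0) := by simpa using hℓ0.div_const c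
  have hfine : ∀ᶠ m in atTop, ℓ m / c ≤ 1 / 16 :=
    hgap0.eventually_le_const (by norm_num)
  have step : ∀ m, ∃ S : ℝ × ℝ → ℝ,
      IsEquilateralUnrolling F c L (θ (m + 1)) (Θ m) (ι m) (ℓ m) →
      Measurable S ∧ ∫ x in unitSquare, S x = ∑ i, ∑ j, t (m + 1) i j ∧
      ∀ (a b : ℤ) (x y : ℝ), x ∈ Ico (Θ m a) (Θ m (a + 1)) → y ∈ Ico (Θ m b) (Θ m (b + 1)) →
        S (x, y) = t (m + 1) (ι m a) (ι m b) /
          ((Θ m (a + 1) - Θ m a) * (Θ m (b + 1) - Θ m b)) := by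
    intro m
    by_cases hm : IsEquilateralUnrolling F c L (θ (m + 1)) (Θ m) (ι m) (ℓ m)
    · obtain ⟨S, hS⟩ := hm.exists_stepFunction (t (m + 1))
      exact ⟨S, fun _ => hS⟩
    · exact ⟨0, fun hm' => absurd hm' hm⟩
  choose S hS using step
  have tval : ∀ m, IsEquilateralUnrolling F c L (θ (m + 1)) (Θ m) (ι m) (ℓ m) → ∀ a b,
      ι m a ≠ ι m b → t (m + 1) (ι m a) (ι m b) =
      T (F (Θ m a)) (F (Θ m (a + 1))) (F (Θ m (a + 1 + 1))) (F (Θ m b)) (F (Θ m (b + 1)))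
        (F (Θ m (b + 1 + 1))) := by
    intro m hm a b hab
    have hp : ∀ k, inscribedPolygon f (θ (m + 1)) (ι m k) = F (Θ m k) := fun k => by
      rw [hf, lift, inscribedPolygon, hm.coe_eq]
    simp only [t, if_pos hab, hm.next_index, hp]
  refine (tendsto_add_atTop_iff_nat 1).1 ?_
  change Tendsto (fun m => ∑ i, ∑ j, t (m + 1) i j) atTop _
  have hconv : Tendsto (fun m => ∫ x in unitSquare, S m x) atTop (𝓝 (∫ x in unitSquare, d x)) := by
    refine tendsto_integral_filter_of_dominated_convergence (fun _ => C * L ^ 2)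
      (good.mono fun m hm => (hS m hm).1.aestronglyMeasurable) ?_ ?_ ?_
    · filter_upwards [good, hfine] with m hm hmf
      refine ae_of_all _ fun ⟨x, y⟩ => ?_
      obtain ⟨a, ha⟩ := hm.exists_mem_cell x
      obtain ⟨b, hb⟩ := hm.exists_mem_cell y
      have hga := hm.gap_pos a
      have hgb := hm.gap_pos b
      rw [(hS m hm).2.2 a b x y ha hb, Real.norm_eq_abs, abs_div, abs_of_pos (mul_pos hga hgb)]
      -- Cells with the same vertex index carry the value 0. For all others Cℓ² is at most CL² times
      -- the product of the gaps, since ℓ ≤ L · gap.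
      by_cases hab : ι m a = ι m b
      · simp only [t, hab]
        simp only [ne_eq, not_true_eq_false, if_false, abs_zero, zero_div]
        positivity
      · rw [tval m hm a b hab, div_le_iff₀ (mul_pos hga hgb)]
        have up : ∀ k, ℓ m ≤ L * (Θ m (k + 1) - Θ m k) := fun k => by
          have := h.upper (Θ m (k + 1)) (Θ m k)
          rwa [hm.edge, abs_of_pos (hm.gap_pos k)] at this
        calc _ ≤ C * ℓ m ^ 2 := h.abs_term_le hm hmf hswap hT hab
          _ ≤ C * ((L * (Θ m (a + 1) - Θ m a)) * (L * (Θ m (b + 1) - Θ m b))) := by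
              refine mul_le_mul_of_nonneg_left ?_ hC
              rw [pow_two]
              exact mul_le_mul (up a) (up b) hm.ℓ_pos.le (by positivity)
          _ = _ := by ring
    · have : IsFiniteMeasure ((volume : Measure (ℝ × ℝ)).restrict unitSquare) :=
        ⟨by
          rw [Measure.restrict_apply_univ]
          exact (isCompact_Icc.prod isCompact_Icc).measure_lt_top⟩
      exact integrable_const _
    · filter_upwards [h.ae_ne] with ⟨x, y⟩ hxy
      have cell : ∀ (x : ℝ) (m : ℕ), ∃ a : ℤ,
          IsEquilateralUnrolling F c L (θ (m + 1)) (Θ m) (ι m) (ℓ m) →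
          x ∈ Ico (Θ m a) (Θ m (a + 1)) := by
        intro x m
        by_cases hm : IsEquilateralUnrolling F c L (θ (m + 1)) (Θ m) (ι m) (ℓ m)
        · obtain ⟨a, ha⟩ := hm.exists_mem_cell x
          exact ⟨a, fun _ => ha⟩
        · exact ⟨0, fun hm' => absurd hm' hm⟩
      have gap : ∀ m, IsEquilateralUnrolling F c L (θ (m + 1)) (Θ m) (ι m) (ℓ m) → ∀ k,
          Θ m (k + 1) - Θ m k ≤ ℓ m / c := fun m hm k => by
        rw [le_div_iff₀ hc, mul_comm]
        exact hm.gap_le k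
      have nodes : ∀ (x : ℝ) (a : ℕ → ℤ),
          (∀ m, IsEquilateralUnrolling F c L (θ (m + 1)) (Θ m) (ι m) (ℓ m) →
            x ∈ Ico (Θ m (a m)) (Θ m (a m + 1))) →
          Tendsto (fun m => Θ m (a m)) atTop (𝓝 x) ∧
          Tendsto (fun m => Θ m (a m + 1)) atTop (𝓝 x) ∧
          Tendsto (fun m => Θ m (a m + 1 + 1)) atTop (𝓝 x) := by
        intro x a ha
        have lo : Tendsto (fun m => x - 2 * (ℓ m / c)) atTop (𝓝 x) := by
          simpa using (hgap0.const_mul 2).const_sub x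
        have hi : Tendsto (fun m => x + 2 * (ℓ m / c)) atTop (𝓝 x) := by
          simpa using (hgap0.const_mul 2).const_add x
        have bounds : ∀ᶠ m in atTop, 0 < ℓ m / c ∧ x ∈ Ico (Θ m (a m)) (Θ m (a m + 1)) ∧
            Θ m (a m + 1) - Θ m (a m) ≤ ℓ m / c ∧
            Θ m (a m + 1 + 1) - Θ m (a m + 1) ≤ ℓ m / c ∧
            0 < Θ m (a m + 1 + 1) - Θ m (a m + 1) := good.mono fun m hm =>
          ⟨div_pos hm.ℓ_pos hc, ha m hm, gap m hm _, gap m hm _, hm.gap_pos _⟩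
        refine ⟨?_, ?_, ?_⟩ <;>
        refine tendsto_of_tendsto_of_tendsto_of_le_of_le' lo hi ?_ ?_ <;>
        · filter_upwards [bounds] with m hm
          obtain ⟨h1, ⟨h2, h2'⟩, h3, h4, h5⟩ := hm
          linarith
      choose a ha using cell x
      choose b hb using cell y
      obtain ⟨hx₀, hx₁, hx₂⟩ := nodes x a ha
      obtain ⟨hy₀, hy₁, hy₂⟩ := nodes y b hb
      have key := hlim (good.mono fun m hm => hm.ℓ_pos)
        (good.mono fun m hm => sub_pos.1 (hm.gap_pos (a m)))
        (good.mono fun m hm => sub_pos.1 (hm.gap_pos (a m + 1)))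
        (good.mono fun m hm => sub_pos.1 (hm.gap_pos (b m)))
        (good.mono fun m hm => sub_pos.1 (hm.gap_pos (b m + 1))) hx₀ hx₁ hx₂ hy₀ hy₁ hy₂
        (good.mono fun m hm => hm.edge (a m)) (good.mono fun m hm => hm.edge (a m + 1))
        (good.mono fun m hm => hm.edge (b m)) (good.mono fun m hm => hm.edge (b m + 1)) hxy
      refine key.congr' ?_
      have hne := (((h.continuous.tendsto x).comp hx₀).sub
        ((h.continuous.tendsto y).comp hy₀)).eventually_ne (sub_ne_zero.2 hxy)
      filter_upwards [good, hne] with m hm hmne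
      -- Equal indices would mean equal vertices, but the vertices next to x and y tend to the
      -- distinct points F x and F y.
      have hab : ι m (a m) ≠ ι m (b m) := by
        intro he
        obtain ⟨z, hz⟩ := hm.exists_of_index_eq _ _ he
        refine hmne (sub_eq_zero.2 ?_)
        simp only [Function.comp_apply]
        rw [hz, hm.add_period, h.periodic_int]
      rw [(hS m hm).2.2 _ _ x y (ha m hm) (hb m hm), tval m hm _ _ hab]
  refine hconv.congr' ?_
  filter_upwards [good] with m hm
  exact (hS m hm).2.1

end IsRegularCurve

end

section

/-! ### The densities of a regular curve -/

open Set MeasureTheory Filter Topology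

lemma norm_coe_le_abs (u : ℝ) : ‖(u : UnitAddCircle)‖ ≤ |u| := by
  rw [UnitAddCircle.norm_eq]
  simpa using round_le u 0

/-- The worst case is |u| = 3/4, at distance 1/4 from the nearest integer. A range beyond 1/2 leaves
room for the neighbours of vertices half a period apart. -/
lemma third_abs_le_norm_coe {u : ℝ} (hu : |u| ≤ 3 / 4) : |u| / 3 ≤ ‖(u : UnitAddCircle)‖ := by
  rw [UnitAddCircle.norm_eq]
  by_cases hk : round u = 0
  · rw [hk, Int.cast_zero, sub_zero]
    linarith [abs_nonneg u]
  · have h1 : (1 : ℝ) ≤ |(round u : ℝ)| := by exact_mod_cast Int.one_le_abs hk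
    have h2 := abs_sub_abs_le_abs_sub (round u : ℝ) u
    rw [abs_sub_comm] at h2
    linarith

theorem exists_isRegularCurve {n : ℕ} {f : UnitAddCircle → Space n} (hW : MemW2Infty f)
    (hL : IsBiLipschitz f) : ∃ V c L M, IsRegularCurve (lift f) V c L M := by
  obtain ⟨-, g, k, -, hk, hfg, hgk⟩ := hW
  obtain ⟨L₁, L₂, hL₁, hL₂, hL⟩ := hL
  have hdist : ∀ s t : ℝ, dist (s : UnitAddCircle) t = ‖((s - t : ℝ) : UnitAddCircle)‖ := fun s t => by
    rw [dist_eq_norm, AddCircle.coe_sub]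
  have upper : ∀ s t, ‖lift f s - lift f t‖ ≤ L₂ * |s - t| := fun s t => by
    refine (hL s t).2.trans (mul_le_mul_of_nonneg_left ?_ hL₂.le)
    rw [hdist]
    exact norm_coe_le_abs _
  have hcont : Continuous (lift f) :=
    (LipschitzWith.of_dist_le_mul (K := ⟨L₂, hL₂.le⟩) fun s t => by
      rw [dist_eq_norm, Real.dist_eq]
      exact upper s t).continuous
  obtain ⟨V, M, hM, hV, hVlip⟩ := exists_hasDerivAt_lipschitz hcont hk hfg hgk
  refine ⟨V, L₁ / 3, L₂, M, by positivity, hL₂, hM, fun t => ?_, hV, hVlip, fun s t hst => ?_, upper⟩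
  · rw [lift, lift, AddCircle.coe_add, AddCircle.coe_period, add_zero]
  · refine le_trans ?_ (hL s t).1
    rw [hdist]
    calc L₁ / 3 * |s - t| = L₁ * (|s - t| / 3) := by ring
      _ ≤ _ := mul_le_mul_of_nonneg_left (third_abs_le_norm_coe hst) hL₁.le

lemma two_sub_norm_sub_sq {n : ℕ} {v w : Space n} (hv : v ≠ 0) (hw : w ≠ 0) :
    ‖dir v - dir w‖ ^ 2 = 2 - 2 * inner ℝ (dir v) (dir w) := by
  rw [norm_sub_sq_real, norm_dir hv, norm_dir hw]
  ring

/-- The left side is the inner product of the components of a and b orthogonal to u, and the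
orthogonal component is no longer than the difference from any point of the line ℝu, in particular
from u. -/
lemma abs_inner_sub_inner_mul_inner_le {n : ℕ} {a b u : Space n} (ha : ‖a‖ = 1) (hb : ‖b‖ = 1)
    (hu : ‖u‖ = 1) :
    |inner ℝ a b - inner ℝ u a * inner ℝ u b| ≤ ‖a - u‖ * ‖b - u‖ := by
  have proj : ∀ {w : Space n}, ‖w‖ = 1 → ‖w - inner ℝ u w • u‖ ≤ ‖w - u‖ := by
    intro w hw
    refine (sq_le_sq₀ (norm_nonneg _) (norm_nonneg _)).1 ?_
    rw [norm_sub_sq_real, norm_sub_sq_real, inner_smul_right, norm_smul, hw, hu,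
      real_inner_comm w u, Real.norm_eq_abs, mul_one, sq_abs]
    nlinarith [sq_nonneg (inner ℝ w u - 1)]
  have e : inner ℝ a b - inner ℝ u a * inner ℝ u b =
      inner ℝ (a - inner ℝ u a • u) (b - inner ℝ u b • u) := by
    rw [inner_sub_left, inner_sub_right, inner_sub_right, real_inner_smul_left,
      real_inner_smul_right, real_inner_smul_right, real_inner_smul_left,
      real_inner_self_eq_norm_sq, hu, real_inner_comm u a]
    ring
  rw [e]
  exact (abs_real_inner_le_norm _ _).trans
    (mul_le_mul (proj ha) (proj hb) (norm_nonneg _) (norm_nonneg _))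

namespace IsRegularCurve

variable {n : ℕ} {f : UnitAddCircle → Space n} {V : ℝ → Space n} {c L M : ℝ}

lemma speed_eq (h : IsRegularCurve (lift f) V c L M) (t : ℝ) : speed f t = ‖V t‖ := by
  rw [speed, (h.hasDerivAt t).deriv]

lemma tangent_eq (h : IsRegularCurve (lift f) V c L M) (t : ℝ) : tangent f t = dir (V t) := by
  rw [tangent, h.speed_eq, (h.hasDerivAt t).deriv, dir]

lemma continuous_speed (h : IsRegularCurve (lift f) V c L M) : Continuous (speed f) := by
  rw [funext h.speed_eq]
  exact h.continuous_deriv.norm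

lemma periodic_deriv (h : IsRegularCurve (lift f) V c L M) : Function.Periodic V 1 := by
  intro t
  have h1 : HasDerivAt (fun s => lift f (s + 1)) (V (t + 1)) t :=
    (h.hasDerivAt (t + 1)).comp_add_const t 1
  rw [h.periodic.funext] at h1
  exact h1.unique (h.hasDerivAt t)

lemma periodic_speed (h : IsRegularCurve (lift f) V c L M) : Function.Periodic (speed f) 1 :=
  fun t => by rw [h.speed_eq, h.speed_eq, h.periodic_deriv]

lemma norm_deriv_le (h : IsRegularCurve (lift f) V c L M) (t : ℝ) : ‖V t‖ ≤ L := by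
  have := (h.hasDerivAt t).le_of_lip' h.L_pos.le
    (Eventually.of_forall fun s => by simpa [Real.norm_eq_abs] using h.upper s t)
  simpa using this

lemma norm_dir_deriv_sub_le (h : IsRegularCurve (lift f) V c L M) (s t : ℝ) :
    ‖dir (V s) - dir (V t)‖ ≤ 2 * M / c * |s - t| := by
  refine (norm_dir_sub_dir_le _ (h.deriv_ne_zero t)).trans ?_
  calc 2 * ‖V s - V t‖ / ‖V t‖ ≤ 2 * (M * |s - t|) / c :=
        div_le_div₀ (by have := h.M_nonneg; positivity)
          (mul_le_mul_of_nonneg_left (h.lipschitz_deriv s t) (by norm_num)) h.c_pos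
          (h.le_norm_deriv t)
    _ = 2 * M / c * |s - t| := by ring

lemma norm_dir_chord_sub_dir_deriv_le (h : IsRegularCurve (lift f) V c L M) {s t r : ℝ}
    (hst : s < t) (hr : r ∈ Icc s t) :
    ‖dir (lift f t - lift f s) - dir (V r)‖ ≤ 2 * M / c * (t - s) := by
  have h1 := h.norm_slope_sub_le (a := s) (H := t - s) hst le_rfl (by linarith) (r := r)
    (by rwa [add_sub_cancel])
  rw [← dir_smul_of_pos (inv_pos.2 (sub_pos.2 hst)) (lift f t - lift f s)]
  refine (norm_dir_sub_dir_le _ (h.deriv_ne_zero r)).trans ?_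
  have hMH : 0 ≤ M * (t - s) := (norm_nonneg _).trans h1
  calc _ ≤ 2 * (M * (t - s)) / c :=
        div_le_div₀ (by positivity) (mul_le_mul_of_nonneg_left h1 (by norm_num)) h.c_pos
          (h.le_norm_deriv r)
    _ = 2 * M / c * (t - s) := by ring

lemma moebiusDensity₁_eq (h : IsRegularCurve (lift f) V c L M) (x y : ℝ) :
    moebiusDensity₁ f (x, y) =
      2 * (1 / ‖lift f y - lift f x‖ ^ 2 * (1 - inner ℝ (dir (V x)) (dir (V y))) *
        (‖V x‖ * ‖V y‖)) := by
  simp only [moebiusDensity₁, h.tangent_eq, h.speed_eq]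
  rw [two_sub_norm_sub_sq (h.deriv_ne_zero x) (h.deriv_ne_zero y), norm_sub_rev (lift f x)]
  ring

lemma inner_wedge (a b u : Space n) :
    inner ℝ (wedge a u) (wedge b u) = inner ℝ a b * ‖u‖ ^ 2 - inner ℝ u a * inner ℝ u b := by
  rw [wedge, wedge, exteriorPower.inner_ιMulti_ιMulti, Matrix.det_fin_two]
  simp only [Matrix.of_apply, Matrix.cons_val_zero, Matrix.cons_val_one]
  rw [real_inner_self_eq_norm_sq, real_inner_comm u a]
  ring

lemma moebiusDensity₂_eq (h : IsRegularCurve (lift f) V c L M) (x y : ℝ) :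
    moebiusDensity₂ f (x, y) =
      (2 * inner ℝ (dir (V x)) (dir (V y)) / ‖lift f y - lift f x‖ ^ 2 -
        2 * inner ℝ (lift f y - lift f x) (dir (V x)) * inner ℝ (lift f y - lift f x) (dir (V y)) /
          ‖lift f y - lift f x‖ ^ 4) * (‖V x‖ * ‖V y‖) := by
  simp only [moebiusDensity₂, chordDirection, h.tangent_eq, h.speed_eq, inner_wedge]
  rw [← neg_sub (lift f y) (lift f x), norm_neg, smul_neg, norm_neg, inner_neg_left, inner_neg_left,
    real_inner_smul_left, real_inner_smul_left, norm_smul, norm_inv, norm_norm]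
  by_cases hv : ‖lift f y - lift f x‖ = 0
  · simp [hv]
  · field_simp

lemma moebiusDensity₂_eq_dir (h : IsRegularCurve (lift f) V c L M) (x y : ℝ) :
    moebiusDensity₂ f (x, y) = 2 / ‖lift f y - lift f x‖ ^ 2 *
      (inner ℝ (dir (V x)) (dir (V y)) - inner ℝ (dir (lift f y - lift f x)) (dir (V x)) *
        inner ℝ (dir (lift f y - lift f x)) (dir (V y))) * (‖V x‖ * ‖V y‖) := by
  rw [h.moebiusDensity₂_eq, dir, dir, dir, real_inner_smul_left (lift f y - lift f x),
    real_inner_smul_left (lift f y - lift f x)]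
  ring

/-- The sum of the two component densities and the mixed derivative of `log ‖Δf‖`. -/
lemma moebiusDensity_sub_eq (h : IsRegularCurve (lift f) V c L M) (x y : ℝ) :
    moebiusDensity f (x, y) - 1 / 2 * moebiusDensity₁ f (x, y) - moebiusDensity₂ f (x, y) =
      (-(inner ℝ (V x) (V y) * ‖lift f x - lift f y‖ ^ 2) + 2 * inner ℝ (V x) (lift f x - lift f y) *
        inner ℝ (lift f x - lift f y) (V y)) / (‖lift f x - lift f y‖ ^ 2) ^ 2 -
      ‖V x‖ * ‖V y‖ / intrinsicDist f x y ^ 2 := by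
  rw [h.moebiusDensity₁_eq, h.moebiusDensity₂_eq, moebiusDensity, h.speed_eq, h.speed_eq,
    norm_sub_rev (lift f y)]
  simp only
  rw [← neg_sub (lift f x) (lift f y), inner_neg_left, inner_neg_left]
  conv_rhs => rw [← norm_smul_dir (V x), ← norm_smul_dir (V y)]
  simp only [real_inner_smul_left, real_inner_smul_right, norm_smul, norm_norm,
    norm_dir (h.deriv_ne_zero x), norm_dir (h.deriv_ne_zero y),
    real_inner_comm (lift f x - lift f y) (dir (V x))]
  by_cases hv : ‖lift f x - lift f y‖ = 0
  · simp [hv]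
    ring
  · field_simp
    ring

/-! ### Arc length -/

lemma intervalIntegrable_speed (h : IsRegularCurve (lift f) V c L M) (s t : ℝ) :
    IntervalIntegrable (speed f) volume s t :=
  h.continuous_speed.intervalIntegrable s t

lemma integral_speed_bounds (h : IsRegularCurve (lift f) V c L M) {s t : ℝ} (hst : s ≤ t) :
    c * (t - s) ≤ ∫ r in s..t, speed f r ∧ ∫ r in s..t, speed f r ≤ L * (t - s) := by
  constructor
  · have := intervalIntegral.integral_mono_on hst (intervalIntegrable_const (c := c))
      (h.intervalIntegrable_speed s t) fun r _ => by
        rw [h.speed_eq]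
        exact h.le_norm_deriv r
    rwa [intervalIntegral.integral_const, smul_eq_mul, mul_comm] at this
  · have := intervalIntegral.integral_mono_on hst (h.intervalIntegrable_speed s t)
      (intervalIntegrable_const (c := L)) fun r _ => by
        rw [h.speed_eq]
        exact h.norm_deriv_le r
    rwa [intervalIntegral.integral_const, smul_eq_mul, mul_comm (t - s)] at this

lemma integral_speed_add (h : IsRegularCurve (lift f) V c L M) (s t : ℝ) :
    (∫ r in s..t, speed f r) + ∫ r in t..(s + 1), speed f r = curveLength f := by
  rw [intervalIntegral.integral_add_adjacent_intervals (h.intervalIntegrable_speed _ _)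
    (h.intervalIntegrable_speed _ _), curveLength]
  have := h.periodic_speed.intervalIntegral_add_eq s 0
  rwa [zero_add] at this

lemma intrinsicDist_comm (s t : ℝ) : intrinsicDist f s t = intrinsicDist f t s := by
  rw [intrinsicDist, intrinsicDist, intervalIntegral.integral_symm, abs_neg]

lemma intrinsicDist_of_le (h : IsRegularCurve (lift f) V c L M) {s t : ℝ} (hst : s ≤ t) :
    intrinsicDist f s t = min (∫ r in s..t, speed f r) (∫ r in t..(s + 1), speed f r) := by
  have h0 := (h.integral_speed_bounds hst).1
  have : 0 ≤ ∫ r in s..t, speed f r :=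
    (mul_nonneg h.c_pos.le (sub_nonneg.2 hst)).trans h0
  rw [intrinsicDist, abs_of_nonneg this, ← h.integral_speed_add s t, add_sub_cancel_left]

/-- Adding a period to the parameter exchanges the two arcs. The restriction on s and t keeps the
parameters within one period, where the formula is the length of the shorter arc. -/
lemma intrinsicDist_add_one (h : IsRegularCurve (lift f) V c L M) {s t : ℝ} (hst : t ≤ s)
    (hts : s ≤ t + 1) : intrinsicDist f s (t + 1) = intrinsicDist f s t := by
  rw [h.intrinsicDist_of_le hts, intrinsicDist_comm, h.intrinsicDist_of_le hst, min_comm]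
  congr 1
  have := intervalIntegral.integral_comp_add_right (a := t) (b := s) (speed f) 1
  rw [← this]
  simp only [h.periodic_speed _]

/-- The deviation of a chord from its arc is cubic in the length. -/
lemma mul_integral_speed_le (h : IsRegularCurve (lift f) V c L M) {s t : ℝ} (hst : s < t)
    (hts : t ≤ s + 1 / 2) :
    (1 - 2 * (M / c) ^ 2 * (t - s) ^ 2) * (∫ r in s..t, speed f r) ≤ ‖lift f t - lift f s‖ ∧
      ‖lift f t - lift f s‖ ≤ ∫ r in s..t, speed f r := by
  have hFTC : ∫ r in s..t, V r = lift f t - lift f s :=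
    intervalIntegral.integral_eq_sub_of_hasDerivAt (fun r _ => h.hasDerivAt r)
      (h.continuous_deriv.intervalIntegrable _ _)
  have hne : lift f t - lift f s ≠ 0 := by
    rw [← norm_pos_iff]
    exact (mul_pos h.c_pos (sub_pos.2 hst)).trans_le (h.gap_le hst (by linarith)).1
  constructor
  · have h1 : inner ℝ (dir (lift f t - lift f s)) (lift f t - lift f s) = ‖lift f t - lift f s‖ := by
      have := norm_ne_zero_iff.2 hne
      rw [dir, real_inner_smul_left, real_inner_self_eq_norm_sq]
      field_simp
    set u := dir (lift f t - lift f s) with hu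
    -- The chord length is the integral of the component of V along the chord direction u, and ⟨u,
    -- τ⟩ = 1 − ‖u − τ‖²/2 loses only a quadratic term.
    have h2 : ‖lift f t - lift f s‖ = ∫ r in s..t, inner ℝ u (V r) := by
      rw [← h1, ← hFTC]
      exact ((innerSL ℝ u).intervalIntegral_comp_comm
        (h.continuous_deriv.intervalIntegrable s t)).symm
    rw [h2, ← intervalIntegral.integral_const_mul]
    refine intervalIntegral.integral_mono_on hst.le
      ((h.intervalIntegrable_speed s t).const_mul _)
      ((continuous_const.inner h.continuous_deriv).intervalIntegrable _ _) fun r hr => ?_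
    have h3 := h.norm_dir_chord_sub_dir_deriv_le hst hr
    have h4 := pow_le_pow_left₀ (norm_nonneg _) h3 2
    rw [two_sub_norm_sub_sq hne (h.deriv_ne_zero r), ← hu] at h4
    have h5 : inner ℝ u (V r) = ‖V r‖ * inner ℝ u (dir (V r)) := by
      rw [← real_inner_smul_right, norm_smul_dir]
    rw [h5, h.speed_eq, mul_comm]
    refine mul_le_mul_of_nonneg_left ?_ (norm_nonneg _)
    have e : (2 * M / c * (t - s)) ^ 2 = 4 * ((M / c) ^ 2 * (t - s) ^ 2) := by ring
    rw [e] at h4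
    linarith
  · rw [← hFTC]
    refine (intervalIntegral.norm_integral_le_integral_norm hst.le).trans (le_of_eq ?_)
    simp only [h.speed_eq]

end IsRegularCurve

end

section

open Set MeasureTheory Filter Topology

/-! ### Integrability of the densities -/

/-- If t is more than half a period behind s, symmetry and a shift replace (s, t) by (t, s + 1),
which is short; the ends of the range fall on the diagonal. -/
lemma abs_le_of_short {d : ℝ × ℝ → ℝ} {C : ℝ} (hC : 0 ≤ C) (hsymm : ∀ s t, d (s, t) = d (t, s))
    (hshift : ∀ s t, t ≤ s → s ≤ t + 1 → d (s, t + 1) = d (s, t)) (hdiag : ∀ s, d (s, s) = 0)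
    (hshort : ∀ s t, s < t → t ≤ s + 1 / 2 → |d (s, t)| ≤ C) {s t : ℝ} (hst : |s - t| ≤ 1) :
    |d (s, t)| ≤ C := by
  have main : ∀ {s t : ℝ}, s ≤ t → t ≤ s + 1 → |d (s, t)| ≤ C := by
    intro s t hst hts
    rcases hst.eq_or_lt with rfl | hlt
    · rwa [hdiag, abs_zero]
    by_cases hle : t ≤ s + 1 / 2
    · exact hshort s t hlt hle
    · rw [hsymm, ← hshift t s hst hts]
      rcases hts.eq_or_lt with rfl | hlt'
      · rwa [hdiag, abs_zero]
      · exact hshort _ _ hlt' (by linarith)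
  rw [abs_le] at hst
  rcases le_total s t with hle | hle
  · exact main hle (by linarith)
  · rw [hsymm]
    exact main hle (by linarith)

lemma integrableOn_unitSquare_of_bounded {d : ℝ × ℝ → ℝ} {C : ℝ} (hd : Measurable d)
    (hC : ∀ s t, |s - t| ≤ 1 → |d (s, t)| ≤ C) : IntegrableOn d unitSquare := by
  refine Measure.integrableOn_of_bounded (M := C)
    (isCompact_Icc.prod isCompact_Icc).measure_lt_top.ne hd.aestronglyMeasurable ?_
  refine (ae_restrict_iff' (measurableSet_Icc.prod measurableSet_Icc)).2 (ae_of_all _ ?_)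
  rintro ⟨s, t⟩ ⟨hs, ht⟩
  simp only at hs ht
  exact hC s t (by rw [abs_le]; constructor <;> linarith [hs.1, hs.2, ht.1, ht.2])

namespace IsRegularCurve

variable {n : ℕ} {f : UnitAddCircle → Space n} {V : ℝ → Space n} {c L M : ℝ}

lemma measurable_dir_deriv (h : IsRegularCurve (lift f) V c L M) :
    Measurable fun t => dir (V t) :=
  h.continuous_deriv.measurable.norm.inv.smul h.continuous_deriv.measurable

lemma continuous_intrinsicDist (h : IsRegularCurve (lift f) V c L M) :
    Continuous fun x : ℝ × ℝ => intrinsicDist f x.1 x.2 := by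
  have hA : Continuous fun t => ∫ r in (0 : ℝ)..t, speed f r :=
    intervalIntegral.continuous_primitive h.intervalIntegrable_speed 0
  have e : ∀ x : ℝ × ℝ, ∫ r in x.1..x.2, speed f r =
      (∫ r in (0 : ℝ)..x.2, speed f r) - ∫ r in (0 : ℝ)..x.1, speed f r := fun x =>
    (intervalIntegral.integral_interval_sub_left (h.intervalIntegrable_speed _ _)
      (h.intervalIntegrable_speed _ _)).symm
  simp only [intrinsicDist, e]
  have := (hA.comp continuous_snd).sub (hA.comp continuous_fst)
  exact this.abs.min (continuous_const.sub this.abs)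

lemma measurable_moebiusDensity (h : IsRegularCurve (lift f) V c L M) :
    Measurable (moebiusDensity f) := by
  have hF := h.continuous.measurable
  have hs := h.continuous_speed.measurable
  exact ((measurable_const.div (((hF.comp measurable_fst).sub
    (hF.comp measurable_snd)).norm.pow_const 2)).sub
    (measurable_const.div (h.continuous_intrinsicDist.measurable.pow_const 2))).mul
    ((hs.comp measurable_fst).mul (hs.comp measurable_snd))

lemma measurable_moebiusDensity₁ (h : IsRegularCurve (lift f) V c L M) :
    Measurable (moebiusDensity₁ f) := by
  have hF := h.continuous.measurable
  have hs := h.continuous_speed.measurable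
  have hτ : Measurable (tangent f) := by
    rw [funext h.tangent_eq]
    exact h.measurable_dir_deriv
  exact ((((hτ.comp measurable_fst).sub (hτ.comp measurable_snd)).norm.pow_const 2).div
    (((hF.comp measurable_fst).sub (hF.comp measurable_snd)).norm.pow_const 2)).mul
    ((hs.comp measurable_fst).mul (hs.comp measurable_snd))

lemma measurable_moebiusDensity₂ (h : IsRegularCurve (lift f) V c L M) :
    Measurable (moebiusDensity₂ f) := by
  have hF := h.continuous.measurable
  have hV := h.continuous_deriv.measurable
  have hτ := h.measurable_dir_deriv
  have hv := (hF.comp measurable_snd).sub (hF.comp measurable_fst)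
  have e : moebiusDensity₂ f = fun x : ℝ × ℝ => _ := funext fun x => h.moebiusDensity₂_eq x.1 x.2
  rw [e]
  have hτ₁ : Measurable fun x : ℝ × ℝ => dir (V x.1) := hτ.comp measurable_fst
  have hτ₂ : Measurable fun x : ℝ × ℝ => dir (V x.2) := hτ.comp measurable_snd
  exact ((((measurable_const.mul (hτ₁.inner hτ₂)).div (hv.norm.pow_const 2))).sub
    (((measurable_const.mul (hv.inner hτ₁)).mul (hv.inner hτ₂)).div (hv.norm.pow_const 4))).mul
    ((hV.comp measurable_fst).norm.mul (hV.comp measurable_snd).norm)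

lemma moebiusDensity_comm (s t : ℝ) : moebiusDensity f (s, t) = moebiusDensity f (t, s) := by
  simp only [moebiusDensity, norm_sub_rev (lift f s), intrinsicDist_comm s t, mul_comm (speed f s)]

lemma moebiusDensity₁_comm (s t : ℝ) : moebiusDensity₁ f (s, t) = moebiusDensity₁ f (t, s) := by
  simp only [moebiusDensity₁, norm_sub_rev (lift f s), norm_sub_rev (tangent f s),
    mul_comm (speed f s)]

lemma moebiusDensity₂_comm (h : IsRegularCurve (lift f) V c L M) (s t : ℝ) :
    moebiusDensity₂ f (s, t) = moebiusDensity₂ f (t, s) := by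
  rw [h.moebiusDensity₂_eq, h.moebiusDensity₂_eq, norm_sub_rev (lift f s),
    ← neg_sub (lift f t) (lift f s), inner_neg_left, inner_neg_left,
    real_inner_comm (dir (V s)) (dir (V t))]
  ring

lemma moebiusDensity_add_one (h : IsRegularCurve (lift f) V c L M) (s t : ℝ) (hts : t ≤ s)
    (hst : s ≤ t + 1) : moebiusDensity f (s, t + 1) = moebiusDensity f (s, t) := by
  simp only [moebiusDensity, h.periodic t, h.periodic_speed t, h.intrinsicDist_add_one hts hst]

lemma moebiusDensity₁_add_one (h : IsRegularCurve (lift f) V c L M) (s t : ℝ) :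
    moebiusDensity₁ f (s, t + 1) = moebiusDensity₁ f (s, t) := by
  simp only [h.moebiusDensity₁_eq, h.periodic t, h.periodic_deriv t]

lemma moebiusDensity₂_add_one (h : IsRegularCurve (lift f) V c L M) (s t : ℝ) :
    moebiusDensity₂ f (s, t + 1) = moebiusDensity₂ f (s, t) := by
  simp only [h.moebiusDensity₂_eq, h.periodic t, h.periodic_deriv t]

lemma speed_mul_speed_le (h : IsRegularCurve (lift f) V c L M) (s t : ℝ) :
    ‖V s‖ * ‖V t‖ ≤ L ^ 2 := by
  rw [pow_two]
  exact mul_le_mul (h.norm_deriv_le s) (h.norm_deriv_le t) (norm_nonneg _) h.L_pos.le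

lemma one_div_sq_norm_le (h : IsRegularCurve (lift f) V c L M) {s t : ℝ} (hst : s < t)
    (hts : t ≤ s + 1 / 2) :
    1 / ‖lift f t - lift f s‖ ^ 2 ≤ 1 / (c * (t - s)) ^ 2 := by
  have h1 := (h.gap_le hst (by linarith)).1
  have h2 : 0 < c * (t - s) := mul_pos h.c_pos (sub_pos.2 hst)
  exact one_div_le_one_div_of_le (by positivity) (pow_le_pow_left₀ h2.le h1 2)

lemma exists_abs_moebiusDensity₁_le (h : IsRegularCurve (lift f) V c L M) :
    ∃ C, ∀ s t, |s - t| ≤ 1 → |moebiusDensity₁ f (s, t)| ≤ C := by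
  have hc := h.c_pos
  refine ⟨(2 * M / c) ^ 2 / c ^ 2 * L ^ 2, fun s t hst => abs_le_of_short (by positivity)
    moebiusDensity₁_comm (fun s t _ _ => h.moebiusDensity₁_add_one s t)
    (fun s => by simp [moebiusDensity₁]) (fun s t hst hts => ?_) hst⟩
  have hp : 0 < t - s := sub_pos.2 hst
  have h1 := pow_le_pow_left₀ (norm_nonneg _) (h.norm_dir_deriv_sub_le s t) 2
  rw [abs_sub_comm, abs_of_pos hp] at h1
  simp only [moebiusDensity₁, h.tangent_eq, h.speed_eq]
  rw [abs_of_nonneg (by positivity), norm_sub_rev (lift f s), div_eq_mul_one_div]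
  calc _ ≤ (2 * M / c * (t - s)) ^ 2 * (1 / (c * (t - s)) ^ 2) * L ^ 2 :=
        mul_le_mul (mul_le_mul h1 (h.one_div_sq_norm_le hst hts) (by positivity) (by positivity))
          (h.speed_mul_speed_le s t) (by positivity) (by positivity)
    _ = _ := by field_simp

/-- Both tangents are within O(t − s) of the chord direction, so the product of their components
orthogonal to the chord is O((t − s)²) and cancels the singularity of 1/‖Δf‖². -/
lemma exists_abs_moebiusDensity₂_le (h : IsRegularCurve (lift f) V c L M) :
    ∃ C, ∀ s t, |s - t| ≤ 1 → |moebiusDensity₂ f (s, t)| ≤ C := by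
  have hc := h.c_pos
  refine ⟨2 * (2 * M / c) ^ 2 / c ^ 2 * L ^ 2, fun s t hst => abs_le_of_short (by positivity)
    h.moebiusDensity₂_comm (fun s t _ _ => h.moebiusDensity₂_add_one s t)
    (fun s => by simp [h.moebiusDensity₂_eq]) (fun s t hst hts => ?_) hst⟩
  have hp : 0 < t - s := sub_pos.2 hst
  have hne : lift f t - lift f s ≠ 0 := by
    rw [← norm_pos_iff]
    exact (mul_pos hc hp).trans_le (h.gap_le hst (by linarith)).1
  have h1 := h.norm_dir_chord_sub_dir_deriv_le hst (left_mem_Icc.2 hst.le)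
  have h2 := h.norm_dir_chord_sub_dir_deriv_le hst (right_mem_Icc.2 hst.le)
  rw [norm_sub_rev] at h1 h2
  have h3 := (abs_inner_sub_inner_mul_inner_le (norm_dir (h.deriv_ne_zero s))
    (norm_dir (h.deriv_ne_zero t)) (norm_dir hne)).trans
    (mul_le_mul h1 h2 (norm_nonneg _) ((norm_nonneg _).trans h1))
  rw [h.moebiusDensity₂_eq_dir, abs_mul, abs_mul, div_eq_mul_one_div,
    abs_of_nonneg (a := ‖V s‖ * ‖V t‖) (by positivity),
    abs_of_nonneg (a := 2 * (1 / ‖lift f t - lift f s‖ ^ 2)) (by positivity)]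
  calc _ ≤ 2 * (1 / (c * (t - s)) ^ 2) * ((2 * M / c * (t - s)) * (2 * M / c * (t - s))) * L ^ 2 :=
        mul_le_mul (mul_le_mul (mul_le_mul_of_nonneg_left (h.one_div_sq_norm_le hst hts) two_pos.le)
          h3 (abs_nonneg _) (by positivity))
          (h.speed_mul_speed_le s t) (by positivity)
          (mul_nonneg (by positivity) (mul_self_nonneg _))
    _ = _ := by field_simp

lemma exists_abs_moebiusDensity_le (h : IsRegularCurve (lift f) V c L M) :
    ∃ C, ∀ s t, |s - t| ≤ 1 → |moebiusDensity f (s, t)| ≤ C := by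
  have hc := h.c_pos
  have hL := h.L_pos
  refine ⟨(4 * (M / c) ^ 2 / c ^ 2 + 4 * L ^ 2 / c ^ 4 + 4 / c ^ 2) * L ^ 2,
    fun s t hst => abs_le_of_short (by positivity)
    moebiusDensity_comm h.moebiusDensity_add_one
    (fun s => ?_) (fun s t hst hts => ?_) hst⟩
  · simp only [moebiusDensity, h.intrinsicDist_of_le le_rfl, sub_self, norm_zero,
      intervalIntegral.integral_same]
    have : 0 ≤ ∫ r in s..(s + 1), speed f r :=
      (mul_nonneg hc.le (by linarith)).trans (h.integral_speed_bounds (by linarith)).1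
    rw [min_eq_left this]
    simp
  have hp : 0 < t - s := sub_pos.2 hst
  obtain ⟨k1, k2⟩ := h.mul_integral_speed_le hst hts
  obtain ⟨k3, k4⟩ := h.integral_speed_bounds hst.le
  have k5 := (h.integral_speed_bounds (show t ≤ s + 1 by linarith)).1
  have hg := (h.gap_le hst (by linarith)).1
  simp only [moebiusDensity, h.speed_eq, h.intrinsicDist_of_le hst.le]
  simp only [← h.speed_eq]
  rw [abs_mul, norm_sub_rev, abs_of_nonneg (a := speed f s * speed f t)
    (by rw [h.speed_eq, h.speed_eq]; positivity)]
  refine mul_le_mul ?_ (by rw [h.speed_eq, h.speed_eq]; exact h.speed_mul_speed_le s t)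
    (by rw [h.speed_eq, h.speed_eq]; positivity) (by positivity)
  generalize (∫ r in s..t, speed f r) = A at *
  generalize (∫ r in t..(s + 1), speed f r) = A' at *
  generalize ‖lift f t - lift f s‖ = ρ at *
  have hcp : 0 < c * (t - s) := mul_pos hc hp
  have hρ : 0 < ρ := hcp.trans_le hg
  have hA : 0 < A := hcp.trans_le k3
  -- If [s, t] is the shorter arc, the cubic deviation of chord and arc cancels the singularity.
  -- Otherwise, although t − s ≤ 1/2, the other arc is shorter: then A' ≥ c/2 and L(t − s) ≥ A ≥
  -- c/2, so both terms are bounded separately.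
  rcases le_total A A' with hle | hle
  · rw [min_eq_left hle]
    have h1 : 1 / A ^ 2 ≤ 1 / ρ ^ 2 :=
      one_div_le_one_div_of_le (by positivity) (pow_le_pow_left₀ hρ.le k2 2)
    rw [abs_of_nonneg (sub_nonneg.2 h1)]
    have h2 : A ^ 2 - ρ ^ 2 ≤ 4 * (M / c) ^ 2 * (t - s) ^ 2 * A ^ 2 := by
      have h3 : A - ρ ≤ 2 * (M / c) ^ 2 * (t - s) ^ 2 * A := by linarith
      have h4 : (A - ρ) * (A + ρ) ≤ (2 * (M / c) ^ 2 * (t - s) ^ 2 * A) * (2 * A) :=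
        mul_le_mul h3 (by linarith) (by linarith) (by positivity)
      linarith
    have h5 : 1 / ρ ^ 2 - 1 / A ^ 2 ≤ 4 * (M / c) ^ 2 / c ^ 2 := by
      have e : 1 / ρ ^ 2 - 1 / A ^ 2 = (A ^ 2 - ρ ^ 2) / A ^ 2 * (1 / ρ ^ 2) := by field_simp
      rw [e]
      calc _ ≤ 4 * (M / c) ^ 2 * (t - s) ^ 2 * (1 / (c * (t - s)) ^ 2) := by
            refine mul_le_mul ?_ (one_div_le_one_div_of_le (by positivity)
              (pow_le_pow_left₀ hcp.le hg 2)) (by positivity) (by positivity)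
            rwa [div_le_iff₀ (by positivity)]
        _ = _ := by field_simp
    refine h5.trans ?_
    rw [add_assoc]
    exact le_add_of_nonneg_right (by positivity)
  · rw [min_eq_right hle]
    have hA' : c / 2 ≤ A' := by nlinarith
    have hts2 : c / (2 * L) ≤ t - s := by
      rw [div_le_iff₀ (by positivity)]
      linarith
    have hρ2 : c ^ 2 / (2 * L) ≤ ρ := by
      refine le_trans ?_ hg
      calc c ^ 2 / (2 * L) = c * (c / (2 * L)) := by ring
        _ ≤ _ := mul_le_mul_of_nonneg_left hts2 hc.le
    have h1 : 1 / ρ ^ 2 ≤ 4 * L ^ 2 / c ^ 4 := by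
      calc 1 / ρ ^ 2 ≤ 1 / (c ^ 2 / (2 * L)) ^ 2 :=
            one_div_le_one_div_of_le (by positivity) (pow_le_pow_left₀ (by positivity) hρ2 2)
        _ = _ := by field_simp; norm_num
    have h2 : 1 / A' ^ 2 ≤ 4 / c ^ 2 := by
      calc 1 / A' ^ 2 ≤ 1 / (c / 2) ^ 2 :=
            one_div_le_one_div_of_le (by positivity) (pow_le_pow_left₀ (by positivity) hA' 2)
        _ = _ := by field_simp; norm_num
    have h3 : 0 ≤ 1 / ρ ^ 2 := by positivity
    have h4 : 0 ≤ 1 / A' ^ 2 := by positivity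
    have h5 : 0 ≤ 4 * (M / c) ^ 2 / c ^ 2 := by positivity
    rw [abs_le]
    constructor <;> linarith

theorem integrableOn_moebiusDensity (h : IsRegularCurve (lift f) V c L M) :
    IntegrableOn (moebiusDensity f) unitSquare :=
  let ⟨_, hC⟩ := h.exists_abs_moebiusDensity_le
  integrableOn_unitSquare_of_bounded h.measurable_moebiusDensity hC

theorem integrableOn_moebiusDensity₁ (h : IsRegularCurve (lift f) V c L M) :
    IntegrableOn (moebiusDensity₁ f) unitSquare :=
  let ⟨_, hC⟩ := h.exists_abs_moebiusDensity₁_le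
  integrableOn_unitSquare_of_bounded h.measurable_moebiusDensity₁ hC

theorem integrableOn_moebiusDensity₂ (h : IsRegularCurve (lift f) V c L M) :
    IntegrableOn (moebiusDensity₂ f) unitSquare :=
  let ⟨_, hC⟩ := h.exists_abs_moebiusDensity₂_le
  integrableOn_unitSquare_of_bounded h.measurable_moebiusDensity₂ hC

end IsRegularCurve

end

section

/-! ### The decomposition of the Möbius energy -/

open Set MeasureTheory Filter Topology

/-- The difference of the Möbius density and its two components. -/
def densityDefect {n : ℕ} (f : UnitAddCircle → Space n) (x : ℝ × ℝ) : ℝ :=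
  moebiusDensity f x - 1 / 2 * moebiusDensity₁ f x - moebiusDensity₂ f x

namespace IsRegularCurve

variable {n : ℕ} {f : UnitAddCircle → Space n} {V : ℝ → Space n} {c L M : ℝ}

/-- The logarithmic derivatives of chord length and arc length agree to first order. -/
lemma abs_log_deriv_sub_le (h : IsRegularCurve (lift f) V c L M) {s t r : ℝ} (hst : s < t)
    (hts : t ≤ s + 1 / 2) (hr : r ∈ Icc s t) :
    |inner ℝ (V r) (lift f t - lift f s) / ‖lift f t - lift f s‖ ^ 2 -
      ‖V r‖ / ∫ q in s..t, speed f q| ≤ L * (2 * (M / c) ^ 2 / c) * (t - s) := by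
  have hc := h.c_pos
  have hp : 0 < t - s := sub_pos.2 hst
  obtain ⟨k1, k2⟩ := h.mul_integral_speed_le hst hts
  have k3 := (h.integral_speed_bounds hst.le).1
  have hg := (h.gap_le hst (by linarith)).1
  have hcp : 0 < c * (t - s) := mul_pos hc hp
  have hρ : 0 < ‖lift f t - lift f s‖ := hcp.trans_le hg
  have hne := norm_pos_iff.1 hρ
  have h1 := pow_le_pow_left₀ (norm_nonneg _) (h.norm_dir_chord_sub_dir_deriv_le hst hr) 2
  have h0 := sq_nonneg ‖dir (lift f t - lift f s) - dir (V r)‖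
  rw [two_sub_norm_sub_sq hne (h.deriv_ne_zero r)] at h1 h0
  have e : inner ℝ (V r) (lift f t - lift f s) = ‖V r‖ * ‖lift f t - lift f s‖ *
      inner ℝ (dir (lift f t - lift f s)) (dir (V r)) := by
    conv_lhs => rw [← norm_smul_dir (V r), ← norm_smul_dir (lift f t - lift f s)]
    rw [real_inner_smul_left, real_inner_smul_right, real_inner_comm]
    ring
  rw [e]
  generalize inner ℝ (dir (lift f t - lift f s)) (dir (V r)) = i at *
  generalize (∫ q in s..t, speed f q) = A at *
  generalize ‖lift f t - lift f s‖ = ρ at *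
  have hA : 0 < A := hcp.trans_le k3
  obtain ⟨κ, hκ⟩ : ∃ κ, κ = 2 * (M / c) ^ 2 * (t - s) ^ 2 := ⟨_, rfl⟩
  have hκ0 : 0 ≤ κ := by rw [hκ]; positivity
  rw [← hκ] at k1
  have h2 : 1 - i ≤ κ := by
    rw [hκ]
    have : (2 * M / c * (t - s)) ^ 2 = 4 * ((M / c) ^ 2 * (t - s) ^ 2) := by ring
    linarith
  have h3 : κ / ρ ≤ 2 * (M / c) ^ 2 / c * (t - s) := by
    calc κ / ρ ≤ κ / (c * (t - s)) := div_le_div_of_nonneg_left hκ0 hcp hg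
      _ = _ := by rw [hκ]; field_simp
  have e2 : ‖V r‖ * ρ * i / ρ ^ 2 - ‖V r‖ / A = ‖V r‖ * (i / ρ - 1 / A) := by field_simp
  rw [e2, mul_assoc L, abs_mul, abs_of_nonneg (norm_nonneg (V r))]
  refine mul_le_mul (h.norm_deriv_le r) (le_trans ?_ h3) (abs_nonneg _) h.L_pos.le
  have h4 : 1 / A ≤ 1 / ρ := one_div_le_one_div_of_le hρ k2
  rw [abs_le]
  constructor
  · have : (1 - i) / ρ ≤ κ / ρ := div_le_div_of_nonneg_right h2 hρ.le
    rw [sub_div] at this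
    linarith
  · have h5 : 1 / ρ - 1 / A ≤ κ / ρ := by
      have : 1 / ρ - 1 / A = (A - ρ) / A * (1 / ρ) := by field_simp
      rw [this, div_eq_mul_one_div κ]
      refine mul_le_mul_of_nonneg_right ?_ (by positivity)
      rw [div_le_iff₀ hA]
      linarith
    have h6 : i / ρ ≤ 1 / ρ := div_le_div_of_nonneg_right (by linarith) hρ.le
    linarith

/-- The function differentiated is the x-derivative of log ‖Δf‖. With V x held fixed, only the first
derivative of the curve is needed for the mixed derivative. -/
lemma hasDerivAt_log_deriv (h : IsRegularCurve (lift f) V c L M) {x y : ℝ}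
    (hxy : lift f x ≠ lift f y) :
    HasDerivAt (fun y => inner ℝ (V x) (lift f x - lift f y) / ‖lift f x - lift f y‖ ^ 2)
      ((-(inner ℝ (V x) (V y) * ‖lift f x - lift f y‖ ^ 2) +
        2 * inner ℝ (V x) (lift f x - lift f y) * inner ℝ (lift f x - lift f y) (V y)) /
        (‖lift f x - lift f y‖ ^ 2) ^ 2) y := by
  have hd : HasDerivAt (fun y => lift f x - lift f y) (-V y) y :=
    (h.hasDerivAt y).const_sub (lift f x)
  have h1 := (hasDerivAt_const y (V x)).inner ℝ hd
  have h2 := hd.norm_sq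
  have hne : ‖lift f x - lift f y‖ ^ 2 ≠ 0 :=
    pow_ne_zero 2 (norm_ne_zero_iff.2 (sub_ne_zero.2 hxy))
  refine (h1.div h2 hne).congr_deriv ?_
  simp only [inner_zero_left, add_zero, inner_neg_right]
  ring

lemma hasDerivAt_integral_speed_right (h : IsRegularCurve (lift f) V c L M) (x y : ℝ) :
    HasDerivAt (fun y => ∫ r in x..y, speed f r) (‖V y‖) y := by
  rw [← h.speed_eq]
  exact intervalIntegral.integral_hasDerivAt_right (h.intervalIntegrable_speed _ _)
    (h.continuous_speed.stronglyMeasurableAtFilter _ _) h.continuous_speed.continuousAt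

lemma hasDerivAt_integral_speed_left (h : IsRegularCurve (lift f) V c L M) (x y : ℝ) :
    HasDerivAt (fun y => ∫ r in y..x, speed f r) (-‖V y‖) y := by
  rw [← h.speed_eq]
  exact intervalIntegral.integral_hasDerivAt_left (h.intervalIntegrable_speed _ _)
    (h.continuous_speed.stronglyMeasurableAtFilter _ _) h.continuous_speed.continuousAt

lemma lift_ne (h : IsRegularCurve (lift f) V c L M) {x y : ℝ} (hxy : x < y) (hyx : y < x + 1) :
    lift f x ≠ lift f y := by
  intro he
  rcases h.sub_eq_of_eq (by rw [abs_le]; constructor <;> linarith) he with h' | h' | h' <;> linarith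

lemma integral_speed_pos (h : IsRegularCurve (lift f) V c L M) {s t : ℝ} (hst : s < t) :
    0 < ∫ r in s..t, speed f r :=
  (mul_pos h.c_pos (sub_pos.2 hst)).trans_le (h.integral_speed_bounds hst.le).1

lemma measurable_densityDefect (h : IsRegularCurve (lift f) V c L M) :
    Measurable (densityDefect f) :=
  (h.measurable_moebiusDensity.sub (h.measurable_moebiusDensity₁.const_mul _)).sub
    h.measurable_moebiusDensity₂

lemma exists_abs_densityDefect_le (h : IsRegularCurve (lift f) V c L M) :
    ∃ C, ∀ s t, |s - t| ≤ 1 → |densityDefect f (s, t)| ≤ C := by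
  obtain ⟨C₀, h₀⟩ := h.exists_abs_moebiusDensity_le
  obtain ⟨C₁, h₁⟩ := h.exists_abs_moebiusDensity₁_le
  obtain ⟨C₂, h₂⟩ := h.exists_abs_moebiusDensity₂_le
  refine ⟨C₀ + C₁ + C₂, fun s t hst => ?_⟩
  have a₀ := h₀ s t hst
  have a₁ := h₁ s t hst
  have a₂ := h₂ s t hst
  rw [densityDefect]
  rw [abs_le] at a₀ a₁ a₂ ⊢
  constructor <;> linarith

lemma intervalIntegrable_densityDefect (h : IsRegularCurve (lift f) V c L M) {x a b : ℝ}
    (hab : a ≤ b) (ha : x - 1 ≤ a) (hb : b ≤ x + 1) :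
    IntervalIntegrable (fun y => densityDefect f (x, y)) volume a b := by
  obtain ⟨C, hC⟩ := h.exists_abs_densityDefect_le
  rw [intervalIntegrable_iff_integrableOn_Ioc_of_le hab]
  refine Measure.integrableOn_of_bounded (M := C) measure_Ioc_lt_top.ne
    (h.measurable_densityDefect.comp measurable_prodMk_left).aestronglyMeasurable ?_
  refine (ae_restrict_iff' measurableSet_Ioc).2 (ae_of_all _ fun y hy => hC x y ?_)
  rw [abs_le]
  constructor <;> linarith [hy.1, hy.2]

/-- Integration of the defect over the half of the curve following `x`. -/
lemma integral_densityDefect_right (h : IsRegularCurve (lift f) V c L M) {x y : ℝ} (hxy : x < y)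
    (hyx : y < x + 1) (hhalf : ∫ r in x..y, speed f r = ∫ r in y..(x + 1), speed f r) :
    ∫ q in x..y, densityDefect f (x, q) =
      inner ℝ (V x) (lift f x - lift f y) / ‖lift f x - lift f y‖ ^ 2 +
        ‖V x‖ / ∫ r in x..y, speed f r := by
  -- Φ is the x-derivative of log ‖Δf‖ plus the primitive in q of −‖V x‖‖V q‖/𝒟², valid as long as
  -- the arc from x to q is the shorter one.
  let Φ : ℝ → ℝ := fun q => inner ℝ (V x) (lift f x - lift f q) / ‖lift f x - lift f q‖ ^ 2 +
    ‖V x‖ / ∫ r in x..q, speed f r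
  have hΦ : ∀ q, x < q → q < x + 1 → HasDerivAt Φ
      ((-(inner ℝ (V x) (V q) * ‖lift f x - lift f q‖ ^ 2) +
        2 * inner ℝ (V x) (lift f x - lift f q) * inner ℝ (lift f x - lift f q) (V q)) /
        (‖lift f x - lift f q‖ ^ 2) ^ 2 - ‖V x‖ * ‖V q‖ / (∫ r in x..q, speed f r) ^ 2) q := by
    intro q hq hq'
    have h1 := (hasDerivAt_const q ‖V x‖).div (h.hasDerivAt_integral_speed_right x q)
      (h.integral_speed_pos hq).ne'
    refine ((h.hasDerivAt_log_deriv (h.lift_ne hq hq')).add h1).congr_deriv ?_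
    ring
  have hderiv : ∀ q ∈ Ioo x y, HasDerivAt Φ (densityDefect f (x, q)) q := by
    intro q hq
    refine (hΦ q hq.1 (hq.2.trans hyx)).congr_deriv ?_
    rw [densityDefect, h.moebiusDensity_sub_eq, h.intrinsicDist_of_le hq.1.le, min_eq_left]
    have h1 := intervalIntegral.integral_add_adjacent_intervals
      (h.intervalIntegrable_speed x q) (h.intervalIntegrable_speed q y)
    have h2 := intervalIntegral.integral_add_adjacent_intervals
      (h.intervalIntegrable_speed q y) (h.intervalIntegrable_speed y (x + 1))
    have h3 := h.integral_speed_pos hq.2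
    linarith
  -- Both terms are singular at x, but chord and arc have the same logarithmic derivative up to O(q
  -- − x).
  have hleft : Tendsto Φ (𝓝[>] x) (𝓝 0) := by
    have hb : Tendsto (fun q => L * (2 * (M / c) ^ 2 / c) * (q - x)) (𝓝[>] x) (𝓝 0) := by
      have : Tendsto (fun q => L * (2 * (M / c) ^ 2 / c) * (q - x)) (𝓝 x)
          (𝓝 (L * (2 * (M / c) ^ 2 / c) * (x - x))) :=
        (continuous_const.mul (continuous_id.sub continuous_const)).tendsto x
      rw [sub_self, mul_zero] at this
      exact this.mono_left nhdsWithin_le_nhds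
    refine squeeze_zero_norm' ?_ hb
    filter_upwards [Ioc_mem_nhdsGT (show x < x + 1 / 2 by linarith)] with q hq
    have h1 := h.abs_log_deriv_sub_le hq.1 hq.2 (left_mem_Icc.2 hq.1.le)
    rw [Real.norm_eq_abs, ← abs_neg]
    refine le_of_eq_of_le ?_ h1
    congr 1
    simp only [Φ]
    rw [← neg_sub (lift f q) (lift f x), inner_neg_right, norm_neg]
    ring
  have hright : Tendsto Φ (𝓝[<] y) (𝓝 (Φ y)) :=
    (hΦ y hxy hyx).continuousAt.tendsto.mono_left nhdsWithin_le_nhds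
  rw [intervalIntegral.integral_eq_sub_of_hasDerivAt_of_tendsto hxy hderiv
    (h.intervalIntegrable_densityDefect hxy.le (by linarith) hyx.le) hleft hright, sub_zero]

/-- Integration of the defect over the half of the curve preceding `x`. -/
lemma integral_densityDefect_left (h : IsRegularCurve (lift f) V c L M) {x y : ℝ} (hxy : x < y)
    (hyx : y < x + 1) (hhalf : ∫ r in x..y, speed f r = ∫ r in y..(x + 1), speed f r) :
    ∫ q in y..(x + 1), densityDefect f (x, q) =
      -(inner ℝ (V x) (lift f x - lift f y) / ‖lift f x - lift f y‖ ^ 2 -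
        ‖V x‖ / ∫ r in y..(x + 1), speed f r) := by
  let Φ : ℝ → ℝ := fun q => inner ℝ (V x) (lift f x - lift f q) / ‖lift f x - lift f q‖ ^ 2 -
    ‖V x‖ / ∫ r in q..(x + 1), speed f r
  have hΦ : ∀ q, x < q → q < x + 1 → HasDerivAt Φ
      ((-(inner ℝ (V x) (V q) * ‖lift f x - lift f q‖ ^ 2) +
        2 * inner ℝ (V x) (lift f x - lift f q) * inner ℝ (lift f x - lift f q) (V q)) /
        (‖lift f x - lift f q‖ ^ 2) ^ 2 -
          ‖V x‖ * ‖V q‖ / (∫ r in q..(x + 1), speed f r) ^ 2) q := by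
    intro q hq hq'
    have h1 := (hasDerivAt_const q ‖V x‖).div (h.hasDerivAt_integral_speed_left (x + 1) q)
      (h.integral_speed_pos hq').ne'
    refine ((h.hasDerivAt_log_deriv (h.lift_ne hq hq')).sub h1).congr_deriv ?_
    ring
  have hderiv : ∀ q ∈ Ioo y (x + 1), HasDerivAt Φ (densityDefect f (x, q)) q := by
    intro q hq
    refine (hΦ q (hxy.trans hq.1) hq.2).congr_deriv ?_
    rw [densityDefect, h.moebiusDensity_sub_eq, h.intrinsicDist_of_le (hxy.trans hq.1).le,
      min_eq_right]
    have h1 := intervalIntegral.integral_add_adjacent_intervals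
      (h.intervalIntegrable_speed x y) (h.intervalIntegrable_speed y q)
    have h2 := intervalIntegral.integral_add_adjacent_intervals
      (h.intervalIntegrable_speed y q) (h.intervalIntegrable_speed q (x + 1))
    have h3 := h.integral_speed_pos hq.1
    linarith
  have hright : Tendsto Φ (𝓝[<] (x + 1)) (𝓝 0) := by
    have hb : Tendsto (fun q => L * (2 * (M / c) ^ 2 / c) * (x + 1 - q)) (𝓝[<] (x + 1)) (𝓝 0) := by
      have : Tendsto (fun q => L * (2 * (M / c) ^ 2 / c) * (x + 1 - q)) (𝓝 (x + 1))
          (𝓝 (L * (2 * (M / c) ^ 2 / c) * (x + 1 - (x + 1)))) :=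
        (continuous_const.mul (continuous_const.sub continuous_id)).tendsto (x + 1)
      rw [sub_self, mul_zero] at this
      exact this.mono_left nhdsWithin_le_nhds
    refine squeeze_zero_norm' ?_ hb
    filter_upwards [Ico_mem_nhdsLT (show x + 1 / 2 < x + 1 by linarith)] with q hq
    have h1 := h.abs_log_deriv_sub_le hq.2 (by linarith [hq.1]) (right_mem_Icc.2 hq.2.le)
    rwa [h.periodic, h.periodic_deriv] at h1
  have hleft : Tendsto Φ (𝓝[>] y) (𝓝 (Φ y)) :=
    (hΦ y hxy hyx).continuousAt.tendsto.mono_left nhdsWithin_le_nhds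
  rw [intervalIntegral.integral_eq_sub_of_hasDerivAt_of_tendsto hyx hderiv
    (h.intervalIntegrable_densityDefect hyx.le (by linarith) le_rfl) hleft hright, zero_sub]

lemma exists_half_length (h : IsRegularCurve (lift f) V c L M) (x : ℝ) :
    ∃ y, x < y ∧ y < x + 1 ∧ ∫ r in x..y, speed f r = curveLength f / 2 ∧
      ∫ r in y..(x + 1), speed f r = curveLength f / 2 := by
  have hadd := h.integral_speed_add x x
  rw [intervalIntegral.integral_same, zero_add] at hadd
  have hpos := h.integral_speed_pos (show x < x + 1 by linarith)
  rw [hadd] at hpos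
  have hcont : ContinuousOn (fun y => ∫ r in x..y, speed f r) (Icc x (x + 1)) :=
    (intervalIntegral.continuous_primitive h.intervalIntegrable_speed x).continuousOn
  obtain ⟨y, hy, he⟩ := intermediate_value_Ioo (show x ≤ x + 1 by linarith) hcont
    (show curveLength f / 2 ∈ _ by
      simp only [intervalIntegral.integral_same, hadd]
      constructor <;> linarith)
  simp only at he
  have := h.integral_speed_add x y
  exact ⟨y, hy.1, hy.2, he, by linarith⟩

lemma curveLength_pos (h : IsRegularCurve (lift f) V c L M) : 0 < curveLength f :=
  h.integral_speed_pos zero_lt_one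

/-- At the point y halving the curve the two chord terms cancel, and the two arc terms add up to
twice speed / (length / 2). -/
lemma integral_densityDefect_period (h : IsRegularCurve (lift f) V c L M) (x : ℝ) :
    ∫ q in x..(x + 1), densityDefect f (x, q) = 4 * speed f x / curveLength f := by
  obtain ⟨y, hxy, hyx, h1, h2⟩ := h.exists_half_length x
  have hpos := h.curveLength_pos
  rw [← intervalIntegral.integral_add_adjacent_intervals
    (h.intervalIntegrable_densityDefect hxy.le (by linarith) hyx.le)
    (h.intervalIntegrable_densityDefect hyx.le (by linarith) le_rfl),
    h.integral_densityDefect_right hxy hyx (h1.trans h2.symm),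
    h.integral_densityDefect_left hxy hyx (h1.trans h2.symm), h1, h2, h.speed_eq]
  field_simp
  ring

/-- The piece [0, x] of the unit interval is moved by one period to [1, x + 1], where the singular
point x is an end point of the interval of integration. -/
lemma integral_densityDefect_unit (h : IsRegularCurve (lift f) V c L M) {x : ℝ}
    (hx : x ∈ Icc (0 : ℝ) 1) :
    ∫ y in (0 : ℝ)..1, densityDefect f (x, y) = 4 * speed f x / curveLength f := by
  rw [← h.integral_densityDefect_period x, ← intervalIntegral.integral_add_adjacent_intervals
    (h.intervalIntegrable_densityDefect hx.1 (by linarith [hx.2]) (by linarith))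
    (h.intervalIntegrable_densityDefect hx.2 (by linarith) (by linarith [hx.1])),
    ← intervalIntegral.integral_add_adjacent_intervals
    (h.intervalIntegrable_densityDefect (x := x) (a := x) (b := 1) hx.2 (by linarith)
      (by linarith [hx.1]))
    (h.intervalIntegrable_densityDefect (x := x) (a := 1) (b := x + 1) (by linarith [hx.1])
      (by linarith [hx.2]) le_rfl), add_comm]
  congr 1
  have := intervalIntegral.integral_comp_add_right (a := 0) (b := x)
    (fun y => densityDefect f (x, y)) 1
  rw [zero_add] at this
  rw [← this]
  refine intervalIntegral.integral_congr fun y hy => ?_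
  rw [uIcc_of_le hx.1] at hy
  simp only [densityDefect]
  rw [h.moebiusDensity_add_one x y hy.2 (by linarith [hx.2, hy.1]), h.moebiusDensity₁_add_one,
    h.moebiusDensity₂_add_one]

/-- The decomposition of the Möbius energy into its two components. -/
theorem moebiusEnergy_eq (h : IsRegularCurve (lift f) V c L M) :
    moebiusEnergy f = moebiusEnergy₁ f + moebiusEnergy₂ f + 4 := by
  have i₀ := h.integrableOn_moebiusDensity
  have i₁ := h.integrableOn_moebiusDensity₁
  have i₂ := h.integrableOn_moebiusDensity₂
  have key : ∫ x in unitSquare, densityDefect f x = 4 := by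
    have hint : IntegrableOn (densityDefect f) (Icc (0 : ℝ) 1 ×ˢ Icc (0 : ℝ) 1)
        ((volume : Measure ℝ).prod volume) := (i₀.sub (i₁.const_mul _)).sub i₂
    rw [unitSquare, Measure.volume_eq_prod, setIntegral_prod _ hint]
    have inner : ∀ x ∈ Icc (0 : ℝ) 1, ∫ y in Icc (0 : ℝ) 1, densityDefect f (x, y) =
        4 / curveLength f * speed f x := by
      intro x hx
      rw [integral_Icc_eq_integral_Ioc, ← intervalIntegral.integral_of_le zero_le_one,
        h.integral_densityDefect_unit hx]
      ring
    rw [setIntegral_congr_fun measurableSet_Icc inner, integral_const_mul,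
      integral_Icc_eq_integral_Ioc, ← intervalIntegral.integral_of_le zero_le_one]
    have := h.curveLength_pos
    change 4 / curveLength f * curveLength f = 4
    field_simp
  have hsplit : ∫ x in unitSquare, densityDefect f x = (∫ x in unitSquare, moebiusDensity f x) -
      1 / 2 * (∫ x in unitSquare, moebiusDensity₁ f x) -
      ∫ x in unitSquare, moebiusDensity₂ f x := by
    have i₁' : IntegrableOn (fun x => 1 / 2 * moebiusDensity₁ f x) unitSquare := i₁.const_mul _
    have i₀₁ : IntegrableOn (fun x => moebiusDensity f x - 1 / 2 * moebiusDensity₁ f x)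
      unitSquare := i₀.sub i₁'
    simp only [densityDefect]
    rw [integral_sub i₀₁ i₂, integral_sub i₀ i₁', integral_const_mul]
  rw [moebiusEnergy, moebiusEnergy₁, moebiusEnergy₂]
  linarith

/-! ### Convergence of the discrete energies -/

variable {θ : (m : ℕ) → Fin m → ℝ}

theorem tendsto_discreteEnergy₁ (h : IsRegularCurve (lift f) V c L M)
    (hθ : ∀ᶠ m in atTop, IsSubdivision (θ m) ∧ IsEquilateral (inscribedPolygon f (θ m))) :
    Tendsto (fun m => discreteEnergy₁ m n (inscribedPolygon f (θ m))) atTop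
      (𝓝 (moebiusEnergy₁ f)) := by
  obtain ⟨C, hC, hT⟩ := h.exists_energyTerm_le
  rw [moebiusEnergy₁, ← integral_const_mul]
  simp only [discreteEnergy₁_eq_sum]
  refine h.tendsto_sum_term rfl hC energyTerm₁_swap (fun hℓ hp => (hT hℓ hp).1) ?_ hθ
  intro X₀ X₁ X₂ Y₀ Y₁ Y₂ ℓ x y h1 h2 h3 h4 h5 h6 h7 h8 h9 h10 h11 h12 h13 h14 h15 hxy
  rw [h.moebiusDensity₁_eq, ← mul_assoc, one_div_mul_cancel two_ne_zero, one_mul]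
  exact (h.tendsto_energyTerm_div h1 h2 h3 h4 h5 h6 h7 h8 h9 h10 h11 h12 h13 h14 h15 hxy).1

theorem tendsto_discreteEnergy₂ (h : IsRegularCurve (lift f) V c L M)
    (hθ : ∀ᶠ m in atTop, IsSubdivision (θ m) ∧ IsEquilateral (inscribedPolygon f (θ m))) :
    Tendsto (fun m => discreteEnergy₂ m n (inscribedPolygon f (θ m))) atTop
      (𝓝 (moebiusEnergy₂ f)) := by
  obtain ⟨C, hC, hT⟩ := h.exists_energyTerm_le
  simp only [discreteEnergy₂_eq_sum]
  refine h.tendsto_sum_term rfl hC energyTerm₂_swap (fun hℓ hp => (hT hℓ hp).2) ?_ hθ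
  intro X₀ X₁ X₂ Y₀ Y₁ Y₂ ℓ x y h1 h2 h3 h4 h5 h6 h7 h8 h9 h10 h11 h12 h13 h14 h15 hxy
  rw [h.moebiusDensity₂_eq]
  exact (h.tendsto_energyTerm_div h1 h2 h3 h4 h5 h6 h7 h8 h9 h10 h11 h12 h13 h14 h15 hxy).2

end IsRegularCurve

end

end DiscreteMoebius

end

theorem mainTheorem1 (n : ℕ) :
    (∀ (m : ℕ) (p : DiscreteMoebius.Polygon m n),
      DiscreteMoebius.discreteEnergy m n p =
        DiscreteMoebius.discreteEnergy₁ m n p + DiscreteMoebius.discreteEnergy₂ m n p + 4) ∧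
    (∀ m : ℕ,
      DiscreteMoebius.IsMoebiusInvariant (DiscreteMoebius.discreteEnergy m n) ∧
      DiscreteMoebius.IsMoebiusInvariant (DiscreteMoebius.discreteEnergy₁ m n) ∧
      DiscreteMoebius.IsMoebiusInvariant (DiscreteMoebius.discreteEnergy₂ m n)) ∧
    (∀ f : UnitAddCircle → DiscreteMoebius.Space n,
      DiscreteMoebius.MemW2Infty f → DiscreteMoebius.IsBiLipschitz f →
      (MeasureTheory.IntegrableOn (DiscreteMoebius.moebiusDensity f) DiscreteMoebius.unitSquare ∧
        MeasureTheory.IntegrableOn (DiscreteMoebius.moebiusDensity₁ f) DiscreteMoebius.unitSquare ∧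
        MeasureTheory.IntegrableOn (DiscreteMoebius.moebiusDensity₂ f)
          DiscreteMoebius.unitSquare) ∧
      ∀ θ : (m : ℕ) → Fin m → ℝ,
        (∀ᶠ m in Filter.atTop, DiscreteMoebius.IsSubdivision (θ m) ∧
          DiscreteMoebius.IsEquilateral (DiscreteMoebius.inscribedPolygon f (θ m))) →
        Filter.Tendsto
          (fun m => DiscreteMoebius.discreteEnergy m n (DiscreteMoebius.inscribedPolygon f (θ m)))
          Filter.atTop (nhds (DiscreteMoebius.moebiusEnergy f)) ∧
        Filter.Tendsto
          (fun m => DiscreteMoebius.discreteEnergy₁ m n (DiscreteMoebius.inscribedPolygon f (θ m)))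
          Filter.atTop (nhds (DiscreteMoebius.moebiusEnergy₁ f)) ∧
        Filter.Tendsto
          (fun m => DiscreteMoebius.discreteEnergy₂ m n (DiscreteMoebius.inscribedPolygon f (θ m)))
          Filter.atTop (nhds (DiscreteMoebius.moebiusEnergy₂ f))) := by
  refine ⟨fun m p => rfl, fun m =>
    ⟨DiscreteMoebius.isMoebiusInvariant_discreteEnergy m n,
      DiscreteMoebius.isMoebiusInvariant_discreteEnergy₁ m n,
      DiscreteMoebius.isMoebiusInvariant_discreteEnergy₂ m n⟩, fun f hW hL => ?_⟩
  obtain ⟨V, c, L, M, h⟩ := DiscreteMoebius.exists_isRegularCurve hW hL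
  refine ⟨⟨h.integrableOn_moebiusDensity, h.integrableOn_moebiusDensity₁,
    h.integrableOn_moebiusDensity₂⟩, fun θ hθ => ?_⟩
  have h₁ := h.tendsto_discreteEnergy₁ hθ
  have h₂ := h.tendsto_discreteEnergy₂ hθ
  refine ⟨?_, h₁, h₂⟩
  rw [h.moebiusEnergy_eq]
  exact (h₁.add h₂).add_const 4
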